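/- **Theorem 1.1.** Let $N\ge 1$, $q\in(0,1)$, $a_1,\dots,a_N>0$, and let $\mathsf R,\mathsf L\ge 0$ be not both zero. The $N$-particle $q$-PushASEP is the continuous-time Markov process $\mathbf x(t)=(x_1(t)>x_2(t)>\dots>x_N(t))$ on strictly decreasing $N$-tuples of integers with the following dynamics. Put $x_0=+\infty$, $x_{N+1}=-\infty$, $\mathrm{gap}_i=x_{i-1}-x_i-1$ and $q^{+\infty}=0$. * Right jumps: the particle $x_i$ jumps to $x_i+1$ at rate $a_i\mathsf R\,(1-q^{\mathrm{gap}_i})$. * Left jumps: the particle $x_i$ jumps to $x_i-1$ at rate $a_i^{-1}\mathsf L$. Whenever a particle $x_j$ with $j<N$ has moved to the left (by itself or because it was pushed), it instantaneously pushes $x_{j+1}$ to the left by one with probability $q^{\mathrm{gap}_{j+1}}$ (the gap being taken before the move), so that pushes may propagate. Thus its Markov generator is $$(\mathscr L f)(\mathbf x)=\sum_{i=1}^N a_i\mathsf R\,(1-q^{\mathrm{gap}_i})\big(f(\mathbf x_i^+)-f(\mathbf x)\big)+\sum_{i=1}^N a_i^{-1}\mathsf L\sum_{j=i}^N\Big(\prod_{m=i+1}^{j}q^{\mathrm{gap}_m}\Big)(1-q^{\mathrm{gap}_{j+1}})\big(f(\mathbf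 x^-_{j,i})-f(\mathbf x)\big),$$ where $\mathbf x_i^+$ is $\mathbf x$ with $x_i$ replaced by $x_i+1$, and $\mathbf x_{j,i}^-$ is $\mathbf x$ with $x_m$ replaced by $x_m-1$ for $i\le m\le j$. Start the process from the step initial condition $x_i(0)=-i$, $1\le i\le N$. Let $k\ge 0$, let $\mathbf n=(n_1,\dots,n_k)\in\mathbb Z^k$ with $N\ge n_1\ge\dots\ge n_k\ge 0$, and let $t\ge 0$. With the convention $q^{x_0(t)+0}=0$, the random variable $\prod_{i=1}^k q^{x_{n_i}(t)+n_i}$ is integrable and $$\mathbb E\Big(\prod_{i=1}^{k}q^{x_{n_i}(t)+n_i}\Big)=\frac{(-1)^kq^{k(k-1)/2}}{(2\pi \mathrm i)^k}\oint\cdots\oint\ \prod_{1\le A<B\le k}\frac{z_A-z_B}{z_A-qz_B}\ \prod_{j=1}^k\Big(\prod_{i=1}^{n_j}\frac{a_i}{a_i-z_j}\Big)\frac{\Pi_t(qz_j)}{\Pi_t(z_j)}\,\frac{dz_j}{z_j},\qquad \Pi_t(z)=e^{t(\mathsf Rz+\mathsf Lz^{-1})}.$$ Here the variables $z_1,\dots,z_k$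 run over any closed piecewise continuously differentiable contours $\gamma_1,\dots,\gamma_k$ such that, for every $A$, the contour $\gamma_A$ contains $a_1,\dots,a_N$ and all points of the contours $q\gamma_B$ with $B>A$, but does not contain zero. (A contour contains, respectively does not contain, a point if the point is not on the contour and the winding number of the contour around it is $1$, respectively $0$.) Such contours exist. -/

import Mathlib

open MeasureTheory ProbabilityTheory Filter Topology
open scoped NNReal

noncomputable section

namespace QPushASEP

/-! ### The particle system

A configuration of `N` particles is a strictly decreasing `x : Fin N → ℤ`.  Indices are
zero-based: `x m` is the position of the particle that is called `x_{m+1}` in one-based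
numbering, so that `x 0` is the rightmost particle. -/

/-- `q` raised to the number of empty sites in front of the particle with zero-based index `m`
(the gap between the particles `m - 1` and `m`).  The first particle has an infinite gap in front
of it, and there is an infinite gap behind the last particle (the case `m = N`, a virtual particle
at `-∞`); there `q ^ ∞ = 0`. -/
def qGap {N : ℕ} (q : ℝ) (x : Fin N → ℤ) (m : ℕ) : ℝ :=
  if h : 0 < m ∧ m < N then q ^ (x ⟨m - 1, by omega⟩ - x ⟨m, h.2⟩ - 1) else 0

/-- The particle `i` moves one step to the right. -/
def jumpRight {N : ℕ} (x : Fin N → ℤ) (i : Fin N) : Fin N → ℤ :=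
  Function.update x i (x i + 1)

/-- The particles `i, i + 1, …, j` move one step to the left. -/
def jumpLeft {N : ℕ} (x : Fin N → ℤ) (i j : Fin N) : Fin N → ℤ :=
  fun m => if i ≤ m ∧ m ≤ j then x m - 1 else x m

/-- Rate of the right jump of the particle `i`. -/
def rateRight {N : ℕ} (q R : ℝ) (a : Fin N → ℝ) (x : Fin N → ℤ) (i : Fin N) : ℝ :=
  a i * R * (1 - qGap q x i)

/-- Rate at which the particle `i` jumps to the left by itself (rate `L / a i`), pushes
successively each of the particles `i + 1, …, j` (the particle `m` is pushed with probability
`q ^ gap`, with the gap before the move) and the particle `j` does not push the particle `j + 1`. -/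
def rateLeft {N : ℕ} (q L : ℝ) (a : Fin N → ℝ) (x : Fin N → ℤ) (i j : Fin N) : ℝ :=
  (a i)⁻¹ * L * (∏ m ∈ Finset.Ioc (i : ℕ) j, qGap q x m) * (1 - qGap q x (j + 1))

/-- The Markov generator of the `q`-PushASEP. -/
def generator {N : ℕ} (q R L : ℝ) (a : Fin N → ℝ) (f : (Fin N → ℤ) → ℝ) (x : Fin N → ℤ) : ℝ :=
  (∑ i : Fin N, rateRight q R a x i * (f (jumpRight x i) - f x)) +
    ∑ i : Fin N, ∑ j ∈ Finset.Ici i, rateLeft q L a x i j * (f (jumpLeft x i j) - f x)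

/-- The process `X` is a `q`-PushASEP: it takes values in ordered configurations, has càdlàg
trajectories (for the discrete topology), and solves the martingale problem for the generator:
`f (X t) - ∫₀ᵗ (generator f) (X s) ds` is a martingale in the natural filtration of `X`, for each
bounded `f`.  All jump rates are bounded, so this determines the law of `X` from that of `X 0`. -/
structure IsQPushASEP {N : ℕ} (q R L : ℝ) (a : Fin N → ℝ) {Ω : Type*} [MeasurableSpace Ω]
    (P : Measure Ω) (X : ℝ≥0 → Ω → (Fin N → ℤ)) : Prop where
  stronglyMeasurable : ∀ t, StronglyMeasurable (X t)
  ordered : ∀ t ω, StrictAnti (X t ω)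
  right_continuous : ∀ ω t, ContinuousWithinAt (fun s => X s ω) (Set.Ici t) t
  left_limit : ∀ ω t, ∃ l, Tendsto (fun s => X s ω) (𝓝[<] t) (𝓝 l)
  martingale : ∀ f : (Fin N → ℤ) → ℝ, (∃ C, ∀ x, |f x| ≤ C) →
    Martingale
      (fun (t : ℝ≥0) ω =>
        f (X t ω) - ∫ s in (0 : ℝ)..t, generator q R L a f (X s.toNNReal ω))
      (Filtration.natural X stronglyMeasurable) P

/-- The step configuration: the particles `x_1, …, x_N` are at `-1, …, -N`. -/
def stepConfig (N : ℕ) : Fin N → ℤ := fun m => -((m : ℤ) + 1)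

/-- `q ^ (x_n + n)` with the one-based label `0 ≤ n ≤ N`; it is zero for `n = 0`, since
`x_0 = +∞`. -/
def qObservable {N : ℕ} (q : ℝ) (x : Fin N → ℤ) (n : ℕ) : ℝ :=
  if h : 0 < n ∧ n ≤ N then q ^ (x ⟨n - 1, by omega⟩ + (n : ℤ)) else 0

/-- `N ≥ n_1 ≥ … ≥ n_k ≥ 0`. -/
def weylChamber (k N : ℕ) : Set (Fin k → ℕ) :=
  {n | Antitone n ∧ ∀ j, n j ≤ N}

/-! ### Contour integrals -/

/-- A closed piecewise continuously differentiable curve in the complex plane. -/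
structure Contour where
  /-- the common start and end of the curve -/
  base : ℂ
  /-- the curve, parametrized by `[0, 1]` -/
  path : Path base base
  /-- there is a partition `0 = τ 0 ≤ … ≤ τ m = 1` such that the curve is `C¹` on each closed
  interval of the partition -/
  piecewise : ∃ (m : ℕ) (τ : ℕ → ℝ), Monotone τ ∧ τ 0 = 0 ∧ τ m = 1 ∧
    ∀ i < m, ContDiffOn ℝ 1 path.extend (Set.Icc (τ i) (τ (i + 1)))

/-- `∮ f(z) dz` along `γ`. -/
def Contour.integral (γ : Contour) (f : ℂ → ℂ) : ℂ :=
  ∫ᶜ z in γ.path, ContinuousLinearMap.toSpanSingleton ℂ (f z)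

/-- The winding number of `γ` around a point that does not lie on it. -/
def Contour.winding (γ : Contour) (w : ℂ) : ℂ :=
  (2 * Real.pi * Complex.I)⁻¹ * γ.integral (fun z => (z - w)⁻¹)

/-- `γ` contains `w`: it goes around `w` once, in the positive direction.  For a positively
oriented simple closed curve this says that `w` lies inside. -/
def Contour.Encloses (γ : Contour) (w : ℂ) : Prop :=
  w ∉ Set.range γ.path ∧ γ.winding w = 1

/-- `w` lies outside `γ`. -/
def Contour.Excludes (γ : Contour) (w : ℂ) : Prop :=
  w ∉ Set.range γ.path ∧ γ.winding w = 0

/-- The contour of the variable `z_A` contains all `a_i` and all contours `q z_B` with `B > A`,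
but not zero. -/
def NestedContours {N k : ℕ} (q : ℝ) (a : Fin N → ℝ) (γ : Fin k → Contour) : Prop :=
  ∀ A, (∀ i, (γ A).Encloses (a i : ℂ)) ∧
    (∀ B, A < B → ∀ s, (γ A).Encloses ((q : ℂ) * (γ B).path s)) ∧
    (γ A).Excludes 0

/-- The iterated integral `∮ ⋯ ∮ F(z_1, …, z_k) dz_k ⋯ dz_1`, with `z_j` on the contour `γ j`. -/
def iteratedIntegral : {k : ℕ} → (Fin k → Contour) → ((Fin k → ℂ) → ℂ) → ℂ
  | 0, _, F => F Fin.elim0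
  | _ + 1, γ, F =>
    (γ 0).integral fun z => iteratedIntegral (fun j => γ j.succ) fun w => F (Fin.cons z w)

/-- `Π_t(z) = exp (t (R z + L / z))`. -/
def piFun (R L t : ℝ) (z : ℂ) : ℂ :=
  Complex.exp (t * (R * z + L * z⁻¹))

/-- The integrand of the moment formula. -/
def momentIntegrand {N k : ℕ} (q R L t : ℝ) (a : Fin N → ℝ) (n : Fin k → ℕ) (z : Fin k → ℂ) : ℂ :=
  (∏ A : Fin k, ∏ B ∈ Finset.Ioi A, (z A - z B) / (z A - q * z B)) *
    ∏ j : Fin k,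
      (∏ i ∈ Finset.univ.filter (fun i : Fin N => (i : ℕ) < n j), (a i : ℂ) / (a i - z j)) *
        (piFun R L t (q * z j) / piFun R L t (z j)) * (1 / z j)

end QPushASEP

end

/-! Write `y_m = q ^ (x_m + m)` with one-based labels. Then `q ^ gap_{m+1} = y_m / y_{m+1}`, so the
jump rates are rational in the `y_m`. The particle `m` jumps right, multiplying `y_m` by `q`, at a
rate proportional to `1 - y_{m-1} / y_m`. The push probabilities telescope: a left jump started by
the particle `i` reaches the particle `m ≥ i` at total rate `a_i⁻¹ L y_i / y_m`. Multiplying by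
these ratios turns a factor `y_m` into `y_{m-1}` or `y_i`. The generator therefore maps each product
`y_{n_1} ⋯ y_{n_k}` to a finite combination of such products, and the moments solve a closed linear
system of differential equations on the finite set of admissible `n` (`generator_obsProd`). A jump
may change several factors at once; because `n` is ordered, this is recorded by powers of `q`, and
hence by a recursion from one factor to the next (`MomentSystem`, `momentSystem_of_symmetric`).

The contour integrals solve the same system (`contourMoment_system`). Differentiating `Π_t(q z) /
Π_t(z)` in time brings down `R (q - 1) z + L (q⁻¹ - 1) / z` for each variable, so the effect of
right and left jumps on the `l`-th factor corresponds to an extra `z_l` or `z_l⁻¹` in the integrand.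
The identity `(a_m - z) P_m = a_m P_{m-1}` for `P_m = ∏_{i ≤ m} a_i / (a_i - z)` converts such
factors into shifts of `n_l`. The recursion between neighbouring factors comes from
`multiIntegral_sub_mul_eq_zero`: for equal weights the factor `z_j - q z_{j+1}` cancels the one pole
that separates the two contours, and on a common contour the integrand is antisymmetric. If some
`n_j = 0`, then `n_k = 0`, the innermost variable has no pole inside its contour, and the integral
vanishes, as does the moment.

At time zero the integral is computed by residues, the outermost variable first, and both sides
equal one when all `n_j` are positive (`contourMoment_zero`). Grönwall's inequality then identifies
the two solutions (`eq_zero_of_hasDerivWithinAt`).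

Two analytic points remain. The observables are unbounded, while the martingale problem concerns
bounded functions; truncation and the Lyapunov function `growth` extend Dynkin's formula to them.
The contours are arbitrary closed curves and the integrands have essential singularities at zero; a
curve with winding number zero around the origin has a closed logarithm, which reduces Cauchy's
theorem to a disc, and only the winding numbers around the nonzero poles matter. -/

noncomputable section

/-! ### Integration along piecewise smooth curves and Cauchy's theorem in the punctured plane -/

namespace QPushASEP

namespace Contour

/-- The parametrization of a contour, extended to the real line. -/
def fn (γ : Contour) : ℝ → ℂ := γ.path.extend

/-- The velocity of a contour. -/
def vel (γ : Contour) : ℝ → ℂ := derivWithin γ.path.extend (Set.Icc 0 1)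

lemma integral_eq (γ : Contour) (f : ℂ → ℂ) :
    γ.integral f = ∫ t in (0 : ℝ)..1, f (γ.fn t) * γ.vel t := by
  rw [Contour.integral, curveIntegral_def]
  refine intervalIntegral.integral_congr fun t _ => ?_
  simp only [curveIntegralFun_def, ContinuousLinearMap.toSpanSingleton_apply, smul_eq_mul, fn, vel]
  rw [mul_comm]

lemma continuous_fn (γ : Contour) : Continuous γ.fn := γ.path.continuous_extend

lemma range_fn (γ : Contour) : Set.range γ.fn = Set.range γ.path := γ.path.extend_range

lemma fn_mem (γ : Contour) (t : ℝ) : γ.fn t ∈ Set.range γ.path :=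
  γ.range_fn ▸ Set.mem_range_self t

lemma fn_zero (γ : Contour) : γ.fn 0 = γ.base := γ.path.extend_zero

lemma fn_one (γ : Contour) : γ.fn 1 = γ.base := γ.path.extend_one

lemma isCompact_range (γ : Contour) : IsCompact (Set.range γ.path) :=
  _root_.isCompact_range γ.path.continuous

/-- Only the nodes of the partition can be exceptional. The fundamental theorem of calculus
tolerates a countable set of such points, so primitives can be used along the whole curve without
cutting it. -/
lemma exists_countable_hasDerivAt (γ : Contour) : ∃ s : Set ℝ, s.Countable ∧
    ∀ t ∈ Set.Ioo (0 : ℝ) 1 \ s, HasDerivAt γ.fn (γ.vel t) t ∧ ContinuousAt γ.vel t := by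
  classical
  obtain ⟨m, τ, hτ, h0, h1, hC⟩ := γ.piecewise
  refine ⟨Set.range τ, Set.countable_range τ, ?_⟩
  rintro t ⟨⟨ht0, ht1⟩, hts⟩
  -- The least node beyond `t` identifies the piece that contains `t`; since `t` is not a node, it
  -- is interior to that piece.
  have hex : ∃ j, t < τ j := ⟨m, h1 ▸ ht1⟩
  have hj := Nat.find_spec hex
  have hjm : Nat.find hex ≤ m := Nat.find_min' hex (h1 ▸ ht1)
  have hj0 : Nat.find hex ≠ 0 := fun h => by
    rw [h, h0] at hj; linarith
  obtain ⟨i, hi⟩ := Nat.exists_eq_succ_of_ne_zero hj0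
  have hit : ¬ t < τ i := Nat.find_min hex (by omega)
  have hit' : τ i < t := lt_of_le_of_ne (not_lt.1 hit) fun h => hts ⟨i, h⟩
  rw [hi] at hj
  have hI : Set.Ioo (τ i) (τ (i + 1)) ∈ 𝓝 t := Ioo_mem_nhds hit' hj
  have hcd := hC i (by omega)
  have hτ0 : 0 ≤ τ i := h0 ▸ hτ (Nat.zero_le i)
  have hτ1 : τ (i + 1) ≤ 1 := h1 ▸ hτ (by omega : i + 1 ≤ m)
  have hud : UniqueDiffOn ℝ (Set.Icc (τ i) (τ (i + 1))) := uniqueDiffOn_Icc (hit'.trans hj)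
  have hcont := hcd.continuousOn_derivWithin hud le_rfl
  have hvel : ∀ s ∈ Set.Ioo (τ i) (τ (i + 1)), γ.vel s = deriv γ.path.extend s := fun s hs =>
    derivWithin_of_mem_nhds (Icc_mem_nhds (hτ0.trans_lt hs.1) (hs.2.trans_le hτ1))
  have hvel' : γ.vel =ᶠ[𝓝 t] derivWithin γ.path.extend (Set.Icc (τ i) (τ (i + 1))) := by
    filter_upwards [hI] with s hs
    rw [hvel s hs, derivWithin_of_mem_nhds (Icc_mem_nhds hs.1 hs.2)]
  constructor
  · rw [hvel t ⟨hit', hj⟩]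
    exact ((hcd.differentiableOn one_ne_zero).differentiableAt
      (Icc_mem_nhds hit' hj)).hasDerivAt
  · exact (hcont.continuousAt (Icc_mem_nhds hit' hj)).congr hvel'.symm

lemma intervalIntegrable_vel (γ : Contour) : IntervalIntegrable γ.vel volume 0 1 := by
  obtain ⟨m, τ, hτ, h0, h1, hC⟩ := γ.piecewise
  have key : IntervalIntegrable γ.vel volume (τ 0) (τ m) := by
    refine IntervalIntegrable.trans_iterate fun i hi => ?_
    rcases (hτ (Nat.le_succ i)).eq_or_lt with h | h
    · simp only [Nat.succ_eq_add_one] at h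
      rw [h]
    have hτ0 : 0 ≤ τ i := h0 ▸ hτ (Nat.zero_le i)
    have hτ1 : τ (i + 1) ≤ 1 := h1 ▸ hτ (by omega : i + 1 ≤ m)
    have hcont := (hC i hi).continuousOn_derivWithin (uniqueDiffOn_Icc h) le_rfl
    have hint := hcont.intervalIntegrable_of_Icc (μ := volume) h.le
    -- The derivative within the piece and the one within `[0, 1]` may differ at the nodes, so they
    -- are compared on the open interval only.
    rw [intervalIntegrable_iff_integrableOn_Ioo_of_le h.le] at hint ⊢
    refine hint.congr_fun (fun s hs => ?_) measurableSet_Ioo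
    rw [derivWithin_of_mem_nhds (Icc_mem_nhds hs.1 hs.2), vel,
      derivWithin_of_mem_nhds (Icc_mem_nhds (hτ0.trans_lt hs.1) (hs.2.trans_le hτ1))]
  rwa [h0, h1] at key

lemma intervalIntegrable_mul_vel (γ : Contour) {f : ℂ → ℂ}
    (hf : ContinuousOn f (Set.range γ.path)) :
    IntervalIntegrable (fun t => f (γ.fn t) * γ.vel t) volume 0 1 :=
  γ.intervalIntegrable_vel.continuousOn_mul
    (hf.comp γ.continuous_fn.continuousOn fun t _ => γ.fn_mem t)

lemma integral_add (γ : Contour) {f g : ℂ → ℂ} (hf : ContinuousOn f (Set.range γ.path))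
    (hg : ContinuousOn g (Set.range γ.path)) :
    γ.integral (fun z => f z + g z) = γ.integral f + γ.integral g := by
  simp only [integral_eq, add_mul]
  exact intervalIntegral.integral_add (γ.intervalIntegrable_mul_vel hf)
    (γ.intervalIntegrable_mul_vel hg)

lemma integral_const_mul (γ : Contour) (c : ℂ) (f : ℂ → ℂ) :
    γ.integral (fun z => c * f z) = c * γ.integral f := by
  simp only [integral_eq, mul_assoc]
  exact intervalIntegral.integral_const_mul c _

lemma integral_sub (γ : Contour) {f g : ℂ → ℂ} (hf : ContinuousOn f (Set.range γ.path))
    (hg : ContinuousOn g (Set.range γ.path)) :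
    γ.integral (fun z => f z - g z) = γ.integral f - γ.integral g := by
  simp only [integral_eq, sub_mul]
  exact intervalIntegral.integral_sub (γ.intervalIntegrable_mul_vel hf)
    (γ.intervalIntegrable_mul_vel hg)

lemma integral_congr (γ : Contour) {f g : ℂ → ℂ} (h : ∀ z ∈ Set.range γ.path, f z = g z) :
    γ.integral f = γ.integral g := by
  simp only [integral_eq]
  exact intervalIntegral.integral_congr fun t _ => by simp only [h _ (γ.fn_mem t)]

/-- A function with a primitive along the contour integrates to zero. -/
lemma integral_eq_zero_of_hasDerivAt (γ : Contour) {f G : ℂ → ℂ}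
    (hf : ContinuousOn f (Set.range γ.path))
    (hG : ∀ z ∈ Set.range γ.path, HasDerivAt G (f z) z) : γ.integral f = 0 := by
  obtain ⟨s, hs, hd⟩ := γ.exists_countable_hasDerivAt
  rw [integral_eq, MeasureTheory.integral_eq_of_hasDerivAt_off_countable
    (G ∘ γ.fn) _ hs _ _ (γ.intervalIntegrable_mul_vel hf)]
  · simp [fn_zero, fn_one]
  · exact (ContinuousOn.comp (t := Set.range γ.path)
      (fun z hz => (hG z hz).continuousAt.continuousWithinAt)
      γ.continuous_fn.continuousOn fun t _ => γ.fn_mem t)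
  · intro t ht
    rw [min_eq_left zero_le_one, max_eq_right zero_le_one] at ht
    exact (hG _ (γ.fn_mem t)).comp_of_eq t (hd t ht).1 rfl

/-- A contour that does not go around zero has a closed logarithm. -/
lemma exists_log (γ : Contour) (h : γ.Excludes 0) : ∃ δ : ℝ → ℂ, ContinuousOn δ (Set.Icc 0 1) ∧
    δ 0 = δ 1 ∧ (∀ t ∈ Set.Icc (0 : ℝ) 1, γ.fn t = Complex.exp (δ t)) ∧
    ∃ s : Set ℝ, s.Countable ∧
      ∀ t ∈ Set.Ioo (0 : ℝ) 1 \ s, HasDerivAt δ (γ.vel t / γ.fn t) t := by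
  obtain ⟨h0, hw⟩ := h
  obtain ⟨s, hs, hd⟩ := γ.exists_countable_hasDerivAt
  have hne : ∀ t, γ.fn t ≠ 0 := fun t ht => h0 (ht ▸ γ.fn_mem t)
  have hint : IntervalIntegrable (fun t => γ.vel t / γ.fn t) volume 0 1 := by
    have := γ.intervalIntegrable_mul_vel (f := fun z => z⁻¹) (continuousOn_inv₀.mono
      fun z hz hz0 => h0 (hz0 ▸ hz))
    simpa only [div_eq_inv_mul] using this
  set δ : ℝ → ℂ := fun t => Complex.log (γ.fn 0) + ∫ u in (0 : ℝ)..t, γ.vel u / γ.fn u with hδ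
  have hδc : ContinuousOn δ (Set.Icc 0 1) := by
    refine continuousOn_const.add ?_
    have := intervalIntegral.continuousOn_primitive_interval (μ := volume) (a := 0) (b := 1)
      (f := fun t => γ.vel t / γ.fn t)
      (by rw [Set.uIcc_of_le zero_le_one]
          exact (intervalIntegrable_iff_integrableOn_Icc_of_le zero_le_one).1 hint)
    rwa [Set.uIcc_of_le zero_le_one] at this
  have hδd : ∀ t ∈ Set.Ioo (0 : ℝ) 1 \ s, HasDerivAt δ (γ.vel t / γ.fn t) t := by
    intro t ht
    refine HasDerivAt.const_add _ (intervalIntegral.integral_hasDerivAt_right ?_ ?_ ?_)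
    · exact hint.mono_set (by
        rw [Set.uIcc_of_le zero_le_one, Set.uIcc_of_le ht.1.1.le]
        exact Set.Icc_subset_Icc le_rfl ht.1.2.le)
    · refine ⟨Set.Ioo 0 1, Ioo_mem_nhds ht.1.1 ht.1.2, ?_⟩
      exact ((intervalIntegrable_iff_integrableOn_Ioo_of_le zero_le_one).1 hint).1
    · exact (hd t ht).2.div γ.continuous_fn.continuousAt (hne t)
  refine ⟨δ, hδc, ?_, ?_, s, hs, hδd⟩
  · have : γ.integral (fun z => (z - 0)⁻¹) = 0 := by
      rw [winding] at hw
      simpa [Real.pi_ne_zero] using hw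
    rw [integral_eq] at this
    simp only [sub_zero, ← div_eq_inv_mul] at this
    simp [hδ, this]
  · intro t ht
    -- Since `δ' = γ' / γ`, the function `γ * exp (-δ)` has derivative zero off a countable set, so
    -- it keeps its initial value `1`.
    have hH : ∫ u in (0 : ℝ)..t, (0 : ℂ) =
        γ.fn t * Complex.exp (-δ t) - γ.fn 0 * Complex.exp (-δ 0) := by
      refine MeasureTheory.integral_eq_of_hasDerivAt_off_countable
        (fun t => γ.fn t * Complex.exp (-δ t)) _ hs ?_ ?_ (by simp)
      · rw [Set.uIcc_of_le ht.1]
        refine γ.continuous_fn.continuousOn.mul (Complex.continuous_exp.comp_continuousOn ?_)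
        exact (hδc.mono (Set.Icc_subset_Icc le_rfl ht.2)).neg
      · intro u hu
        rw [min_eq_left ht.1, max_eq_right ht.1] at hu
        have hu' : u ∈ Set.Ioo (0 : ℝ) 1 \ s := ⟨⟨hu.1.1, hu.1.2.trans_le ht.2⟩, hu.2⟩
        refine ((hd u hu').1.mul (hδd u hu').neg.cexp).congr_deriv ?_
        have hn := hne u
        simp only [Pi.neg_apply]
        field_simp
        ring
    have h00 : γ.fn 0 * Complex.exp (-δ 0) = 1 := by
      simp [hδ, Complex.exp_neg, Complex.exp_log (hne 0), hne 0]
    rw [intervalIntegral.integral_zero, h00, Complex.exp_neg] at hH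
    have := Complex.exp_ne_zero (δ t)
    field_simp at hH
    linear_combination -hH

/-- The substitution `z = exp w` turns the integral into one of the entire function `g (exp w) * exp
w` along the closed logarithm of the curve. This function has a primitive on a disc containing that
logarithm, whatever the singularity of `g` at zero. -/
lemma integral_eq_zero_of_differentiableOn_compl_zero (γ : Contour) (h : γ.Excludes 0) {g : ℂ → ℂ}
    (hg : DifferentiableOn ℂ g {0}ᶜ) : γ.integral g = 0 := by
  obtain ⟨δ, hδc, hδ01, hexp, s, hs, hδd⟩ := γ.exists_log h
  have hne : ∀ t, γ.fn t ≠ 0 := fun t ht => h.1 (ht ▸ γ.fn_mem t)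
  have hgo : ∀ w : ℂ, w ≠ 0 → DifferentiableAt ℂ g w := fun w hw =>
    hg.differentiableAt (isOpen_compl_singleton.mem_nhds hw)
  obtain ⟨r, hr⟩ := ((isCompact_Icc.image_of_continuousOn hδc).isBounded).subset_ball 0
  obtain ⟨G, hG⟩ := DifferentiableOn.isExactOn_ball (c := 0) (r := r)
    (f := fun w => g (Complex.exp w) * Complex.exp w) (fun w _ => by
      refine DifferentiableAt.differentiableWithinAt (DifferentiableAt.mul ?_ (by fun_prop))
      exact (hgo _ (Complex.exp_ne_zero w)).comp w (by fun_prop))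
  have hmem : ∀ t ∈ Set.Icc (0 : ℝ) 1, δ t ∈ Metric.ball (0 : ℂ) r := fun t ht =>
    hr (Set.mem_image_of_mem _ ht)
  rw [integral_eq, MeasureTheory.integral_eq_of_hasDerivAt_off_countable (G ∘ δ) _ hs _ _
    (γ.intervalIntegrable_mul_vel fun z hz =>
      (hgo z (fun h0 => h.1 (h0 ▸ hz))).continuousAt.continuousWithinAt)]
  · simp [hδ01]
  · rw [Set.uIcc_of_le zero_le_one]
    exact ContinuousOn.comp (t := Metric.ball 0 r)
      (fun z hz => (hG z hz).continuousAt.continuousWithinAt) hδc hmem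
  · intro t ht
    rw [min_eq_left zero_le_one, max_eq_right zero_le_one] at ht
    have ht' := Set.Ioo_subset_Icc_self ht.1
    have := (hG _ (hmem t ht')).comp t (hδd t ht)
    simp only [← hexp t ht'] at this
    refine this.congr_deriv ?_
    have hn := hne t
    field_simp

end Contour

end QPushASEP

/-! ### Residue calculus by partial fractions -/

namespace QPushASEP

namespace Contour

/-- The rational function with simple poles (counted with multiplicity) at the points of `m`. -/
def poleProd (m : Multiset ℂ) (z : ℂ) : ℂ := (m.map fun s => (z - s)⁻¹).prod

@[simp] lemma poleProd_zero (z : ℂ) : poleProd 0 z = 1 := by simp [poleProd]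

@[simp] lemma poleProd_cons (s : ℂ) (m : Multiset ℂ) (z : ℂ) :
    poleProd (s ::ₘ m) z = (z - s)⁻¹ * poleProd m z := by simp [poleProd]

lemma poleProd_add (m m' : Multiset ℂ) (z : ℂ) :
    poleProd (m + m') z = poleProd m z * poleProd m' z := by simp [poleProd]

lemma differentiableAt_poleProd {m : Multiset ℂ} {z : ℂ} (h : z ∉ m) :
    DifferentiableAt ℂ (poleProd m) z := by
  induction m using Multiset.induction with
  | empty => simp [funext poleProd_zero]
  | cons s m ih =>
    simp only [Multiset.mem_cons, not_or] at h
    rw [funext (poleProd_cons s m)]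
    exact (DifferentiableAt.inv (differentiableAt_id.sub_const s) (sub_ne_zero.2 h.1)).mul (ih h.2)

lemma continuousOn_poleProd {m : Multiset ℂ} {S : Set ℂ} (h : ∀ s ∈ m, s ∉ S) :
    ContinuousOn (poleProd m) S := fun z hz =>
  (differentiableAt_poleProd fun hm => h z hm hz).continuousAt.continuousWithinAt

lemma integral_inv_sub (γ : Contour) (s : ℂ) :
    γ.integral (fun z => (z - s)⁻¹) = 2 * Real.pi * Complex.I * γ.winding s := by
  rw [winding, mul_inv_cancel_left₀ (by simp [Real.pi_ne_zero])]

lemma integral_inv_sub_pow (γ : Contour) {s : ℂ} (hs : s ∉ Set.range γ.path) (j : ℕ) :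
    γ.integral (fun z => ((z - s)⁻¹) ^ (j + 2)) = 0 := by
  have hne : ∀ z ∈ Set.range γ.path, z - s ≠ 0 := fun z hz h => hs (sub_eq_zero.1 h ▸ hz)
  refine γ.integral_eq_zero_of_hasDerivAt
    (G := fun z => -((j : ℂ) + 1)⁻¹ * ((z - s)⁻¹) ^ (j + 1)) ?_ fun z hz => ?_
  · exact ((continuousOn_id.sub continuousOn_const).inv₀ hne).pow _
  · refine (((((hasDerivAt_id z).sub_const s).inv (hne z hz)).pow (j + 1)).const_mul
      (-((j : ℂ) + 1)⁻¹)).congr_deriv ?_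
    have h1 := hne z hz
    have h2 : (j : ℂ) + 1 ≠ 0 := Nat.cast_add_one_ne_zero j
    simp only [id, Nat.add_sub_cancel, Nat.cast_add, Nat.cast_one, Pi.inv_apply, inv_pow]
    field_simp
    ring

/-- Partial fractions: `1 / ((z - s) (z - s')) = (1 / (z - s) - 1 / (z - s')) / (s - s')`. Each step
lowers the number of poles, until one point is left with some multiplicity. -/
lemma integral_poleProd_cons_cons (γ : Contour) {s s' : ℂ} {m : Multiset ℂ} (hss : s ≠ s')
    (h : ∀ x ∈ s ::ₘ s' ::ₘ m, x ∉ Set.range γ.path) :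
    γ.integral (poleProd (s ::ₘ s' ::ₘ m)) =
      (s - s')⁻¹ * (γ.integral (poleProd (s ::ₘ m)) - γ.integral (poleProd (s' ::ₘ m))) := by
  have h1 : ∀ x ∈ s ::ₘ m, x ∉ Set.range γ.path := fun x hx => h x (by
    simp only [Multiset.mem_cons] at hx ⊢; tauto)
  have h2 : ∀ x ∈ s' ::ₘ m, x ∉ Set.range γ.path := fun x hx => h x (by
    simp only [Multiset.mem_cons] at hx ⊢; tauto)
  rw [← γ.integral_sub (continuousOn_poleProd h1) (continuousOn_poleProd h2),
    ← γ.integral_const_mul]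
  refine γ.integral_congr fun z hz => ?_
  have e1 : z - s ≠ 0 := fun e => h s (by simp) (sub_eq_zero.1 e ▸ hz)
  have e2 : z - s' ≠ 0 := fun e => h s' (by simp) (sub_eq_zero.1 e ▸ hz)
  have e3 := sub_ne_zero.2 hss
  simp only [poleProd_cons]
  field_simp
  ring

/-- Induction for the integrals of the functions `poleProd m`. -/
lemma poleProd_induction {p : Multiset ℂ → Prop} (zero : p 0) (single : ∀ s, p {s})
    (pow : ∀ s j, p (Multiset.replicate (j + 2) s))
    (step : ∀ s s' m, s ≠ s' → p (s ::ₘ m) → p (s' ::ₘ m) → p (s ::ₘ s' ::ₘ m))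
    (m : Multiset ℂ) : p m := by
  induction hn : Multiset.card m using Nat.strong_induction_on generalizing m with
  | _ n ih =>
  rcases m.empty_or_exists_mem with rfl | ⟨s, hs⟩
  · exact zero
  by_cases hall : ∀ x ∈ m, x = s
  · rw [Multiset.eq_replicate_of_mem hall]
    rcases hc : Multiset.card m with _ | _ | j
    · simpa using zero
    · simpa using single s
    · exact pow s j
  · push Not at hall
    obtain ⟨s', hs', hne⟩ := hall
    obtain ⟨m₁, rfl⟩ := Multiset.exists_cons_of_mem hs
    have : s' ∈ m₁ := (Multiset.mem_cons.1 hs').resolve_left hne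
    obtain ⟨m₂, rfl⟩ := Multiset.exists_cons_of_mem this
    simp only [Multiset.card_cons] at hn
    exact step s s' m₂ hne.symm (ih _ (by simp; omega) _ rfl) (ih _ (by simp; omega) _ rfl)

lemma poleProd_singleton (s : ℂ) : poleProd {s} = fun z => (z - s)⁻¹ := by
  ext z; simp [poleProd]

lemma poleProd_replicate (j : ℕ) (s : ℂ) :
    poleProd (Multiset.replicate j s) = fun z => ((z - s)⁻¹) ^ j := by
  ext z; simp [poleProd]

lemma integral_one (γ : Contour) : γ.integral (fun _ => 1) = 0 :=
  γ.integral_eq_zero_of_hasDerivAt (G := id) continuousOn_const fun z _ => hasDerivAt_id z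

/-- After partial fractions only the simple poles contribute, each through its winding number;
powers of order at least two have primitives. The integral thus depends linearly on the winding
numbers. -/
lemma integral_poleProd_eq_mul {γ γ' : Contour} {c : ℂ} {m : Multiset ℂ}
    (h : ∀ s ∈ m, s ∉ Set.range γ.path ∧ s ∉ Set.range γ'.path ∧
      γ.winding s = c * γ'.winding s) :
    γ.integral (poleProd m) = c * γ'.integral (poleProd m) := by
  revert h
  induction m using poleProd_induction with
  | zero =>
    intro _
    simp [funext poleProd_zero, integral_one]
  | single s =>
    intro h
    rw [poleProd_singleton, integral_inv_sub, integral_inv_sub, (h s (by simp)).2.2]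
    ring
  | pow s j =>
    intro h
    have := h s (by simp)
    rw [poleProd_replicate, integral_inv_sub_pow _ this.1, integral_inv_sub_pow _ this.2.1,
      mul_zero]
  | step s s' m hss h1 h2 =>
    intro h
    rw [integral_poleProd_cons_cons _ hss fun x hx => (h x hx).1,
      integral_poleProd_cons_cons _ hss fun x hx => (h x hx).2.1,
      h1 fun x hx => h x (by simp only [Multiset.mem_cons] at hx ⊢; tauto),
      h2 fun x hx => h x (by simp only [Multiset.mem_cons] at hx ⊢; tauto)]
    ring

/-- With at least two poles, all encircled once, the residues add up to zero because the function
decays like `z⁻²` at infinity. In the partial fractions this appears as a difference of equal terms.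
-/
lemma integral_poleProd_of_winding_eq_one {γ : Contour} {m : Multiset ℂ}
    (h : ∀ s ∈ m, γ.Encloses s) :
    γ.integral (poleProd m) = if Multiset.card m = 1 then 2 * Real.pi * Complex.I else 0 := by
  revert h
  induction m using poleProd_induction with
  | zero =>
    intro _
    simp [funext poleProd_zero, integral_one]
  | single s =>
    intro h
    rw [poleProd_singleton, integral_inv_sub, (h s (by simp)).2]
    simp
  | pow s j =>
    intro h
    rw [poleProd_replicate, integral_inv_sub_pow _ (h s (by simp)).1]
    simp
  | step s s' m hss h1 h2 =>
    intro h
    rw [integral_poleProd_cons_cons _ hss fun x hx => (h x hx).1,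
      h1 fun x hx => h x (by simp only [Multiset.mem_cons] at hx ⊢; tauto),
      h2 fun x hx => h x (by simp only [Multiset.mem_cons] at hx ⊢; tauto)]
    simp

/-- Two contours that do not go around zero and have proportional winding numbers around the
nonzero poles of a function give proportional integrals; the function may have an essential
singularity at zero. -/
theorem integral_mul_poleProd_eq_mul {γ γ' : Contour} {c : ℂ} (hγ : γ.Excludes 0)
    (hγ' : γ'.Excludes 0) {m : Multiset ℂ} {g : ℂ → ℂ} (hg : DifferentiableOn ℂ g {0}ᶜ)
    (h : ∀ s ∈ m, s ≠ 0 ∧ s ∉ Set.range γ.path ∧ s ∉ Set.range γ'.path ∧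
      γ.winding s = c * γ'.winding s) :
    γ.integral (fun z => g z * poleProd m z) = c * γ'.integral (fun z => g z * poleProd m z) := by
  induction m using Multiset.induction generalizing g with
  | empty =>
    simp only [poleProd_zero, mul_one]
    rw [γ.integral_eq_zero_of_differentiableOn_compl_zero hγ hg,
      γ'.integral_eq_zero_of_differentiableOn_compl_zero hγ' hg, mul_zero]
  | cons s m ih =>
    have hs := h s (by simp)
    have hnhds : ({0}ᶜ : Set ℂ) ∈ 𝓝 s := isOpen_compl_singleton.mem_nhds hs.1
    have hg' : DifferentiableOn ℂ (dslope g s) {0}ᶜ :=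
      (Complex.differentiableOn_dslope hnhds).2 hg
    -- One pole is removed by `g z = g s + (z - s) * dslope g s z`, where the divided difference is
    -- again holomorphic off zero. When no pole is left, Cauchy's theorem in the punctured plane
    -- applies.
    have hsplit : ∀ η : Contour, η.Excludes 0 → (∀ x ∈ s ::ₘ m, x ∉ Set.range η.path) →
        η.integral (fun z => g z * poleProd (s ::ₘ m) z) =
          η.integral (fun z => dslope g s z * poleProd m z) +
            g s * η.integral (poleProd (s ::ₘ m)) := by
      intro η h0 hη
      have hsub : Set.range η.path ⊆ {0}ᶜ := fun z hz hz0 => h0.1 (hz0 ▸ hz)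
      rw [← η.integral_const_mul, ← η.integral_add
        ((hg'.continuousOn.mono hsub).fun_mul
          (continuousOn_poleProd fun x hx => hη x (Multiset.mem_cons_of_mem hx)))
        (continuousOn_const.fun_mul (continuousOn_poleProd hη))]
      refine η.integral_congr fun z hz => ?_
      have hzs : z ≠ s := fun e => hη s (by simp) (e ▸ hz)
      have := sub_ne_zero.2 hzs
      rw [dslope_of_ne _ hzs, slope_def_field, poleProd_cons]
      field_simp
      ring
    rw [hsplit γ hγ fun x hx => (h x hx).2.1, hsplit γ' hγ' fun x hx => (h x hx).2.2.1,
      ih hg' fun x hx => h x (Multiset.mem_cons_of_mem hx),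
      integral_poleProd_eq_mul fun x hx => (h x hx).2]
    ring

/-- The sum of the residues away from zero of `z⁻¹ ∏ (z - s)⁻¹`. -/
lemma integral_inv_mul_poleProd {γ : Contour} (h0 : γ.Excludes 0) {m : Multiset ℂ} (hm : m ≠ 0)
    (h : ∀ s ∈ m, γ.Encloses s) :
    γ.integral (fun z => z⁻¹ * poleProd m z) = -(2 * Real.pi * Complex.I) * poleProd m 0 := by
  induction m using Multiset.induction with
  | empty => exact absurd rfl hm
  | cons s m ih =>
    have hs0 : s ≠ 0 := by
      rintro rfl
      have := (h 0 (by simp)).2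
      rw [h0.2] at this
      exact zero_ne_one this
    have hc1 : ContinuousOn (poleProd (s ::ₘ m)) (Set.range γ.path) :=
      continuousOn_poleProd fun x hx => (h x hx).1
    have hc2 : ContinuousOn (fun z => z⁻¹ * poleProd m z) (Set.range γ.path) :=
      (continuousOn_inv₀.mono fun z hz e => h0.1 (e ▸ hz)).mul
        (continuousOn_poleProd fun x hx => (h x (Multiset.mem_cons_of_mem hx)).1)
    -- This uses `1 / (z (z - s)) = s⁻¹ (1 / (z - s) - 1 / z)`.
    have hsplit : γ.integral (fun z => z⁻¹ * poleProd (s ::ₘ m) z) =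
        s⁻¹ * (γ.integral (poleProd (s ::ₘ m)) - γ.integral (fun z => z⁻¹ * poleProd m z)) := by
      rw [← γ.integral_sub hc1 hc2, ← γ.integral_const_mul]
      refine γ.integral_congr fun z hz => ?_
      have e1 : z - s ≠ 0 := fun e => (h s (by simp)).1 (sub_eq_zero.1 e ▸ hz)
      have e2 : z ≠ 0 := fun e => h0.1 (e ▸ hz)
      rw [poleProd_cons]
      field_simp
      ring
    rw [hsplit, integral_poleProd_of_winding_eq_one h]
    -- For a single pole the first integral is `2πi` and the second vanishes, as zero is excluded;
    -- with more poles the first vanishes and the second is the induction hypothesis.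
    by_cases hm0 : m = 0
    · subst hm0
      have : γ.integral (fun z => z⁻¹ * poleProd 0 z) = 0 := by
        have := γ.integral_inv_sub 0
        rw [h0.2] at this
        simpa using this
      rw [this]
      simp only [poleProd_cons, poleProd_zero, Multiset.card_cons, Multiset.card_zero, zero_sub,
        inv_neg]
      simp
      field_simp
    · rw [ih hm0 fun x hx => h x (Multiset.mem_cons_of_mem hx)]
      have : Multiset.card m ≠ 0 := by simpa using hm0
      simp only [Multiset.card_cons, Nat.add_eq_right, this, if_false, poleProd_cons, zero_sub,
        inv_neg]
      ring

/-- The sum of the residues away from zero of `z⁻¹ ∏ (z - b') / (z - b) ∏ (z - s)⁻¹`. -/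
theorem integral_inv_mul_prod_mul_poleProd {γ : Contour} (h0 : γ.Excludes 0) {ι : Type*}
    (T : Finset ι) (b b' : ι → ℂ) {m : Multiset ℂ} (hm : m ≠ 0)
    (h : ∀ s ∈ m, γ.Encloses s) (hb : ∀ i ∈ T, γ.Encloses (b i)) :
    γ.integral (fun z => z⁻¹ * (∏ i ∈ T, (z - b' i) / (z - b i)) * poleProd m z) =
      -(2 * Real.pi * Complex.I) * ((∏ i ∈ T, b' i / b i) * poleProd m 0) := by
  classical
  induction T using Finset.induction generalizing m with
  | empty => simpa using integral_inv_mul_poleProd h0 hm h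
  | insert i T hi ih =>
    have hbi := hb i (Finset.mem_insert_self i T)
    have hbT : ∀ j ∈ T, γ.Encloses (b j) := fun j hj => hb j (Finset.mem_insert_of_mem hj)
    have hb0 : b i ≠ 0 := by
      intro e
      have := hbi.2
      rw [e, h0.2] at this
      exact zero_ne_one this
    have hcons : ∀ s ∈ b i ::ₘ m, γ.Encloses s := fun s hs => by
      rcases Multiset.mem_cons.1 hs with rfl | hs
      exacts [hbi, h s hs]
    have hc : ∀ m' : Multiset ℂ, (∀ s ∈ m', γ.Encloses s) → ContinuousOn
        (fun z => z⁻¹ * (∏ i ∈ T, (z - b' i) / (z - b i)) * poleProd m' z)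
        (Set.range γ.path) := fun m' hm' => by
      refine ((continuousOn_inv₀.mono fun z hz e => h0.1 (e ▸ hz)).mul
        (continuousOn_finsetProd _ fun j hj => ?_)).mul
        (continuousOn_poleProd fun x hx => (hm' x hx).1)
      exact (continuousOn_id.sub continuousOn_const).div (continuousOn_id.sub continuousOn_const)
        fun z hz e => (hbT j hj).1 (sub_eq_zero.1 e ▸ hz)
    -- Since `(z - b') / (z - b) = 1 + (b - b') / (z - b)`, the factor either disappears or joins
    -- the poles in `m`; for this reason the induction is over all nonempty `m`.
    have hsplit : γ.integral
          (fun z => z⁻¹ * (∏ j ∈ insert i T, (z - b' j) / (z - b j)) * poleProd m z) =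
        γ.integral (fun z => z⁻¹ * (∏ j ∈ T, (z - b' j) / (z - b j)) * poleProd m z) +
        (b i - b' i) * γ.integral
          (fun z => z⁻¹ * (∏ j ∈ T, (z - b' j) / (z - b j)) * poleProd (b i ::ₘ m) z) := by
      rw [← γ.integral_const_mul, ← γ.integral_add (hc m h)
        (continuousOn_const.fun_mul (hc _ hcons))]
      refine γ.integral_congr fun z hz => ?_
      have e1 : z - b i ≠ 0 := fun e => hbi.1 (sub_eq_zero.1 e ▸ hz)
      rw [Finset.prod_insert hi, poleProd_cons]
      field_simp
      ring
    rw [hsplit, ih hm h hbT, ih (by simp) hcons hbT, Finset.prod_insert hi, poleProd_cons]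
    field_simp
    ring

end Contour

end QPushASEP

/-! ### Winding numbers and the existence of nested contours -/

namespace QPushASEP

namespace Contour

lemma continuousOn_inv_sub {S : Set ℂ} {w : ℂ} (hw : w ∉ S) :
    ContinuousOn (fun z : ℂ => (z - w)⁻¹) S :=
  ContinuousOn.inv₀ (by fun_prop) fun z hz e => hw ((sub_eq_zero.1 e : z = w) ▸ hz)

/-- Differentiation under the integral sign gives `∮ (z - w)⁻² dz`, which vanishes since the
integrand has a primitive. This makes the winding number locally constant. -/
lemma hasDerivAt_winding (γ : Contour) {w : ℂ} (hw : w ∉ Set.range γ.path) :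
    HasDerivAt γ.winding 0 w := by
  obtain ⟨d, hd, hball⟩ := Metric.isOpen_iff.1 γ.isCompact_range.isClosed.isOpen_compl w hw
  have hdist : ∀ t, ∀ x ∈ Metric.ball w (d / 2), d / 2 ≤ ‖γ.fn t - x‖ := by
    intro t x hx
    by_contra! hlt
    refine hball (?_ : γ.fn t ∈ Metric.ball w d) (γ.fn_mem t)
    rw [Metric.mem_ball] at hx ⊢
    calc dist (γ.fn t) w ≤ dist (γ.fn t) x + dist x w := dist_triangle _ _ _
      _ < d / 2 + d / 2 := add_lt_add (by rwa [dist_eq_norm]) hx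
      _ = d := by ring
  have hnr : ∀ x ∈ Metric.ball w (d / 2), x ∉ Set.range γ.path := fun x hx =>
    fun h => hball (Metric.ball_subset_ball (by linarith) hx) h
  have hmem : w ∈ Metric.ball w (d / 2) := Metric.mem_ball_self (by positivity)
  have key := (intervalIntegral.hasDerivAt_integral_of_dominated_loc_of_deriv_le
    (μ := volume) (a := 0) (b := 1) (F := fun x t => (γ.fn t - x)⁻¹ * γ.vel t)
    (F' := fun x t => ((γ.fn t - x)⁻¹) ^ 2 * γ.vel t) (x₀ := w)
    (s := Metric.ball w (d / 2)) (bound := fun t => ((d / 2)⁻¹) ^ 2 * ‖γ.vel t‖)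
    (Metric.ball_mem_nhds w (by positivity)) ?_ ?_ ?_ ?_ ?_ ?_).2
  · have h0 : ∫ t in (0 : ℝ)..1, ((γ.fn t - w)⁻¹) ^ 2 * γ.vel t = 0 := by
      rw [← γ.integral_eq (fun z => ((z - w)⁻¹) ^ 2)]
      exact γ.integral_inv_sub_pow hw 0
    rw [h0] at key
    have := key.const_mul (2 * Real.pi * Complex.I)⁻¹
    rw [mul_zero] at this
    refine this.congr_of_eventuallyEq (Eventually.of_forall fun x => ?_)
    simp only [winding, integral_eq]
  · filter_upwards [Metric.ball_mem_nhds w (half_pos hd)] with x hx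
    exact (γ.intervalIntegrable_mul_vel (continuousOn_inv_sub (hnr x hx))).def'.1
  · exact γ.intervalIntegrable_mul_vel (continuousOn_inv_sub hw)
  · exact (γ.intervalIntegrable_mul_vel ((continuousOn_inv_sub hw).pow 2)).def'.1
  · refine Eventually.of_forall fun t _ x hx => ?_
    rw [norm_mul, norm_pow, norm_inv]
    gcongr
    exact hdist t x hx
  · exact γ.intervalIntegrable_vel.norm.const_mul _
  · refine Eventually.of_forall fun t _ x hx => HasDerivAt.mul_const ?_ _
    have hne : γ.fn t - x ≠ 0 := fun e => by
      have := hdist t x hx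
      rw [e, norm_zero] at this
      linarith
    refine (((hasDerivAt_id x).const_sub (γ.fn t)).inv hne).congr_deriv ?_
    simp

lemma winding_eq_of_isPreconnected (γ : Contour) {S : Set ℂ} (hS : IsPreconnected S)
    (hSγ : ∀ x ∈ S, x ∉ Set.range γ.path) {x y : ℂ} (hx : x ∈ S) (hy : y ∈ S) :
    γ.winding x = γ.winding y := by
  set U : Set ℂ := (Set.range γ.path)ᶜ with hU
  have hUo : IsOpen U := γ.isCompact_range.isClosed.isOpen_compl
  have hsub : S ⊆ connectedComponentIn U x := hS.subset_connectedComponentIn hx hSγ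
  have hCU : connectedComponentIn U x ⊆ U := connectedComponentIn_subset U x
  refine (hUo.connectedComponentIn).is_const_of_deriv_eq_zero isPreconnected_connectedComponentIn
    (fun z hz => (γ.hasDerivAt_winding (hCU hz)).differentiableAt.differentiableWithinAt)
    (fun z hz => (γ.hasDerivAt_winding (hCU hz)).deriv) (hsub hx) (hsub hy)

lemma winding_eq_zero_of_subset_ball (γ : Contour) {c w : ℂ} {r : ℝ}
    (hγ : Set.range γ.path ⊆ Metric.ball c r) (hw : w ∉ Metric.ball c r) : γ.winding w = 0 := by
  obtain ⟨G, hG⟩ := DifferentiableOn.isExactOn_ball (c := c) (r := r)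
    (f := fun z => (z - w)⁻¹) fun z hz =>
      ((differentiableAt_id.sub_const w).inv
        fun e => hw (sub_eq_zero.1 e ▸ hz)).differentiableWithinAt
  rw [winding, γ.integral_eq_zero_of_hasDerivAt
    (continuousOn_inv_sub fun h => hw (hγ h)) fun z hz => hG z (hγ hz), mul_zero]

/-- A point at least as far from the origin as the whole curve can be moved radially outward to `2
w` without meeting the curve, and there the winding number is zero. -/
lemma winding_eq_zero_of_norm_le (γ : Contour) {w : ℂ} (hw : w ∉ Set.range γ.path)
    (h : ∀ z ∈ Set.range γ.path, ‖z‖ ≤ ‖w‖) : γ.winding w = 0 := by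
  have hw0 : w ≠ 0 := by
    rintro rfl
    have := h (γ.fn 0) (γ.fn_mem 0)
    rw [norm_zero, norm_le_zero_iff] at this
    exact hw (this ▸ γ.fn_mem 0)
  have hpos := norm_pos_iff.2 hw0
  have hfar : γ.winding ((2 : ℝ) • w) = 0 := by
    refine γ.winding_eq_zero_of_subset_ball (c := 0) (r := 2 * ‖w‖) (fun z hz => ?_) ?_
    · rw [mem_ball_zero_iff]
      linarith [h z hz]
    · simp
  have hpre : IsPreconnected ((fun r : ℝ => r • w) '' Set.Icc 1 2) :=
    isPreconnected_Icc.image _ (by fun_prop)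
  rw [← hfar]
  refine γ.winding_eq_of_isPreconnected hpre ?_ ⟨1, by norm_num, one_smul _ _⟩
    ⟨2, by norm_num, rfl⟩
  rintro _ ⟨r, hr, rfl⟩ hmem
  have := h _ hmem
  simp only [norm_smul, Real.norm_eq_abs, abs_of_nonneg (zero_le_one.trans hr.1)] at this
  have hr1 : r = 1 := le_antisymm (by nlinarith) hr.1
  subst hr1
  exact hw (by simpa using hmem)

/-- If `γ` contains the contour `q γ'`, then `γ'` does not go around any point of `q⁻¹ γ`. -/
lemma winding_div_eq_zero {q : ℂ} (hq : q ≠ 0) {γ γ' : Contour}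
    (h : ∀ s, γ.Encloses (q * γ'.path s)) {z : ℂ} (hz : z ∈ Set.range γ.path) :
    z / q ∉ Set.range γ'.path ∧ γ'.winding (z / q) = 0 := by
  have hnot : ∀ w ∈ Set.range γ.path, w / q ∉ Set.range γ'.path := by
    rintro w hw ⟨s, hs⟩
    refine (h s).1 ?_
    rwa [hs, mul_div_cancel₀ _ hq]
  refine ⟨hnot z hz, ?_⟩
  -- Let `p` and `p'` be the points of `γ` and `γ'` farthest from zero. If `|q p'| ≤ |p|`, then `p /
  -- q` is no closer to zero than any point of `γ'`, so its winding number vanishes, and the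
  -- connected set `γ / q`, which misses `γ'`, inherits this. Otherwise `q p'` is farther out than
  -- all of `γ` and cannot be enclosed.
  obtain ⟨p, hp, hpmax⟩ := γ.isCompact_range.exists_isMaxOn ⟨_, γ.fn_mem 0⟩
    continuous_norm.continuousOn
  obtain ⟨p', hp', hpmax'⟩ := γ'.isCompact_range.exists_isMaxOn ⟨_, γ'.fn_mem 0⟩
    continuous_norm.continuousOn
  have hq0 := norm_pos_iff.2 hq
  rcases le_or_gt (‖q‖ * ‖p'‖) ‖p‖ with hle | hlt
  · have h0 : γ'.winding (p / q) = 0 := by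
      refine γ'.winding_eq_zero_of_norm_le (hnot p hp) fun w hw => ?_
      rw [norm_div, le_div_iff₀ hq0]
      have : ‖w‖ ≤ ‖p'‖ := hpmax' hw
      nlinarith
    rw [← h0]
    refine γ'.winding_eq_of_isPreconnected (S := (fun w => w / q) '' Set.range γ.path)
      ((isPreconnected_range γ.path.continuous).image _ (by fun_prop)) ?_ ⟨z, hz, rfl⟩
      ⟨p, hp, rfl⟩
    rintro _ ⟨w, hw, rfl⟩
    exact hnot w hw
  · exfalso
    obtain ⟨s, rfl⟩ := hp'
    have h1 := (h s).2
    rw [γ.winding_eq_zero_of_norm_le (h s).1 fun w hw => ?_] at h1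
    · exact zero_ne_one h1
    · rw [norm_mul]
      exact (hpmax hw : ‖w‖ ≤ ‖p‖).trans hlt.le

/-- The circle with center `c` and radius `r`, positively oriented. -/
def circle (c : ℂ) (r : ℝ) : Contour where
  base := c + r
  path :=
    { toFun := fun t => circleMap c r (2 * Real.pi * t)
      continuous_toFun := by fun_prop
      source' := by simp [circleMap]
      target' := by simp [circleMap] }
  piecewise := by
    refine ⟨1, fun i => min i 1, fun i j hij => min_le_min (Nat.cast_le.2 hij) le_rfl, by simp,
      by simp, fun i hi => ?_⟩
    obtain rfl : i = 0 := by omega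
    refine ContDiff.contDiffOn (f := fun t : ℝ => circleMap c r (2 * Real.pi * t)) ?_ |>.congr ?_
    · exact (contDiff_circleMap c r).comp (contDiff_const.mul contDiff_id)
    · intro t ht
      have ht' : t ∈ Set.Icc (0 : ℝ) 1 := by simpa using ht
      exact Path.extend_apply _ ht'

lemma circle_path_mem_sphere (c : ℂ) {r : ℝ} (hr : 0 ≤ r) {z : ℂ}
    (hz : z ∈ Set.range (circle c r).path) : z ∈ Metric.sphere c r := by
  obtain ⟨t, rfl⟩ := hz
  exact circleMap_mem_sphere c hr _

lemma circle_excludes (c : ℂ) {r : ℝ} (hr : 0 ≤ r) {w : ℂ} (hw : r < dist w c) :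
    (circle c r).Excludes w := by
  refine ⟨fun h => ?_, winding_eq_zero_of_subset_ball _ (c := c) (r := dist w c)
    (fun z hz => ?_) (by simp)⟩
  · have := circle_path_mem_sphere c hr h
    rw [Metric.mem_sphere] at this
    linarith
  · have := circle_path_mem_sphere c hr hz
    rw [Metric.mem_sphere] at this
    rwa [Metric.mem_ball, this]

lemma circle_winding_center (c : ℂ) {r : ℝ} (hr : 0 < r) : (circle c r).winding c = 1 := by
  have hfn : ∀ t ∈ Set.Icc (0 : ℝ) 1, (circle c r).fn t = circleMap c r (2 * Real.pi * t) :=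
    fun t ht => Path.extend_apply _ ht
  rw [winding, integral_eq]
  have : ∀ t ∈ Set.uIoo (0 : ℝ) 1,
      ((circle c r).fn t - c)⁻¹ * (circle c r).vel t = 2 * Real.pi * Complex.I := by
    intro t ht
    rw [Set.uIoo_of_le zero_le_one] at ht
    have hv : (circle c r).vel t =
        deriv (fun t : ℝ => circleMap c r (2 * Real.pi * t)) t := by
      rw [vel, derivWithin_of_mem_nhds (Icc_mem_nhds ht.1 ht.2)]
      refine Filter.EventuallyEq.deriv_eq ?_
      filter_upwards [Icc_mem_nhds ht.1 ht.2] with s hs using hfn s hs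
    have hd : HasDerivAt (fun t : ℝ => circleMap c r (2 * Real.pi * t))
        ((2 * Real.pi : ℝ) • (circleMap 0 r (2 * Real.pi * t) * Complex.I)) t := by
      have := (hasDerivAt_circleMap c r (2 * Real.pi * t)).scomp t
        ((hasDerivAt_id t).const_mul (2 * Real.pi))
      simpa [Function.comp_def] using this
    rw [hv, hd.deriv, hfn t (Set.Ioo_subset_Icc_self ht), circleMap_sub_center]
    have hne : circleMap 0 r (2 * Real.pi * t) ≠ 0 := circleMap_ne_center hr.ne'
    rw [Complex.real_smul]
    push_cast
    field_simp
  rw [intervalIntegral.integral_congr_uIoo this, intervalIntegral.integral_const, sub_zero,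
    one_smul, inv_mul_cancel₀ (by simp [Real.pi_ne_zero])]

lemma circle_encloses (c : ℂ) {r : ℝ} {w : ℂ} (hw : dist w c < r) : (circle c r).Encloses w := by
  have hr : 0 < r := dist_nonneg.trans_lt hw
  have hnot : ∀ x ∈ Metric.ball c r, x ∉ Set.range (circle c r).path := fun x hx h => by
    have := circle_path_mem_sphere c hr.le h
    rw [Metric.mem_sphere] at this
    rw [Metric.mem_ball] at hx
    linarith
  refine ⟨hnot w hw, ?_⟩
  rw [← circle_winding_center c hr]
  exact winding_eq_of_isPreconnected _ (convex_ball c r).isPreconnected hnot hw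
    (Metric.mem_ball_self hr)

end Contour

/-- Circles with diameters `[ε q ^ (2 (k - A)), M]` are nested contours. -/
theorem exists_nestedContours {N : ℕ} {q : ℝ} (hq0 : 0 < q) (hq1 : q < 1) {a : Fin N → ℝ}
    (ha : ∀ i, 0 < a i) (k : ℕ) : ∃ γ : Fin k → Contour, NestedContours q a γ := by
  obtain ⟨ε, hε, hεa⟩ : ∃ ε > 0, ∀ i, ε < a i := by
    have : ∀ᶠ ε in 𝓝[>] (0 : ℝ), ∀ i, ε < a i :=
      eventually_all.2 fun i => (eventually_lt_nhds (ha i)).filter_mono nhdsWithin_le_nhds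
    exact (this.and self_mem_nhdsWithin).exists.imp fun ε h => ⟨h.2, h.1⟩
  obtain ⟨M, hM⟩ : ∃ M, ∀ i, max (a i) ε < M := by
    have : ∀ᶠ M in atTop, ∀ i, max (a i) ε < M := eventually_all.2 fun i => eventually_gt_atTop _
    exact this.exists
  -- For `N = 0` nothing forces `M` above `ε`, so the common right endpoint `M'` is taken larger
  -- than both.
  obtain ⟨M', hM', hMM'⟩ : ∃ M', ε < M' ∧ M ≤ M' := ⟨max (ε + 1) M, by simp, by simp⟩
  have haM : ∀ i, a i < M' := fun i => ((le_max_left _ _).trans_lt (hM i)).trans_le hMM'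
  -- Consecutive left endpoints differ by the factor `q ^ 2`, which leaves room for `l A < q * l B`
  -- when `A < B`.
  set l : Fin k → ℝ := fun A => ε * q ^ (2 * (k - A : ℕ)) with hl
  have hl0 : ∀ A, 0 < l A := fun A => by positivity
  have hlε : ∀ A, l A ≤ ε := fun A =>
    mul_le_of_le_one_right hε.le (pow_le_one₀ hq0.le hq1.le)
  have hlq : ∀ A B, A < B → l A < q * l B := fun A B hAB => by
    have hlt : (A : ℕ) < B := hAB
    have hB := B.2
    have : q ^ (2 * (k - A : ℕ)) < q ^ (2 * (k - B : ℕ) + 1) :=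
      pow_lt_pow_right_of_lt_one₀ hq0 hq1 (by omega)
    calc l A < ε * q ^ (2 * (k - B : ℕ) + 1) := by simp only [hl]; gcongr
      _ = q * l B := by simp only [hl]; ring
  have hreal : ∀ A (x : ℝ), l A < x → x < M' →
      dist (x : ℂ) (((l A + M') / 2 : ℝ) : ℂ) < (M' - l A) / 2 := by
    intro A x h1 h2
    rw [Complex.dist_of_im_eq (by simp)]
    simp only [Complex.ofReal_re, Real.dist_eq]
    rw [abs_lt]
    constructor <;> linarith
  refine ⟨fun A => Contour.circle (((l A + M') / 2 : ℝ) : ℂ) ((M' - l A) / 2), fun A => ⟨?_, ?_, ?_⟩⟩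
  · exact fun i => Contour.circle_encloses _ (hreal A _ ((hlε A).trans_lt (hεa i)) (haM i))
  · intro B hAB s
    have hB := hlε B
    have hAB' := hlq A B hAB
    refine Contour.circle_encloses _ ?_
    have hz := Contour.circle_path_mem_sphere (((l B + M') / 2 : ℝ) : ℂ)
      (by linarith : (0 : ℝ) ≤ (M' - l B) / 2) (Set.mem_range_self s)
    rw [Metric.mem_sphere] at hz
    set z := (Contour.circle (((l B + M') / 2 : ℝ) : ℂ) ((M' - l B) / 2)).path s
    -- The image disc has diameter `[q l_B, q M']`. The two signs of the absolute value correspond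
    -- to `q M' < M'` on the right and `l_A < q l_B` on the left.
    calc dist ((q : ℂ) * z) (((l A + M') / 2 : ℝ) : ℂ)
        ≤ dist ((q : ℂ) * z) (q * (((l B + M') / 2 : ℝ) : ℂ)) +
          dist ((q : ℂ) * (((l B + M') / 2 : ℝ) : ℂ)) (((l A + M') / 2 : ℝ) : ℂ) :=
          dist_triangle _ _ _
      _ = q * ((M' - l B) / 2) + |q * ((l B + M') / 2) - (l A + M') / 2| := by
        congr 1
        · rw [dist_eq_norm, ← mul_sub, norm_mul, ← dist_eq_norm, hz]
          simp [abs_of_pos hq0]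
        · rw [← Complex.ofReal_mul, Complex.dist_of_im_eq (by simp)]
          simp only [Complex.ofReal_re, Real.dist_eq]
      _ < (M' - l A) / 2 := by
        rcases abs_cases (q * ((l B + M') / 2) - (l A + M') / 2) with ⟨h, _⟩ | ⟨h, _⟩ <;> rw [h]
        · nlinarith
        · nlinarith
  · refine Contour.circle_excludes _ (by linarith [hlε A]) ?_
    rw [dist_comm, dist_zero_right, Complex.norm_real, Real.norm_eq_abs,
      abs_of_pos (by linarith [hl0 A])]
    linarith [hl0 A]

end QPushASEP

/-! ### Multiple contour integrals as integrals over a product measure -/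

namespace QPushASEP

/-- Lebesgue measure on the parameter interval. -/
abbrev unitMeasure : Measure ℝ := volume.restrict (Set.Ioc 0 1)

section MultiIntegral

variable {k : ℕ}

/-- The points whose coordinates run over the given contours. -/
def contourSet (γ : Fin k → Contour) : Set (Fin k → ℂ) :=
  Set.univ.pi fun j => Set.range (γ j).path

/-- The parametrization of a product of contours. -/
def pathPoint (γ : Fin k → Contour) (s : Fin k → ℝ) : Fin k → ℂ := fun j => (γ j).fn (s j)

/-- The density of `dz_1 ⋯ dz_k` in the parametrization of a product of contours. -/
def velProd (γ : Fin k → Contour) (s : Fin k → ℝ) : ℂ := ∏ j, (γ j).vel (s j)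

/-- The integral over a product of contours. -/
def multiIntegral (γ : Fin k → Contour) (F : (Fin k → ℂ) → ℂ) : ℂ :=
  ∫ s, F (pathPoint γ s) * velProd γ s ∂(Measure.pi fun _ => unitMeasure)

lemma pathPoint_mem (γ : Fin k → Contour) (s : Fin k → ℝ) : pathPoint γ s ∈ contourSet γ :=
  fun j _ => (γ j).fn_mem (s j)

lemma continuous_pathPoint (γ : Fin k → Contour) : Continuous (pathPoint γ) :=
  continuous_pi fun j => (γ j).continuous_fn.comp (continuous_apply j)

lemma isCompact_contourSet (γ : Fin k → Contour) : IsCompact (contourSet γ) :=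
  isCompact_univ_pi fun j => (γ j).isCompact_range

lemma integrable_vel (γ : Contour) : Integrable γ.vel unitMeasure :=
  (intervalIntegrable_iff_integrableOn_Ioc_of_le zero_le_one).1 γ.intervalIntegrable_vel

lemma integrable_velProd (γ : Fin k → Contour) :
    Integrable (velProd γ) (Measure.pi fun _ => unitMeasure) :=
  Integrable.fintype_prod fun j => integrable_vel (γ j)

lemma exists_norm_pathPoint_le {γ : Fin k → Contour} {F : (Fin k → ℂ) → ℂ}
    (hF : ContinuousOn F (contourSet γ)) : ∃ C, ∀ s, ‖F (pathPoint γ s)‖ ≤ C := by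
  obtain ⟨C, hC⟩ := (isCompact_contourSet γ).exists_bound_of_continuousOn hF
  exact ⟨C, fun s => hC _ (pathPoint_mem γ s)⟩

lemma continuous_comp_pathPoint {γ : Fin k → Contour} {F : (Fin k → ℂ) → ℂ}
    (hF : ContinuousOn F (contourSet γ)) : Continuous fun s => F (pathPoint γ s) :=
  hF.comp_continuous (continuous_pathPoint γ) (pathPoint_mem γ)

lemma integrable_mul_velProd {γ : Fin k → Contour} {F : (Fin k → ℂ) → ℂ}
    (hF : ContinuousOn F (contourSet γ)) :
    Integrable (fun s => F (pathPoint γ s) * velProd γ s) (Measure.pi fun _ => unitMeasure) := by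
  obtain ⟨C, hC⟩ := exists_norm_pathPoint_le hF
  exact (integrable_velProd γ).bdd_mul (continuous_comp_pathPoint hF).aestronglyMeasurable
    (Eventually.of_forall hC)

lemma multiIntegral_congr {γ : Fin k → Contour} {F G : (Fin k → ℂ) → ℂ}
    (h : ∀ z ∈ contourSet γ, F z = G z) : multiIntegral γ F = multiIntegral γ G := by
  simp only [multiIntegral, h _ (pathPoint_mem γ _)]

lemma multiIntegral_add {γ : Fin k → Contour} {F G : (Fin k → ℂ) → ℂ}
    (hF : ContinuousOn F (contourSet γ)) (hG : ContinuousOn G (contourSet γ)) :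
    multiIntegral γ (fun z => F z + G z) = multiIntegral γ F + multiIntegral γ G := by
  simp only [multiIntegral, add_mul]
  exact integral_add (integrable_mul_velProd hF) (integrable_mul_velProd hG)

lemma multiIntegral_const_mul (γ : Fin k → Contour) (c : ℂ) (F : (Fin k → ℂ) → ℂ) :
    multiIntegral γ (fun z => c * F z) = c * multiIntegral γ F := by
  simp only [multiIntegral, mul_assoc]
  exact integral_const_mul c _

lemma multiIntegral_sub {γ : Fin k → Contour} {F G : (Fin k → ℂ) → ℂ}
    (hF : ContinuousOn F (contourSet γ)) (hG : ContinuousOn G (contourSet γ)) :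
    multiIntegral γ (fun z => F z - G z) = multiIntegral γ F - multiIntegral γ G := by
  simp only [multiIntegral, sub_mul]
  exact integral_sub (integrable_mul_velProd hF) (integrable_mul_velProd hG)

lemma multiIntegral_sum {γ : Fin k → Contour} {ι : Type*} (s : Finset ι)
    {F : ι → (Fin k → ℂ) → ℂ} (hF : ∀ i ∈ s, ContinuousOn (F i) (contourSet γ)) :
    multiIntegral γ (fun z => ∑ i ∈ s, F i z) = ∑ i ∈ s, multiIntegral γ (F i) := by
  simp only [multiIntegral, Finset.sum_mul]
  exact integral_finsetSum s fun i hi => integrable_mul_velProd (hF i hi)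

lemma velProd_insertNth (γ : Fin (k + 1) → Contour) (j : Fin (k + 1)) (t : ℝ) (s : Fin k → ℝ) :
    velProd γ (j.insertNth t s) = (γ j).vel t * velProd (fun i => γ (j.succAbove i)) s := by
  simp [velProd, Fin.prod_univ_succAbove _ j]

lemma pathPoint_insertNth (γ : Fin (k + 1) → Contour) (j : Fin (k + 1)) (t : ℝ)
    (s : Fin k → ℝ) : pathPoint γ (j.insertNth t s) =
      j.insertNth ((γ j).fn t) (pathPoint (fun i => γ (j.succAbove i)) s) := by
  ext i
  refine Fin.succAboveCases j ?_ (fun i => ?_) i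
  · simp [pathPoint]
  · simp [pathPoint]

lemma multiIntegral_eq_integral_prod (γ : Fin (k + 1) → Contour) (j : Fin (k + 1))
    (F : (Fin (k + 1) → ℂ) → ℂ) :
    multiIntegral γ F = ∫ p : ℝ × (Fin k → ℝ),
      F (j.insertNth ((γ j).fn p.1) (pathPoint (fun i => γ (j.succAbove i)) p.2)) *
        ((γ j).vel p.1 * velProd (fun i => γ (j.succAbove i)) p.2)
      ∂(unitMeasure.prod (Measure.pi fun _ => unitMeasure)) := by
  rw [multiIntegral, ← ((measurePreserving_piFinSuccAbove (fun _ => unitMeasure) j).symm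
    ).integral_comp']
  refine integral_congr_ae (Eventually.of_forall fun p => ?_)
  simp only [MeasurableEquiv.piFinSuccAbove_symm_apply, Fin.insertNthEquiv, Equiv.coe_fn_mk,
    velProd_insertNth, pathPoint_insertNth]

lemma integrable_prod_of_continuousOn {γ : Fin (k + 1) → Contour} (j : Fin (k + 1))
    {F : (Fin (k + 1) → ℂ) → ℂ} (hF : ContinuousOn F (contourSet γ)) :
    Integrable (fun p : ℝ × (Fin k → ℝ) =>
      F (j.insertNth ((γ j).fn p.1) (pathPoint (fun i => γ (j.succAbove i)) p.2)) *
        ((γ j).vel p.1 * velProd (fun i => γ (j.succAbove i)) p.2))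
      (unitMeasure.prod (Measure.pi fun _ => unitMeasure)) := by
  have := ((measurePreserving_piFinSuccAbove (fun _ => unitMeasure) j).symm
    ).integrable_comp_of_integrable (integrable_mul_velProd hF)
  refine this.congr (Eventually.of_forall fun p => ?_)
  simp only [Function.comp_apply, MeasurableEquiv.piFinSuccAbove_symm_apply, Fin.insertNthEquiv,
    Equiv.coe_fn_mk, velProd_insertNth, pathPoint_insertNth]

lemma contour_integral_eq_integral (γ : Contour) (f : ℂ → ℂ) :
    γ.integral f = ∫ t, f (γ.fn t) * γ.vel t ∂unitMeasure := by
  rw [γ.integral_eq, intervalIntegral.integral_of_le zero_le_one]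

/-- Fubini: the variable `z_j` is integrated first. -/
lemma multiIntegral_eq_integral_inner {γ : Fin (k + 1) → Contour} (j : Fin (k + 1))
    {F : (Fin (k + 1) → ℂ) → ℂ} (hF : ContinuousOn F (contourSet γ)) :
    multiIntegral γ F = multiIntegral (fun i => γ (j.succAbove i))
      fun w => (γ j).integral fun z => F (j.insertNth z w) := by
  rw [multiIntegral_eq_integral_prod γ j,
    integral_prod_symm _ (integrable_prod_of_continuousOn j hF), multiIntegral]
  refine integral_congr_ae (Eventually.of_forall fun s => ?_)
  simp only
  rw [contour_integral_eq_integral, ← integral_mul_const]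
  simp only [mul_assoc]

/-- Fubini: the variable `z_j` is integrated last. -/
lemma multiIntegral_eq_integral_outer {γ : Fin (k + 1) → Contour} (j : Fin (k + 1))
    {F : (Fin (k + 1) → ℂ) → ℂ} (hF : ContinuousOn F (contourSet γ)) :
    multiIntegral γ F = (γ j).integral fun z =>
      multiIntegral (fun i => γ (j.succAbove i)) fun w => F (j.insertNth z w) := by
  rw [multiIntegral_eq_integral_prod γ j,
    integral_prod _ (integrable_prod_of_continuousOn j hF), contour_integral_eq_integral]
  refine integral_congr_ae (Eventually.of_forall fun s => ?_)
  simp only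
  rw [multiIntegral, ← integral_mul_const]
  refine integral_congr_ae (Eventually.of_forall fun p => ?_)
  ring

lemma insertNth_mem_contourSet {γ : Fin (k + 1) → Contour} (j : Fin (k + 1)) {z : ℂ}
    {w : Fin k → ℂ} (hz : z ∈ Set.range (γ j).path)
    (hw : w ∈ contourSet fun i => γ (j.succAbove i)) : j.insertNth z w ∈ contourSet γ := by
  intro i _
  refine Fin.succAboveCases j ?_ (fun i => ?_) i
  · simpa using hz
  · simpa using hw i trivial

/-- In the product form the variables can be integrated in any order and permuted; the iterated form
fixes the order. -/
theorem iteratedIntegral_eq_multiIntegral {γ : Fin k → Contour} {F : (Fin k → ℂ) → ℂ}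
    (hF : ContinuousOn F (contourSet γ)) : iteratedIntegral γ F = multiIntegral γ F := by
  induction k with
  | zero =>
    rw [iteratedIntegral, multiIntegral, Measure.pi_of_empty _ (Fin.elim0 : Fin 0 → ℝ),
      integral_dirac]
    simp [velProd, Subsingleton.elim (pathPoint γ _) Fin.elim0]
  | succ k ih =>
    rw [iteratedIntegral, multiIntegral_eq_integral_outer 0 hF]
    refine Contour.integral_congr _ fun z hz => ?_
    simp only [Fin.zero_succAbove, Fin.insertNth_zero']
    refine ih (hF.comp (Continuous.continuousOn ?_) fun w hw => ?_)
    · exact continuous_const.finCons continuous_id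
    · rw [← Fin.insertNth_zero']
      exact insertNth_mem_contourSet 0 hz (by simpa using hw)

/-- Replacing the contour of one variable. -/
lemma multiIntegral_eq_mul_update {γ : Fin k → Contour} (j : Fin k) (η : Contour) (c : ℂ)
    {F : (Fin k → ℂ) → ℂ} (hF : ContinuousOn F (contourSet γ))
    (hF' : ContinuousOn F (contourSet (Function.update γ j η)))
    (h : ∀ z ∈ contourSet γ, (γ j).integral (fun x => F (Function.update z j x)) =
      c * η.integral (fun x => F (Function.update z j x))) :
    multiIntegral γ F = c * multiIntegral (Function.update γ j η) F := by
  obtain _ | k := k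
  · exact j.elim0
  rw [multiIntegral_eq_integral_inner j hF, multiIntegral_eq_integral_inner j hF',
    ← multiIntegral_const_mul]
  simp only [Function.update_self, ne_eq, Fin.succAbove_ne, not_false_eq_true,
    Function.update_of_ne]
  refine multiIntegral_congr fun w hw => ?_
  have := h _ (insertNth_mem_contourSet j ((γ j).fn_mem 0) hw)
  simpa only [Fin.update_insertNth] using this

lemma multiIntegral_eq_zero {γ : Fin k → Contour} (j : Fin k)
    {F : (Fin k → ℂ) → ℂ} (hF : ContinuousOn F (contourSet γ))
    (h : ∀ z ∈ contourSet γ, (γ j).integral (fun x => F (Function.update z j x)) = 0) :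
    multiIntegral γ F = 0 := by
  rw [multiIntegral_eq_mul_update j (γ j) 0 hF (by rwa [Function.update_eq_self])
    (by simpa using h), zero_mul]

lemma multiIntegral_comp_perm (γ : Fin k → Contour) (σ : Equiv.Perm (Fin k))
    (F : (Fin k → ℂ) → ℂ) :
    multiIntegral γ (fun z => F (z ∘ σ)) = multiIntegral (γ ∘ σ) F := by
  rw [multiIntegral, multiIntegral, ← (measurePreserving_piCongrLeft
    (fun _ : Fin k => unitMeasure) σ).integral_comp']
  refine integral_congr_ae (Eventually.of_forall fun s => ?_)
  have hs : ∀ i, MeasurableEquiv.piCongrLeft (fun _ : Fin k => ℝ) σ s (σ i) = s i := fun i => by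
    rw [MeasurableEquiv.coe_piCongrLeft, Equiv.piCongrLeft_apply_apply]
  simp only
  congr 1
  · congr 1
    ext i
    simp [pathPoint, hs]
  · simp only [velProd, Function.comp_apply]
    rw [← Equiv.prod_comp σ]
    simp [hs]

/-- Exchanging two variables on the same contour preserves the integral, while the integrand changes
its sign. -/
lemma multiIntegral_eq_zero_of_swap {γ : Fin k → Contour} {i j : Fin k} (hγ : γ i = γ j)
    {F : (Fin k → ℂ) → ℂ} (hF : ∀ z ∈ contourSet γ, F (z ∘ Equiv.swap i j) = -F z) :
    multiIntegral γ F = 0 := by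
  have hσ : γ ∘ Equiv.swap i j = γ := by
    ext l : 1
    simp only [Function.comp_apply, Equiv.swap_apply_def]
    split_ifs with h1 h2
    · rw [h1, hγ]
    · rw [h2, hγ]
    · rfl
  have h1 := multiIntegral_comp_perm γ (Equiv.swap i j) F
  rw [hσ, multiIntegral_congr hF] at h1
  have h2 := multiIntegral_const_mul γ (-1) F
  simp only [neg_one_mul] at h2
  rw [h2] at h1
  linear_combination (-1 / 2 : ℂ) * h1

/-- The time dependence of the moment integrand has this form, with `Λ` the sum of the one-variable
eigenvalues. The contours are compact, so `G` and `Λ` are bounded and the derivative is dominated by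
a multiple of the integrable velocity for times within distance one of `t`. -/
lemma hasDerivAt_multiIntegral_exp {γ : Fin k → Contour} {G Λ : (Fin k → ℂ) → ℂ}
    (hG : ContinuousOn G (contourSet γ)) (hΛ : ContinuousOn Λ (contourSet γ)) (t : ℝ) :
    HasDerivAt (fun t : ℝ => multiIntegral γ fun z => Complex.exp (t * Λ z) * G z)
      (multiIntegral γ fun z => Λ z * (Complex.exp (t * Λ z) * G z)) t := by
  have hcont : ∀ t : ℝ, ContinuousOn (fun z => Complex.exp (t * Λ z) * G z) (contourSet γ) :=
    fun t => (Complex.continuous_exp.comp_continuousOn (continuousOn_const.mul hΛ)).mul hG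
  obtain ⟨C, hC⟩ := exists_norm_pathPoint_le hG
  obtain ⟨B, hB⟩ := exists_norm_pathPoint_le hΛ
  have hC0 : 0 ≤ C := (norm_nonneg _).trans (hC 0)
  have hB0 : 0 ≤ B := (norm_nonneg _).trans (hB 0)
  refine (hasDerivAt_integral_of_dominated_loc_of_deriv_le
    (F := fun (t : ℝ) s => (Complex.exp (t * Λ (pathPoint γ s)) * G (pathPoint γ s)) * velProd γ s)
    (F' := fun (t : ℝ) s => (Λ (pathPoint γ s) *
      (Complex.exp (t * Λ (pathPoint γ s)) * G (pathPoint γ s))) * velProd γ s)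
    (bound := fun s => (B * (Real.exp ((|t| + 1) * B) * C)) * ‖velProd γ s‖)
    (Metric.ball_mem_nhds t one_pos) ?_ ?_ ?_ ?_ ?_ ?_).2
  · exact Eventually.of_forall fun t => (integrable_mul_velProd (hcont t)).1
  · exact integrable_mul_velProd (hcont t)
  · exact (integrable_mul_velProd (hΛ.mul (hcont t))).1
  · refine Eventually.of_forall fun s x hx => ?_
    rw [norm_mul, norm_mul, norm_mul, Complex.norm_exp]
    have hx' : |x| ≤ |t| + 1 := by
      have := abs_sub_abs_le_abs_sub x t
      rw [Metric.mem_ball, Real.dist_eq] at hx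
      linarith
    gcongr
    · exact hB s
    · refine (Complex.re_le_norm _).trans ?_
      rw [norm_mul, Complex.norm_real, Real.norm_eq_abs]
      gcongr
      exact hB s
    · exact hC s
  · exact (integrable_velProd γ).norm.const_mul _
  · refine Eventually.of_forall fun s x _ => HasDerivAt.mul_const ?_ _
    have h1 : HasDerivAt (fun t : ℝ => (t : ℂ) * Λ (pathPoint γ s)) (Λ (pathPoint γ s)) x := by
      simpa using (Complex.ofRealCLM.hasDerivAt (x := x)).mul_const (Λ (pathPoint γ s))
    refine (h1.cexp.mul_const (G (pathPoint γ s))).congr_deriv ?_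
    ring

end MultiIntegral

end QPushASEP

namespace QPushASEP

/-! ### Functions with poles in a given set -/

/-- `f` is holomorphic outside zero, up to finitely many poles that lie in `Z`. -/
def HasPoles (Z : Set ℂ) (f : ℂ → ℂ) : Prop :=
  ∃ (g : ℂ → ℂ) (m : Multiset ℂ), DifferentiableOn ℂ g {0}ᶜ ∧ (∀ s ∈ m, s ∈ Z) ∧
    ∀ z, f z = g z * Contour.poleProd m z

namespace HasPoles

variable {Z Z' : Set ℂ} {f g : ℂ → ℂ}

lemma of_differentiableOn (hf : DifferentiableOn ℂ f {0}ᶜ) : HasPoles Z f :=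
  ⟨f, 0, hf, by simp, by simp⟩

lemma const (c : ℂ) : HasPoles Z fun _ => c := of_differentiableOn (differentiableOn_const c)

lemma inv_id : HasPoles Z fun z => z⁻¹ :=
  of_differentiableOn fun _ hz => (differentiableAt_inv hz).differentiableWithinAt

lemma inv_sub {s : ℂ} (hs : s ∈ Z) : HasPoles Z fun z => (z - s)⁻¹ :=
  ⟨fun _ => 1, {s}, differentiableOn_const 1, by simpa using hs, fun z => by
    rw [Contour.poleProd_singleton, one_mul]⟩

lemma mul (hf : HasPoles Z f) (hg : HasPoles Z g) : HasPoles Z fun z => f z * g z := by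
  obtain ⟨F, m, hF, hm, hfF⟩ := hf
  obtain ⟨G, m', hG, hm', hgG⟩ := hg
  refine ⟨fun z => F z * G z, m + m', hF.mul hG, fun s hs => ?_, fun z => ?_⟩
  · rcases Multiset.mem_add.1 hs with h | h
    exacts [hm s h, hm' s h]
  · simp only [Contour.poleProd_add, hfF, hgG]
    ring

lemma prod {ι : Type*} {S : Finset ι} {f : ι → ℂ → ℂ} (h : ∀ i ∈ S, HasPoles Z (f i)) :
    HasPoles Z fun z => ∏ i ∈ S, f i z := by
  classical
  induction S using Finset.induction with
  | empty => simpa using const 1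
  | insert i S hi ih =>
    simp only [Finset.prod_insert hi]
    exact (h i (Finset.mem_insert_self i S)).mul
      (ih fun j hj => h j (Finset.mem_insert_of_mem hj))

lemma mono (hf : HasPoles Z f) (h : Z ⊆ Z') : HasPoles Z' f := by
  obtain ⟨g, m, hg, hm, hfg⟩ := hf
  exact ⟨g, m, hg, fun s hs => h (hm s hs), hfg⟩

lemma continuousOn (hf : HasPoles Z f) {S : Set ℂ} (h0 : (0 : ℂ) ∉ S) (hS : ∀ s ∈ Z, s ∉ S) :
    ContinuousOn f S := by
  obtain ⟨g, m, hg, hm, hfg⟩ := hf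
  rw [funext hfg]
  exact (hg.continuousOn.mono fun z hz e => h0 (e ▸ hz)).mul
    (Contour.continuousOn_poleProd fun s hs => hS s (hm s hs))

lemma integral_eq_mul (hf : HasPoles Z f) {γ γ' : Contour} {c : ℂ} (hγ : γ.Excludes 0)
    (hγ' : γ'.Excludes 0) (h : ∀ s ∈ Z, s ≠ 0 ∧ s ∉ Set.range γ.path ∧ s ∉ Set.range γ'.path ∧
      γ.winding s = c * γ'.winding s) : γ.integral f = c * γ'.integral f := by
  obtain ⟨g, m, hg, hm, hfg⟩ := hf
  rw [funext hfg]
  exact Contour.integral_mul_poleProd_eq_mul hγ hγ' hg fun s hs => h s (hm s hs)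

end HasPoles

/-! ### The interaction factor of the integrand -/

section Cross

variable {k : ℕ}

/-- The product of `(z_A - z_B) / (z_A - q z_B)` over the pairs `(A, B)` in `S`. -/
def crossOn (q : ℂ) (S : Finset (Fin k × Fin k)) (z : Fin k → ℂ) : ℂ :=
  ∏ p ∈ S, (z p.1 - z p.2) / (z p.1 - q * z p.2)

/-- The pairs `(A, B)` with `A < B`. -/
def ltPairs (k : ℕ) : Finset (Fin k × Fin k) := Finset.univ.filter fun p => p.1 < p.2

lemma mem_ltPairs {p : Fin k × Fin k} : p ∈ ltPairs k ↔ p.1 < p.2 := by simp [ltPairs]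

lemma prod_prod_Ioi_eq_crossOn (q : ℂ) (z : Fin k → ℂ) :
    ∏ A : Fin k, ∏ B ∈ Finset.Ioi A, (z A - z B) / (z A - q * z B) =
      crossOn q (ltPairs k) z := by
  rw [crossOn, ltPairs, Finset.prod_filter, ← Finset.univ_product_univ, Finset.prod_product]
  refine Finset.prod_congr rfl fun A _ => ?_
  rw [← Finset.prod_filter]
  exact Finset.prod_congr (by ext; simp) fun _ _ => rfl

lemma continuousOn_crossOn {q : ℂ} {S : Finset (Fin k × Fin k)} {T : Set (Fin k → ℂ)}
    (h : ∀ z ∈ T, ∀ p ∈ S, z p.1 - q * z p.2 ≠ 0) : ContinuousOn (crossOn q S) T := by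
  unfold crossOn
  refine continuousOn_finsetProd _ fun p hp => ContinuousOn.div ?_ ?_ fun z hz => h z hz p hp
  · fun_prop
  · fun_prop

/-- As a function of `z_j` alone, the interaction has poles `q z_B` from the pairs `(j, B)` and `z_A
/ q` from the pairs `(A, j)`. -/
lemma hasPoles_crossOn {q : ℂ} (hq : q ≠ 0) {S : Finset (Fin k × Fin k)} {j : Fin k}
    {z : Fin k → ℂ} {Z : Set ℂ} (hS : ∀ p ∈ S, p.1 ≠ p.2)
    (h1 : ∀ p ∈ S, p.1 = j → q * z p.2 ∈ Z) (h2 : ∀ p ∈ S, p.2 = j → z p.1 / q ∈ Z) :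
    HasPoles Z fun x => crossOn q S (Function.update z j x) := by
  unfold crossOn
  refine HasPoles.prod fun p hp => ?_
  by_cases hp1 : p.1 = j
  · have hp2 : p.2 ≠ j := fun e => hS p hp (hp1.trans e.symm)
    simp only [hp1, Function.update_self, Function.update_of_ne hp2, div_eq_mul_inv]
    exact HasPoles.mul (.of_differentiableOn (by fun_prop)) (.inv_sub (h1 p hp hp1))
  · by_cases hp2 : p.2 = j
    · simp only [hp2, Function.update_self, Function.update_of_ne hp1]
      have : ∀ x, (z p.1 - x) / (z p.1 - q * x) =
          ((z p.1 - x) * (-q⁻¹)) * (x - z p.1 / q)⁻¹ := fun x => by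
        rw [show z p.1 - q * x = (-q) * (x - z p.1 / q) by field_simp; ring, div_eq_mul_inv,
          mul_inv, inv_neg, mul_assoc]
      simp only [this]
      exact HasPoles.mul (.of_differentiableOn (by fun_prop)) (.inv_sub (h2 p hp hp2))
    · simp only [Function.update_of_ne hp1, Function.update_of_ne hp2]
      exact .const _

lemma hasPoles_prod_update {Z : Set ℂ} {h : Fin k → ℂ → ℂ} {j : Fin k} (hj : HasPoles Z (h j))
    (z : Fin k → ℂ) : HasPoles Z fun x => ∏ i, h i (Function.update z j x i) := by
  refine HasPoles.prod fun i _ => ?_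
  by_cases hi : i = j
  · subst hi
    simpa using hj
  · simpa only [Function.update_of_ne hi] using .const _

/-- The pairs `A < B` other than a pair of neighbours are permuted by the exchange of the
neighbours. -/
lemma crossOn_erase_swap (q : ℂ) {j j' : Fin k} (hj : (j' : ℕ) = j + 1) (z : Fin k → ℂ) :
    crossOn q ((ltPairs k).erase (j, j')) (z ∘ Equiv.swap j j') =
      crossOn q ((ltPairs k).erase (j, j')) z := by
  unfold crossOn
  have hmem : ∀ p ∈ (ltPairs k).erase (j, j'),
      (Equiv.swap j j' p.1, Equiv.swap j j' p.2) ∈ (ltPairs k).erase (j, j') := by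
    rintro ⟨A, B⟩ hp
    simp only [Finset.mem_erase, mem_ltPairs, ne_eq, Prod.mk.injEq, not_and, Fin.lt_def,
      Fin.ext_iff, Equiv.swap_apply_def] at hp ⊢
    split_ifs <;> omega
  refine Finset.prod_bij' (fun p _ => (Equiv.swap j j' p.1, Equiv.swap j j' p.2))
    (fun p _ => (Equiv.swap j j' p.1, Equiv.swap j j' p.2)) hmem hmem ?_ ?_ ?_
  · simp
  · simp
  · simp

end Cross

/-! ### Nested contours -/

namespace NestedContours

variable {N k : ℕ} {q : ℝ} {a : Fin N → ℝ} {γ : Fin k → Contour}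

lemma ne_zero (hγ : NestedContours q a γ) {A : Fin k} {z : ℂ}
    (hz : z ∈ Set.range (γ A).path) : z ≠ 0 := fun e => (hγ A).2.2.1 (e ▸ hz)

lemma ne_rate (hγ : NestedContours q a γ) {A : Fin k} {z : ℂ}
    (hz : z ∈ Set.range (γ A).path) (i : Fin N) : z ≠ a i := fun e => ((hγ A).1 i).1 (e ▸ hz)

lemma encloses_mul (hγ : NestedContours q a γ) {A B : Fin k} (hAB : A < B) {z : ℂ}
    (hz : z ∈ Set.range (γ B).path) : (γ A).Encloses (q * z) := by
  obtain ⟨s, rfl⟩ := hz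
  exact (hγ A).2.1 B hAB s

lemma sub_ne_zero (hγ : NestedContours q a γ) {A B : Fin k} (hAB : A < B) {z w : ℂ}
    (hz : z ∈ Set.range (γ A).path) (hw : w ∈ Set.range (γ B).path) : z - q * w ≠ 0 := fun e =>
  (hγ.encloses_mul hAB hw).1 ((_root_.sub_eq_zero.1 e) ▸ hz)

lemma excludes_div (hγ : NestedContours q a γ) (hq : 0 < q) {A B : Fin k} (hAB : A < B) {z : ℂ}
    (hz : z ∈ Set.range (γ A).path) : (γ B).Excludes (z / q) :=
  Contour.winding_div_eq_zero (by exact_mod_cast hq.ne') ((hγ A).2.1 B hAB) hz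

lemma continuousOn_crossOn (hγ : NestedContours q a γ) {S : Finset (Fin k × Fin k)}
    (hS : S ⊆ ltPairs k) : ContinuousOn (crossOn (q : ℂ) S) (contourSet γ) :=
  QPushASEP.continuousOn_crossOn fun _ hz _ hp =>
    hγ.sub_ne_zero (mem_ltPairs.1 (hS hp)) (hz _ trivial) (hz _ trivial)

lemma continuousOn_prod (hγ : NestedContours q a γ) {h : Fin k → ℂ → ℂ}
    (hh : ∀ i, HasPoles (Set.range fun i => (a i : ℂ)) (h i)) :
    ContinuousOn (fun z : Fin k → ℂ => ∏ i, h i (z i)) (contourSet γ) := by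
  refine continuousOn_finsetProd _ fun i _ => ?_
  refine ((hh i).continuousOn (S := Set.range (γ i).path) (hγ i).2.2.1 ?_).comp
    (continuous_apply i).continuousOn fun z hz => hz i trivial
  rintro _ ⟨l, rfl⟩
  exact ((hγ i).1 l).1

lemma tail {γ : Fin (k + 1) → Contour} (hγ : NestedContours q a γ) :
    NestedContours q a fun i : Fin k => γ i.succ := fun _ =>
  ⟨(hγ _).1, fun _ hAB => (hγ _).2.1 _ (Fin.succ_lt_succ_iff.2 hAB), (hγ _).2.2⟩

/-- The integral vanishes if the innermost variable has no poles inside its contour. -/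
lemma multiIntegral_eq_zero_of_last (hγ : NestedContours q a γ) (hq : 0 < q) {h : Fin k → ℂ → ℂ}
    (hh : ∀ i, HasPoles (Set.range fun i => (a i : ℂ)) (h i)) {j : Fin k}
    (hlast : (j : ℕ) + 1 = k) (hj : HasPoles ∅ (h j)) :
    multiIntegral γ (fun z => crossOn q (ltPairs k) z * ∏ i, h i (z i)) = 0 := by
  have hqC : (q : ℂ) ≠ 0 := by exact_mod_cast hq.ne'
  refine multiIntegral_eq_zero j
    ((hγ.continuousOn_crossOn subset_rfl).mul (hγ.continuousOn_prod hh)) fun z hz => ?_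
  -- No pair has the last variable as its first component, so only the poles `z_A / q` remain, and
  -- these lie outside its contour.
  have hp : HasPoles {s | ∃ A < j, s = z A / q} fun x =>
      crossOn q (ltPairs k) (Function.update z j x) * ∏ i, h i (Function.update z j x i) := by
    refine HasPoles.mul (hasPoles_crossOn hqC ?_ ?_ ?_)
      (hasPoles_prod_update (hj.mono (Set.empty_subset _)) z)
    · intro p hp
      exact (mem_ltPairs.1 hp).ne
    · intro p hp hpj
      have h1 : (p.1 : ℕ) < p.2 := mem_ltPairs.1 hp
      have h2 := p.2.2
      rw [hpj] at h1
      omega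
    · intro p hp hpj
      exact ⟨p.1, hpj ▸ mem_ltPairs.1 hp, rfl⟩
  rw [hp.integral_eq_mul (γ' := γ j) (c := 0) (hγ j).2.2 (hγ j).2.2, zero_mul]
  rintro _ ⟨A, hA, rfl⟩
  have hex := hγ.excludes_div hq hA (hz A trivial)
  exact ⟨div_ne_zero (hγ.ne_zero (hz A trivial)) hqC, hex.1, hex.1, by rw [hex.2, zero_mul]⟩

/-- For equal weights of two neighbouring variables the factor `z_j - q z_{j+1}` kills the
integral: it cancels a pole, after which both variables can run over the same contour, and the
integrand is antisymmetric. -/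
theorem multiIntegral_sub_mul_eq_zero (hγ : NestedContours q a γ) (hq : 0 < q)
    {h : Fin k → ℂ → ℂ} (hh : ∀ i, HasPoles (Set.range fun i => (a i : ℂ)) (h i)) {j j' : Fin k}
    (hjj : (j' : ℕ) = j + 1) (hhj : h j = h j') :
    multiIntegral γ (fun z => (z j - q * z j') *
      (crossOn q (ltPairs k) z * ∏ i, h i (z i))) = 0 := by
  have hqC : (q : ℂ) ≠ 0 := by exact_mod_cast hq.ne'
  have hlt : j < j' := by rw [Fin.lt_def]; omega
  -- The factor `z_j - q z_{j'}` cancels the denominator of the pair `(j, j')`. Its numerator `z_j -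
  -- z_{j'}` survives and makes the integrand antisymmetric.
  set S := (ltPairs k).erase (j, j') with hS
  have hmemS : ∀ p, p ∈ S ↔ p ≠ (j, j') ∧ p.1 < p.2 := fun p => by
    rw [hS, Finset.mem_erase, mem_ltPairs]
  set F : (Fin k → ℂ) → ℂ := fun z => (z j - z j') * (crossOn q S z * ∏ i, h i (z i)) with hF
  have hcongr : ∀ z ∈ contourSet γ, (z j - q * z j') *
      (crossOn q (ltPairs k) z * ∏ i, h i (z i)) = F z := fun z hz => by
    have hne := hγ.sub_ne_zero hlt (hz j trivial) (hz j' trivial)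
    have hsplit : crossOn q (ltPairs k) z =
        (z j - z j') / (z j - q * z j') * crossOn q S z :=
      (Finset.mul_prod_erase (ltPairs k)
        (fun p : Fin k × Fin k => (z p.1 - z p.2) / (z p.1 - q * z p.2))
        (mem_ltPairs.2 hlt : (j, j') ∈ ltPairs k)).symm
    rw [hsplit, hF]
    field_simp
  rw [multiIntegral_congr hcongr]
  -- The variable `z_j` moves inward to the contour of `z_{j'}`. The other denominators stay
  -- nonzero: for the pairs in `S` the partner of `j` precedes `j` or follows `j'`, so the nesting
  -- with `γ j'` applies.
  set γ' := Function.update γ j (γ j') with hγ'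
  have hγ'j : γ' j = γ j' := by simp [hγ']
  have hγ'ne : ∀ i, i ≠ j → γ' i = γ i := fun i hi => by simp [hγ', hi]
  have hγ'S : ∀ p ∈ S, ∀ z ∈ contourSet γ', z p.1 - q * z p.2 ≠ 0 := by
    rintro ⟨A, B⟩ hp z hz
    rw [hmemS] at hp
    obtain ⟨hne, hAB⟩ := hp
    have hAB' : (A : ℕ) < B := hAB
    have hzj : z j ∈ Set.range (γ j').path := by
      have : z j ∈ Set.range (γ' j).path := hz j trivial
      rwa [hγ'j] at this
    have hzi : ∀ i, i ≠ j → z i ∈ Set.range (γ i).path := fun i hi => by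
      have : z i ∈ Set.range (γ' i).path := hz i trivial
      rwa [hγ'ne i hi] at this
    by_cases hA : A = j
    · subst hA
      have hBv : (B : ℕ) ≠ j' := fun e => hne (by rw [Fin.ext e])
      exact hγ.sub_ne_zero (by rw [Fin.lt_def]; omega) hzj (hzi B hAB.ne')
    · by_cases hB : B = j
      · subst hB
        exact hγ.sub_ne_zero (hAB.trans hlt) (hzi A hA) hzj
      · exact hγ.sub_ne_zero hAB (hzi A hA) (hzi B hB)
  have hweight : ContinuousOn (fun z : Fin k → ℂ => ∏ i, h i (z i)) (contourSet γ') := by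
    refine continuousOn_finsetProd _ fun i _ => ?_
    obtain ⟨i', hi'⟩ : ∃ i', γ' i = γ i' := by
      by_cases hi : i = j
      exacts [⟨j', hi ▸ hγ'j⟩, ⟨i, hγ'ne i hi⟩]
    refine ((hh i).continuousOn (S := Set.range (γ i').path) (hγ i').2.2.1 ?_).comp
      (continuous_apply i).continuousOn fun z hz => hi' ▸ hz i trivial
    rintro _ ⟨l, rfl⟩
    exact ((hγ i').1 l).1
  rw [multiIntegral_eq_mul_update j (γ j') 1 (F := F), one_mul]
  · refine multiIntegral_eq_zero_of_swap (i := j) (j := j') ?_ fun z hz => ?_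
    · rw [← hγ', hγ'j, hγ'ne j' hlt.ne']
    · have hprod : ∏ i, h i ((z ∘ Equiv.swap j j') i) = ∏ i, h i (z i) := by
        rw [← Equiv.prod_comp (Equiv.swap j j')]
        refine Finset.prod_congr rfl fun i _ => ?_
        simp only [Function.comp_apply, Equiv.swap_apply_self]
        have hi : h (Equiv.swap j j' i) = h i := by
          simp only [Equiv.swap_apply_def]
          split_ifs with h1 h2
          · rw [h1, hhj]
          · rw [h2, hhj]
          · rfl
        rw [hi]
      simp only [hF]
      rw [crossOn_erase_swap _ hjj, hprod]
      simp only [Function.comp_apply, Equiv.swap_apply_left, Equiv.swap_apply_right]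
      ring
  · exact ContinuousOn.mul (by fun_prop)
      ((hγ.continuousOn_crossOn (Finset.erase_subset _ _)).mul (hγ.continuousOn_prod hh))
  · exact ContinuousOn.mul (by fun_prop)
      ((QPushASEP.continuousOn_crossOn fun z hz p hp => hγ'S p hp z hz).mul hweight)
  · intro z hz
    -- All remaining nonzero poles in `z_j` have equal winding numbers for both contours: `z_A / q`
    -- is outside both, while `q z_B` with `B > j'` and the `a_i` are inside both.
    have hp : HasPoles ({s | ∃ A < j, s = z A / q} ∪ {s | ∃ B > j', s = q * z B} ∪
        Set.range fun i => (a i : ℂ)) fun x => F (Function.update z j x) := by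
      simp only [hF, Function.update_self, Function.update_of_ne hlt.ne']
      refine HasPoles.mul (.of_differentiableOn (by fun_prop)) (HasPoles.mul
        (hasPoles_crossOn hqC ?_ ?_ ?_)
        (hasPoles_prod_update ((hh j).mono Set.subset_union_right) z))
      · intro p hp
        exact ((hmemS p).1 hp).2.ne
      · rintro ⟨A, B⟩ hp rfl
        obtain ⟨hne, hAB⟩ := (hmemS _).1 hp
        have hB : (B : ℕ) ≠ j' := fun e => hne (by rw [Fin.ext e])
        have hAB' : (A : ℕ) < B := hAB
        refine .inl (.inr ⟨B, ?_, rfl⟩)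
        rw [gt_iff_lt, Fin.lt_def]
        dsimp only at hjj
        omega
      · rintro ⟨A, B⟩ hp rfl
        exact .inl (.inl ⟨A, ((hmemS _).1 hp).2, rfl⟩)
    refine hp.integral_eq_mul (hγ j).2.2 (hγ j').2.2 ?_
    rintro s ((⟨A, hA, rfl⟩ | ⟨B, hB, rfl⟩) | ⟨i, rfl⟩)
    · have h1 := hγ.excludes_div hq hA (hz A trivial)
      have h2 := hγ.excludes_div hq (hA.trans hlt) (hz A trivial)
      exact ⟨div_ne_zero (hγ.ne_zero (hz A trivial)) hqC, h1.1, h2.1, by rw [h1.2, h2.2, one_mul]⟩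
    · have h1 := hγ.encloses_mul (hlt.trans hB) (hz B trivial)
      have h2 := hγ.encloses_mul hB (hz B trivial)
      exact ⟨mul_ne_zero hqC (hγ.ne_zero (hz B trivial)), h1.1, h2.1, by rw [h1.2, h2.2, one_mul]⟩
    · have h1 := (hγ j).1 i
      have h2 := (hγ j').1 i
      refine ⟨fun e => ?_, h1.1, h2.1, by rw [h1.2, h2.2, one_mul]⟩
      have := h1.2
      simp only at e
      rw [e, (hγ j).2.2.2] at this
      exact zero_ne_one this

end NestedContours

end QPushASEP

/-! ### Integrals against products of one-variable weights -/

namespace QPushASEP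

section WeightedIntegral

variable {N k : ℕ} {q : ℝ} {a : Fin N → ℝ} {γ : Fin k → Contour}

/-- The integral of the interaction factor against a product of functions of one variable. -/
def weightedIntegral (γ : Fin k → Contour) (q : ℝ) (h : Fin k → ℂ → ℂ) : ℂ :=
  multiIntegral γ fun z => crossOn (q : ℂ) (ltPairs k) z * ∏ i, h i (z i)

lemma weightedIntegral_congr {h h' : Fin k → ℂ → ℂ}
    (hh : ∀ i, ∀ z ∈ Set.range (γ i).path, h i z = h' i z) :
    weightedIntegral γ q h = weightedIntegral γ q h' := by
  refine multiIntegral_congr fun z hz => ?_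
  rw [Finset.prod_congr rfl fun i _ => hh i (z i) (hz i trivial)]

lemma prod_update_apply (h : Fin k → ℂ → ℂ) (l : Fin k) (f : ℂ → ℂ) (z : Fin k → ℂ) :
    ∏ i, Function.update h l f i (z i) = f (z l) * ∏ i ∈ Finset.univ.erase l, h i (z i) := by
  rw [← Finset.mul_prod_erase Finset.univ _ (Finset.mem_univ l), Function.update_self]
  congr 1
  exact Finset.prod_congr rfl fun i hi => by rw [Function.update_of_ne (Finset.ne_of_mem_erase hi)]

lemma hasPoles_update {Z : Set ℂ} {h : Fin k → ℂ → ℂ} (hh : ∀ i, HasPoles Z (h i)) {f : ℂ → ℂ}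
    (hf : HasPoles Z f) (l : Fin k) (i : Fin k) : HasPoles Z (Function.update h l f i) := by
  by_cases hi : i = l
  · subst hi
    rwa [Function.update_self]
  · rw [Function.update_of_ne hi]
    exact hh i

lemma NestedContours.continuousOn_weighted (hγ : NestedContours q a γ) {h : Fin k → ℂ → ℂ}
    (hh : ∀ i, HasPoles (Set.range fun i => (a i : ℂ)) (h i)) : ContinuousOn
      (fun z => crossOn (q : ℂ) (ltPairs k) z * ∏ i, h i (z i)) (contourSet γ) :=
  (hγ.continuousOn_crossOn subset_rfl).mul (hγ.continuousOn_prod hh)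

lemma weightedIntegral_update_sum (hγ : NestedContours q a γ) {h : Fin k → ℂ → ℂ}
    (hh : ∀ i, HasPoles (Set.range fun i => (a i : ℂ)) (h i)) (l : Fin k) {ι : Type*}
    (S : Finset ι) (c : ι → ℂ) (f : ι → ℂ → ℂ)
    (hf : ∀ i ∈ S, HasPoles (Set.range fun i => (a i : ℂ)) (f i)) :
    weightedIntegral γ q (Function.update h l fun z => ∑ i ∈ S, c i * f i z) =
      ∑ i ∈ S, c i * weightedIntegral γ q (Function.update h l (f i)) := by
  simp only [weightedIntegral, ← multiIntegral_const_mul]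
  rw [← multiIntegral_sum S fun i hi =>
    continuousOn_const.fun_mul (hγ.continuousOn_weighted (hasPoles_update hh (hf i hi) l))]
  refine multiIntegral_congr fun z _ => ?_
  simp only [prod_update_apply, Finset.sum_mul, Finset.mul_sum]
  exact Finset.sum_congr rfl fun i _ => by ring

/-- Exchange of a factor `z` between two neighbouring variables with the same weight. -/
lemma weightedIntegral_exchange (hγ : NestedContours q a γ) (hq : 0 < q) {h : Fin k → ℂ → ℂ}
    (hh : ∀ i, HasPoles (Set.range fun i => (a i : ℂ)) (h i)) {l l' : Fin k}
    (hl : (l' : ℕ) = l + 1) {b : ℂ → ℂ} (hb : HasPoles (Set.range fun i => (a i : ℂ)) b) :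
    weightedIntegral γ q (Function.update (Function.update h l fun z => z * b z) l' b) =
      q * weightedIntegral γ q (Function.update (Function.update h l b) l' fun z => z * b z) := by
  have hne : l ≠ l' := fun e => by rw [e] at hl; omega
  have hzb : HasPoles (Set.range fun i => (a i : ℂ)) fun z => z * b z :=
    HasPoles.mul (.of_differentiableOn differentiableOn_id) hb
  have key := hγ.multiIntegral_sub_mul_eq_zero hq
    (hasPoles_update (hasPoles_update hh hb l) hb l') hl
    (by rw [Function.update_self, Function.update_of_ne hne, Function.update_self])
  rw [← sub_eq_zero, weightedIntegral, weightedIntegral, ← multiIntegral_const_mul,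
    ← multiIntegral_sub (hγ.continuousOn_weighted (hasPoles_update (hasPoles_update hh hzb l) hb l'))
      (continuousOn_const.fun_mul
        (hγ.continuousOn_weighted (hasPoles_update (hasPoles_update hh hb l) hzb l'))), ← key]
  refine multiIntegral_congr fun z _ => ?_
  have hp : ∀ f g : ℂ → ℂ, ∏ i, Function.update (Function.update h l f) l' g i (z i) =
      f (z l) * g (z l') * ∏ i ∈ (Finset.univ.erase l').erase l, h i (z i) := fun f g => by
    rw [prod_update_apply, ← Finset.mul_prod_erase _ _
      (Finset.mem_erase.2 ⟨hne, Finset.mem_univ l⟩), Function.update_self]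
    rw [Finset.prod_congr rfl fun i hi => by
      rw [Function.update_of_ne (Finset.ne_of_mem_erase hi)]]
    ring
  simp only [hp]
  ring

end WeightedIntegral

/-! ### The weights of the moment formula -/

section Weights

variable {N k : ℕ} {q R L t : ℝ} {a : Fin N → ℝ}

/-- The rate parameter with one-based label `m`. -/
def rateAt (a : Fin N → ℝ) (m : ℕ) : ℝ :=
  if h : 0 < m ∧ m ≤ N then a ⟨m - 1, by omega⟩ else 0

/-- `∏_{i ≤ m} a_i / (a_i - z)`. -/
def ratProd (a : Fin N → ℝ) (m : ℕ) (z : ℂ) : ℂ :=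
  ∏ i ∈ Finset.univ.filter (fun i : Fin N => (i : ℕ) < m), (a i : ℂ) / (a i - z)

/-- The eigenvalue of the one-particle generator. -/
def drift (q R L : ℝ) (z : ℂ) : ℂ := R * (q - 1) * z + L * ((q : ℂ)⁻¹ - 1) * z⁻¹

/-- The factor of the moment integrand that belongs to one variable. -/
def weight (q R L t : ℝ) (a : Fin N → ℝ) (m : ℕ) (z : ℂ) : ℂ :=
  ratProd a m z * Complex.exp (t * drift q R L z) * z⁻¹

/-- The quotient `Π_t(q z) / Π_t(z)` is the exponential of `t` times the eigenvalue `drift`. -/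
lemma momentIntegrand_eq (n : Fin k → ℕ) (z : Fin k → ℂ) :
    momentIntegrand q R L t a n z =
      crossOn (q : ℂ) (ltPairs k) z * ∏ j, weight q R L t a (n j) (z j) := by
  rw [momentIntegrand, prod_prod_Ioi_eq_crossOn]
  congr 1
  refine Finset.prod_congr rfl fun j _ => ?_
  rw [weight, ratProd, piFun, piFun, ← Complex.exp_sub, one_div, drift, mul_inv]
  congr 3
  ring

lemma ratProd_zero (z : ℂ) : ratProd a 0 z = 1 := by simp [ratProd]

lemma ratProd_succ {m : ℕ} (hm : m + 1 ≤ N) (z : ℂ) :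
    ratProd a (m + 1) z = rateAt a (m + 1) / (rateAt a (m + 1) - z) * ratProd a m z := by
  have hset : (Finset.univ.filter fun i : Fin N => (i : ℕ) < m + 1) =
      insert ⟨m, hm⟩ (Finset.univ.filter fun i : Fin N => (i : ℕ) < m) := by
    ext i
    simp only [Finset.mem_filter, Finset.mem_univ, true_and, Finset.mem_insert, Fin.ext_iff]
    omega
  rw [ratProd, hset, Finset.prod_insert (by simp), ratProd, rateAt, dif_pos ⟨by omega, hm⟩]
  simp

lemma hasPoles_ratProd (m : ℕ) : HasPoles (Set.range fun i => (a i : ℂ)) (ratProd a m) := by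
  refine HasPoles.prod fun i _ => ?_
  have : ∀ z : ℂ, (a i : ℂ) / (a i - z) = -a i * (z - a i)⁻¹ := fun z => by
    rw [← neg_sub z (a i : ℂ), div_neg, neg_mul, div_eq_mul_inv]
  simp only [this]
  exact HasPoles.mul (.const _) (.inv_sub ⟨i, rfl⟩)

lemma differentiableOn_drift : DifferentiableOn ℂ (drift q R L) {0}ᶜ := fun z hz => by
  have hz0 : z ≠ 0 := hz
  unfold drift
  fun_prop (disch := assumption)

lemma hasPoles_exp_drift {Z : Set ℂ} :
    HasPoles Z fun z => Complex.exp (t * drift q R L z) * z⁻¹ :=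
  (HasPoles.of_differentiableOn ((differentiableOn_drift.const_mul _).cexp)).mul .inv_id

lemma hasPoles_weight (m : ℕ) :
    HasPoles (Set.range fun i => (a i : ℂ)) (weight q R L t a m) := by
  have := (hasPoles_ratProd (a := a) m).mul (hasPoles_exp_drift (q := q) (R := R) (L := L) (t := t))
  simp only [← mul_assoc] at this
  exact this

lemma rateAt_pos (ha : ∀ i, 0 < a i) {m : ℕ} (hm : 0 < m) (hmN : m ≤ N) : 0 < rateAt a m := by
  rw [rateAt, dif_pos ⟨hm, hmN⟩]
  exact ha _

/-- The last factor `a_m / (a_m - z)` gives `(a_m - z) P_m = a_m P_{m-1}`. This is the algebraic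
form of a right jump. -/
lemma mul_weight {m : ℕ} (hm : 0 < m) (hmN : m ≤ N) {z : ℂ} (hz : ∀ i, z ≠ a i) :
    z * weight q R L t a m z =
      rateAt a m * weight q R L t a m z - rateAt a m * weight q R L t a (m - 1) z := by
  obtain ⟨m, rfl⟩ := Nat.exists_eq_succ_of_ne_zero hm.ne'
  have hne : (rateAt a (m + 1) : ℂ) - z ≠ 0 := by
    rw [rateAt, dif_pos ⟨hm, hmN⟩]
    exact sub_ne_zero.2 (hz _).symm
  simp only [weight, Nat.succ_eq_add_one, Nat.add_sub_cancel, ratProd_succ hmN]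
  field_simp
  ring

/-- One step is `a / (z (a - z)) = a⁻¹ (a / (a - z)) + z⁻¹`, iterated from `m` down to `m'`. The sum
over `i` matches the particles whose left jumps push the particle `m`. -/
lemma inv_mul_weight (ha : ∀ i, 0 < a i) {m m' : ℕ} (hmm : m' ≤ m) (hmN : m ≤ N) {z : ℂ}
    (hz0 : z ≠ 0) (hz : ∀ i, z ≠ a i) :
    z⁻¹ * weight q R L t a m z =
      ∑ i ∈ Finset.Ioc m' m, (rateAt a i : ℂ)⁻¹ * weight q R L t a i z +
        z⁻¹ * weight q R L t a m' z := by
  induction m, hmm using Nat.le_induction with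
  | base => simp
  | succ m hm ih =>
    have hne : (rateAt a (m + 1) : ℂ) - z ≠ 0 := by
      rw [rateAt, dif_pos ⟨by omega, hmN⟩]
      exact sub_ne_zero.2 (hz _).symm
    have hne' : (rateAt a (m + 1) : ℂ) ≠ 0 := by
      exact_mod_cast (rateAt_pos ha (by omega) hmN).ne'
    rw [← Finset.insert_Ioc_right_eq_Ioc_add_one hm, Finset.sum_insert (by simp), add_assoc,
      ← ih (by omega)]
    simp only [weight, ratProd_succ hmN]
    field_simp
    ring

end Weights

end QPushASEP

namespace QPushASEP

/-! ### The closed system of the moments -/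

/-- The relations between the moments `u n`, and the sums `U l n` and `Z l n` that describe the
effect of the left and right jumps on the `l`-th factor. -/
structure MomentSystem {N k : ℕ} (q : ℝ) (a : Fin N → ℝ) (u : (Fin k → ℕ) → ℂ)
    (U Z : Fin k → (Fin k → ℕ) → ℂ) : Prop where
  eq_zero : ∀ n ∈ weylChamber k N, ∀ j, n j = 0 → u n = 0
  left_last : ∀ n ∈ weylChamber k N, ∀ l : Fin k, (l : ℕ) + 1 = k →
    U l n = ∑ i ∈ Finset.Ioc 0 (n l), (rateAt a i : ℂ)⁻¹ * u (Function.update n l i)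
  left_step : ∀ n ∈ weylChamber k N, ∀ l l' : Fin k, (l' : ℕ) = l + 1 →
    U l n = ∑ i ∈ Finset.Ioc (n l') (n l), (rateAt a i : ℂ)⁻¹ * u (Function.update n l i) +
      (q : ℂ)⁻¹ * U l' (Function.update n l (n l'))
  -- The condition says that `l` is the last index of its block of equal entries, so that lowering
  -- `n l` by one keeps `n` ordered. Within a block the values follow by `right_step`.
  right_last : ∀ n ∈ weylChamber k N, (∀ j, 0 < n j) → ∀ l : Fin k,
    (∀ l' : Fin k, (l' : ℕ) = l + 1 → n l' < n l) →
    Z l n = rateAt a (n l) * (u n - u (Function.update n l (n l - 1)))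
  right_step : ∀ n ∈ weylChamber k N, (∀ j, 0 < n j) → ∀ l l' : Fin k, (l' : ℕ) = l + 1 →
    n l' = n l → Z l n = q * Z l' n

section Contour

variable {N k : ℕ} {q R L t : ℝ} {a : Fin N → ℝ} {γ : Fin k → Contour}

/-- The contour integral of the moment formula, without the prefactor. -/
def contourMoment (γ : Fin k → Contour) (q R L t : ℝ) (a : Fin N → ℝ) (n : Fin k → ℕ) : ℂ :=
  weightedIntegral γ q fun i => weight q R L t a (n i)

/-- The contour integral with an additional factor `z_l⁻¹`. -/
def contourMomentInv (γ : Fin k → Contour) (q R L t : ℝ) (a : Fin N → ℝ) (l : Fin k)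
    (n : Fin k → ℕ) : ℂ :=
  weightedIntegral γ q
    (Function.update (fun i => weight q R L t a (n i)) l fun z => z⁻¹ * weight q R L t a (n l) z)

/-- The contour integral with an additional factor `z_l`. -/
def contourMomentMul (γ : Fin k → Contour) (q R L t : ℝ) (a : Fin N → ℝ) (l : Fin k)
    (n : Fin k → ℕ) : ℂ :=
  weightedIntegral γ q
    (Function.update (fun i => weight q R L t a (n i)) l fun z => z * weight q R L t a (n l) z)

lemma weight_update (n : Fin k → ℕ) (l : Fin k) (m : ℕ) :
    (fun i => weight q R L t a (Function.update n l m i)) =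
      Function.update (fun i => weight q R L t a (n i)) l (weight q R L t a m) :=
  Function.comp_update (weight q R L t a) n l m

lemma hasPoles_inv_mul_weight (m : ℕ) :
    HasPoles (Set.range fun i => (a i : ℂ)) fun z => z⁻¹ * weight q R L t a m z :=
  HasPoles.inv_id.mul (hasPoles_weight m)

lemma hasPoles_weight_zero {Z : Set ℂ} : HasPoles Z (weight q R L t a 0) := by
  have : weight q R L t a 0 = fun z => Complex.exp (t * drift q R L z) * z⁻¹ := by
    ext z
    rw [weight, ratProd_zero, one_mul]
  rw [this]
  exact hasPoles_exp_drift

lemma contourMomentInv_eq (hγ : NestedContours q a γ) (ha : ∀ i, 0 < a i) {n : Fin k → ℕ}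
    {l : Fin k} {m : ℕ} (hm : m ≤ n l) (hN : n l ≤ N) :
    contourMomentInv γ q R L t a l n =
      ∑ i ∈ Finset.Ioc m (n l), (rateAt a i : ℂ)⁻¹ *
        contourMoment γ q R L t a (Function.update n l i) +
      contourMomentInv γ q R L t a l (Function.update n l m) := by
  have hw : ∀ i, HasPoles (Set.range fun i => (a i : ℂ)) (weight q R L t a (n i)) :=
    fun i => hasPoles_weight (n i)
  simp only [contourMoment, contourMomentInv, weight_update, Function.update_self,
    Function.update_idem]
  -- The index `none` carries the remainder `z⁻¹ * weight m`, so that linearity is applied once to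
  -- the whole right-hand side.
  have key := weightedIntegral_update_sum hγ hw l (Finset.insertNone (Finset.Ioc m (n l)))
    (fun o => o.elim 1 fun i => (rateAt a i : ℂ)⁻¹)
    (fun o => o.elim (fun z => z⁻¹ * weight q R L t a m z) (weight q R L t a)) (by
      rintro (_ | i) _
      exacts [hasPoles_inv_mul_weight m, hasPoles_weight i])
  simp only [Finset.sum_insertNone, Option.elim, one_mul] at key
  rw [add_comm, ← key]
  refine weightedIntegral_congr fun i z hz => ?_
  by_cases hi : i = l
  · subst hi
    simp only [Function.update_self]
    rw [add_comm]
    exact inv_mul_weight ha hm hN (hγ.ne_zero hz) fun i => hγ.ne_rate hz i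
  · simp only [Function.update_of_ne hi]

/-- The vanishing relation and `left_last` hold because a last weight with label zero, with or
without an extra `z⁻¹`, has no pole inside its contour. In `left_step` the label `n l` is lowered to
`n l'`, after which the two weights agree and the extra factor moves to the next variable by
exchange with `b = z⁻¹ * weight`. The right relations use `mul_weight` and the exchange with `b =
weight`. -/
theorem contourMoment_system (hγ : NestedContours q a γ) (hq : 0 < q) (ha : ∀ i, 0 < a i) :
    MomentSystem q a (contourMoment γ q R L t a) (contourMomentInv γ q R L t a)
      (contourMomentMul γ q R L t a) where
  eq_zero := by
    intro n hn j hj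
    have hk := j.2
    set l : Fin k := ⟨k - 1, by omega⟩
    have hl : n l = 0 := by
      have : n l ≤ n j := hn.1 (by rw [Fin.le_def]; simp only [l]; omega)
      omega
    refine hγ.multiIntegral_eq_zero_of_last hq (fun i => hasPoles_weight (n i)) (j := l)
      (by simp only [l]; omega) ?_
    rw [hl]
    exact hasPoles_weight_zero
  left_last := by
    intro n hn l hl
    rw [contourMomentInv_eq hγ ha (Nat.zero_le (n l)) (hn.2 l), add_eq_left, contourMomentInv]
    refine hγ.multiIntegral_eq_zero_of_last hq
      (hasPoles_update (fun i => hasPoles_weight _) (hasPoles_inv_mul_weight _) l) (j := l) hl ?_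
    rw [Function.update_self, Function.update_self]
    exact HasPoles.inv_id.mul hasPoles_weight_zero
  left_step := by
    intro n hn l l' hl
    rw [contourMomentInv_eq hγ ha (hn.1 (by rw [Fin.le_def]; omega : l ≤ l')) (hn.2 l)]
    congr 1
    have hne : l' ≠ l := fun e => by rw [e] at hl; omega
    have hqC : (q : ℂ) ≠ 0 := by exact_mod_cast hq.ne'
    rw [eq_inv_mul_iff_mul_eq₀ hqC]
    have key := weightedIntegral_exchange hγ hq
      (h := fun i => weight q R L t a (Function.update n l (n l') i))
      (fun i => hasPoles_weight _) hl (hasPoles_inv_mul_weight (q := q) (R := R) (L := L) (t := t)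
        (n l'))
    have hcancel : ∀ i, ∀ z ∈ Set.range (γ i).path,
        z * (z⁻¹ * weight q R L t a (n l') z) = weight q R L t a (n l') z := fun i z hz =>
      mul_inv_cancel_left₀ (hγ.ne_zero hz) _
    rw [contourMomentInv, contourMomentInv]
    simp only [Function.update_self, Function.update_of_ne hne]
    convert key.symm using 1
    · congr 1
      refine weightedIntegral_congr fun i z hz => ?_
      by_cases hi : i = l'
      · subst hi
        simp only [Function.update_self, Function.update_of_ne hne]
        exact (hcancel i z hz).symm
      · simp only [Function.update_of_ne hi]
    · refine weightedIntegral_congr fun i z hz => ?_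
      by_cases hi : i = l'
      · subst hi
        simp only [Function.update_self]
      · by_cases hi' : i = l
        · subst hi'
          simp only [Function.update_self, Function.update_of_ne hi]
          exact (hcancel i z hz).symm
        · simp only [Function.update_of_ne hi, Function.update_of_ne hi']
  right_last := by
    intro n hn hpos l _
    have hw : ∀ i, HasPoles (Set.range fun i => (a i : ℂ)) (weight q R L t a (n i)) :=
      fun i => hasPoles_weight (n i)
    have key := weightedIntegral_update_sum hγ hw l Finset.univ
      ![(rateAt a (n l) : ℂ), -(rateAt a (n l) : ℂ)]
      ![weight q R L t a (n l), weight q R L t a (n l - 1)]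
      (by simp [Fin.forall_fin_two, hasPoles_weight])
    simp only [Fin.sum_univ_two, Matrix.cons_val_zero, Matrix.cons_val_one] at key
    rw [contourMoment, contourMoment, weight_update]
    have hself : Function.update (fun i => weight q R L t a (n i)) l (weight q R L t a (n l)) =
      fun i => weight q R L t a (n i) := Function.update_eq_self l _
    rw [hself] at key
    rw [mul_sub, sub_eq_add_neg, ← neg_mul, ← key, contourMomentMul]
    refine weightedIntegral_congr fun i z hz => ?_
    by_cases hi : i = l
    · subst hi
      simp only [Function.update_self]
      rw [mul_weight (hpos i) (hn.2 i) fun i => hγ.ne_rate hz i]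
      ring
    · simp only [Function.update_of_ne hi]
  right_step := by
    intro n _ _ l l' hl hnl
    have hne : l' ≠ l := fun e => by rw [e] at hl; omega
    have key := weightedIntegral_exchange hγ hq (h := fun i => weight q R L t a (n i))
      (fun i => hasPoles_weight _) hl (hasPoles_weight (q := q) (R := R) (L := L) (t := t) (n l))
    rw [contourMomentMul, contourMomentMul, hnl]
    have e1 : Function.update (Function.update (fun i => weight q R L t a (n i)) l
        fun z => z * weight q R L t a (n l) z) l' (weight q R L t a (n l)) =
        Function.update (fun i => weight q R L t a (n i)) l
        fun z => z * weight q R L t a (n l) z := by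
      rw [Function.update_eq_self_iff, Function.update_of_ne hne, hnl]
    have e2 : Function.update (fun i => weight q R L t a (n i)) l (weight q R L t a (n l)) =
        fun i => weight q R L t a (n i) := Function.update_eq_self l _
    rwa [e1, e2] at key

/-- Differentiation brings down the sum of the eigenvalues `drift` of the variables, whose two terms
supply the extra factors `z_l` and `z_l⁻¹`. -/
lemma hasDerivAt_contourMoment (hγ : NestedContours q a γ) (n : Fin k → ℕ) (t : ℝ) :
    HasDerivAt (fun t => contourMoment γ q R L t a n)
      (R * (q - 1) * ∑ l, contourMomentMul γ q R L t a l n +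
        L * ((q : ℂ)⁻¹ - 1) * ∑ l, contourMomentInv γ q R L t a l n) t := by
  set G : (Fin k → ℂ) → ℂ := fun z =>
    crossOn (q : ℂ) (ltPairs k) z * ∏ i, (ratProd a (n i) (z i) * (z i)⁻¹) with hG
  set Λ : (Fin k → ℂ) → ℂ := fun z => ∑ i, drift q R L (z i) with hΛ
  have hGc : ContinuousOn G (contourSet γ) := hγ.continuousOn_weighted
    (h := fun i z => ratProd a (n i) z * z⁻¹) fun i => (hasPoles_ratProd (n i)).mul .inv_id
  have hΛc : ContinuousOn Λ (contourSet γ) := by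
    refine continuousOn_finsetSum _ fun i _ => ?_
    exact ContinuousOn.comp (t := {0}ᶜ) (g := drift q R L) (f := fun z : Fin k → ℂ => z i)
      differentiableOn_drift.continuousOn (continuous_apply i).continuousOn
      fun z hz => hγ.ne_zero (hz i trivial)
  have hexp : ∀ (t : ℝ) z, Complex.exp (t * Λ z) * G z =
      crossOn (q : ℂ) (ltPairs k) z * ∏ i, weight q R L t a (n i) (z i) := fun t z => by
    simp only [hG, hΛ, weight, Finset.mul_sum, Complex.exp_sum, Finset.prod_mul_distrib]
    ring
  have key := hasDerivAt_multiIntegral_exp hGc hΛc t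
  simp only [hexp] at key
  refine key.congr_deriv ?_
  have hw : ∀ i, HasPoles (Set.range fun i => (a i : ℂ)) (weight q R L t a (n i)) :=
    fun i => hasPoles_weight (n i)
  have hmulw : ∀ l, HasPoles (Set.range fun i => (a i : ℂ))
      fun z => z * weight q R L t a (n l) z := fun l =>
    HasPoles.mul (.of_differentiableOn differentiableOn_id) (hw l)
  have h1 : ∀ l, ContinuousOn (fun z => crossOn (q : ℂ) (ltPairs k) z *
      ∏ i, Function.update (fun i => weight q R L t a (n i)) l
        (fun z => z * weight q R L t a (n l) z) i (z i)) (contourSet γ) := fun l =>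
    hγ.continuousOn_weighted (hasPoles_update hw (hmulw l) l)
  have h2 : ∀ l, ContinuousOn (fun z => crossOn (q : ℂ) (ltPairs k) z *
      ∏ i, Function.update (fun i => weight q R L t a (n i)) l
        (fun z => z⁻¹ * weight q R L t a (n l) z) i (z i)) (contourSet γ) := fun l =>
    hγ.continuousOn_weighted (hasPoles_update hw (hasPoles_inv_mul_weight (n l)) l)
  simp only [contourMomentMul, contourMomentInv, weightedIntegral]
  rw [← multiIntegral_sum _ fun l _ => h1 l, ← multiIntegral_sum _ fun l _ => h2 l,
    ← multiIntegral_const_mul, ← multiIntegral_const_mul, ← multiIntegral_add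
    (continuousOn_const.fun_mul (continuousOn_finsetSum _ fun l _ => h1 l))
    (continuousOn_const.fun_mul (continuousOn_finsetSum _ fun l _ => h2 l))]
  refine multiIntegral_congr fun z _ => ?_
  simp only [hΛ, Finset.mul_sum, Finset.sum_mul, ← Finset.sum_add_distrib]
  refine Finset.sum_congr rfl fun l _ => ?_
  rw [prod_update_apply, prod_update_apply,
    ← Finset.mul_prod_erase Finset.univ (fun i => weight q R L t a (n i) (z i))
      (Finset.mem_univ l), drift]
  ring

lemma ratProd_eq_mul_poleProd (m : ℕ) (z : ℂ) :
    ratProd a m z = (∏ i ∈ Finset.univ.filter (fun i : Fin N => (i : ℕ) < m), (-(a i) : ℂ)) *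
      Contour.poleProd ((Finset.univ.filter fun i : Fin N => (i : ℕ) < m).val.map
        fun i => (a i : ℂ)) z := by
  rw [Contour.poleProd, Multiset.map_map, ratProd]
  change _ = _ * ∏ i ∈ Finset.univ.filter (fun i : Fin N => (i : ℕ) < m), (z - (a i : ℂ))⁻¹
  rw [← Finset.prod_mul_distrib]
  refine Finset.prod_congr rfl fun i _ => ?_
  rw [← neg_sub z (a i : ℂ), div_neg, neg_mul, div_eq_mul_inv]

lemma crossOn_cons (q : ℂ) (x : ℂ) (w : Fin k → ℂ) :
    crossOn q (ltPairs (k + 1)) (Fin.cons x w) =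
      (∏ B, (x - w B) / (x - q * w B)) * crossOn q (ltPairs k) w := by
  rw [← prod_prod_Ioi_eq_crossOn, ← prod_prod_Ioi_eq_crossOn, Fin.prod_univ_succ]
  congr 1
  · rw [Fin.Ioi_zero_eq_map, Finset.prod_map]
    simp
  · refine Finset.prod_congr rfl fun A _ => ?_
    rw [← Fin.map_succEmb_Ioi, Finset.prod_map]
    simp

/-- The moments of the step initial condition. -/
theorem contourMoment_zero (hq : 0 < q) (ha : ∀ i, 0 < a i) (hγ : NestedContours q a γ)
    {n : Fin k → ℕ} (hpos : ∀ j, 0 < n j) (hn : ∀ j, n j ≤ N) :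
    (-1) ^ k * (q : ℂ) ^ (k * (k - 1) / 2) / (2 * Real.pi * Complex.I) ^ k *
      contourMoment γ q R L 0 a n = 1 := by
  induction k with
  | zero =>
    rw [contourMoment, weightedIntegral, ← iteratedIntegral_eq_multiIntegral
      (hγ.continuousOn_weighted fun i => hasPoles_weight _), iteratedIntegral]
    simp [crossOn, ltPairs]
  | succ k ih =>
    have hqC : (q : ℂ) ≠ 0 := by exact_mod_cast hq.ne'
    have hstep : contourMoment γ q R L 0 a n = -(2 * Real.pi * Complex.I) * ((q : ℂ)⁻¹) ^ k *
        contourMoment (fun i => γ i.succ) q R L 0 a fun i => n i.succ := by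
      rw [contourMoment, weightedIntegral, multiIntegral_eq_integral_inner 0
        (hγ.continuousOn_weighted fun i => hasPoles_weight _), contourMoment, weightedIntegral,
        ← multiIntegral_const_mul]
      simp only [Fin.zero_succAbove, Fin.insertNth_zero']
      refine multiIntegral_congr fun w hw => ?_
      have hw' : ∀ i : Fin k, w i ∈ Set.range (γ i.succ).path := fun i => hw i trivial
      set m : Multiset ℂ := (Finset.univ.filter fun i : Fin N => (i : ℕ) < n 0).val.map
        fun i => (a i : ℂ) with hm
      have hmem : (⟨0, (hpos 0).trans_le (hn 0)⟩ : Fin N) ∈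
          Finset.univ.filter fun i : Fin N => (i : ℕ) < n 0 := by simp [hpos 0]
      have hm0 : m ≠ 0 := fun h => by
        have : (a ⟨0, (hpos 0).trans_le (hn 0)⟩ : ℂ) ∈ m := Multiset.mem_map_of_mem _ hmem
        rw [h] at this
        exact Multiset.notMem_zero _ this
      -- The contour of the outermost variable encloses every pole except zero, and the integrand
      -- decays at least like `z⁻²` since `m` is nonempty. The integral is therefore minus `2πi`
      -- times the residue at zero, where each other variable contributes `w B / (q * w B) = q⁻¹`.
      have key := Contour.integral_inv_mul_prod_mul_poleProd (hγ 0).2.2 Finset.univ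
        (fun B => (q : ℂ) * w B) w hm0 (fun s hs => by
          obtain ⟨i, _, rfl⟩ := Multiset.mem_map.1 hs
          exact (hγ 0).1 i)
        (fun B _ => hγ.encloses_mul (Fin.succ_pos B) (hw' B))
      have hintegrand : ∀ x, crossOn (q : ℂ) (ltPairs (k + 1)) (Fin.cons x w : Fin (k + 1) → ℂ) *
          ∏ i, weight q R L 0 a (n i) ((Fin.cons x w : Fin (k + 1) → ℂ) i) =
          ((∏ i ∈ Finset.univ.filter (fun i : Fin N => (i : ℕ) < n 0), (-(a i) : ℂ)) *
            (crossOn (q : ℂ) (ltPairs k) w * ∏ i : Fin k, weight q R L 0 a (n i.succ) (w i))) *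
          (x⁻¹ * (∏ B, (x - w B) / (x - q * w B)) * Contour.poleProd m x) := fun x => by
        rw [crossOn_cons, Fin.prod_univ_succ]
        simp only [Fin.cons_zero, Fin.cons_succ]
        have : weight q R L 0 a (n 0) x = ratProd a (n 0) x * x⁻¹ := by simp [weight]
        rw [this, ratProd_eq_mul_poleProd]
        ring
      simp only [hintegrand]
      rw [Contour.integral_const_mul, key]
      have hB : ∏ B : Fin k, w B / (q * w B) = ((q : ℂ)⁻¹) ^ k := by
        rw [Finset.prod_congr rfl fun B _ => show w B / (q * w B) = (q : ℂ)⁻¹ by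
          have := hγ.ne_zero (hw' B)
          field_simp]
        simp
      have hP : (∏ i ∈ Finset.univ.filter (fun i : Fin N => (i : ℕ) < n 0), (-(a i) : ℂ)) *
          Contour.poleProd m 0 = 1 := by
        rw [hm, ← ratProd_eq_mul_poleProd, ratProd]
        refine Finset.prod_eq_one fun i _ => ?_
        rw [sub_zero, div_self]
        exact_mod_cast (ha i).ne'
      rw [hB]
      linear_combination (-(2 * Real.pi * Complex.I) * ((q : ℂ)⁻¹) ^ k *
        (crossOn (q : ℂ) (ltPairs k) w * ∏ i : Fin k, weight q R L 0 a (n i.succ) (w i))) * hP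
    have hih := ih hγ.tail (fun j => hpos j.succ) fun j => hn j.succ
    -- The prefactor gains `q ^ k`, which cancels the `k` factors `q⁻¹` of the residue; the sign and
    -- `2πi` cancel likewise.
    have htri : (k + 1) * (k + 1 - 1) / 2 = k * (k - 1) / 2 + k := Nat.triangle_succ k
    rw [hstep, htri, pow_add, pow_succ, pow_succ]
    refine Eq.trans ?_ hih
    have hpi : (Real.pi : ℂ) ≠ 0 := by exact_mod_cast Real.pi_ne_zero
    have hI := Complex.I_ne_zero
    rw [inv_pow]
    field_simp
    ring

end Contour

end QPushASEP

/-! ### Uniqueness for the moment system -/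

namespace QPushASEP

section Uniqueness

variable {N k : ℕ} {q : ℝ} {a : Fin N → ℝ}

lemma finite_weylChamber (k N : ℕ) : (weylChamber k N).Finite :=
  (Set.Finite.pi' fun _ : Fin k => Set.finite_Iic N).subset fun _ hn j => hn.2 j

lemma update_mem_weylChamber {n : Fin k → ℕ} (hn : n ∈ weylChamber k N) {l : Fin k} {i : ℕ}
    (hi : i ≤ n l) (hi' : ∀ l' : Fin k, (l' : ℕ) = l + 1 → n l' ≤ i) :
    Function.update n l i ∈ weylChamber k N := by
  refine ⟨fun x y hxy => ?_, fun j => ?_⟩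
  · by_cases hy : y = l
    · subst hy
      by_cases hx : x = y
      · rw [hx]
      · rw [Function.update_self, Function.update_of_ne hx]
        exact hi.trans (hn.1 hxy)
    · rw [Function.update_of_ne hy]
      by_cases hx : x = l
      · subst hx
        rw [Function.update_self]
        have hlt : (x : ℕ) < y := lt_of_le_of_ne hxy fun e => hy (Fin.ext e.symm)
        have hy' := y.2
        exact (hn.1 (by rw [Fin.le_def]; exact hlt)).trans
          (hi' ⟨x + 1, by omega⟩ rfl)
      · rw [Function.update_of_ne hx]
        exact hn.1 hxy
  · by_cases hj : j = l
    · subst hj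
      rw [Function.update_self]
      exact hi.trans (hn.2 j)
    · rw [Function.update_of_ne hj]
      exact hn.2 j

namespace MomentSystem

variable {u v : (Fin k → ℕ) → ℂ} {U Z V Y : Fin k → (Fin k → ℕ) → ℂ}

/-- Linearity lets the uniqueness statement be applied to the difference of process moments and
normalized contour integrals. -/
lemma sub_const_mul (h : MomentSystem q a u U Z) (h' : MomentSystem q a v V Y) (c : ℂ) :
    MomentSystem q a (fun n => u n - c * v n) (fun l n => U l n - c * V l n)
      (fun l n => Z l n - c * Y l n) where
  eq_zero n hn j hj := by rw [h.eq_zero n hn j hj, h'.eq_zero n hn j hj, mul_zero, sub_zero]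
  left_last n hn l hl := by
    rw [h.left_last n hn l hl, h'.left_last n hn l hl, Finset.mul_sum, ← Finset.sum_sub_distrib]
    exact Finset.sum_congr rfl fun i _ => by ring
  left_step n hn l l' hl := by
    rw [h.left_step n hn l l' hl, h'.left_step n hn l l' hl, mul_add, Finset.mul_sum,
      add_sub_add_comm, ← Finset.sum_sub_distrib]
    congr 1
    · exact Finset.sum_congr rfl fun i _ => by ring
    · ring
  right_last n hn hpos l hl := by
    rw [h.right_last n hn hpos l hl, h'.right_last n hn hpos l hl]
    ring
  right_step n hn hpos l l' hl hnl := by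
    rw [h.right_step n hn hpos l l' hl hnl, h'.right_step n hn hpos l l' hl hnl]
    ring

lemma norm_sum_le {b : ℕ → ℂ} {w : ℕ → ℂ} {m m' : ℕ} {B : ℝ} (hm : m ≤ N)
    (hw : ∀ i ∈ Finset.Ioc m' m, ‖w i‖ ≤ B) (hB : 0 ≤ B) :
    ‖∑ i ∈ Finset.Ioc m' m, b i * w i‖ ≤ (∑ i ∈ Finset.Ioc 0 N, ‖b i‖) * B := by
  calc ‖∑ i ∈ Finset.Ioc m' m, b i * w i‖ ≤ ∑ i ∈ Finset.Ioc m' m, ‖b i‖ * B := by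
        refine norm_sum_le_of_le _ fun i hi => ?_
        rw [norm_mul]
        exact mul_le_mul_of_nonneg_left (hw i hi) (norm_nonneg _)
    _ ≤ ∑ i ∈ Finset.Ioc 0 N, ‖b i‖ * B :=
        Finset.sum_le_sum_of_subset_of_nonneg (Finset.Ioc_subset_Ioc (Nat.zero_le _) hm)
          fun i _ _ => by positivity
    _ = _ := (Finset.sum_mul _ _ _).symm

/-- The recursion determines `U` from `u`, going backwards from the last index. The constant depends
on `q`, `a` and `k` alone, hence not on time, as Grönwall's inequality requires. -/
lemma exists_norm_left_le (q : ℝ) (a : Fin N → ℝ) (k : ℕ) : ∃ C, 0 ≤ C ∧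
    ∀ (u : (Fin k → ℕ) → ℂ) (U Z : Fin k → (Fin k → ℕ) → ℂ), MomentSystem q a u U Z →
      ∀ B, 0 ≤ B → (∀ n ∈ weylChamber k N, ‖u n‖ ≤ B) →
        ∀ l, ∀ n ∈ weylChamber k N, ‖U l n‖ ≤ C * B := by
  -- Here `d` bounds the distance of `l` from the end, so `d = 0` is void and `d = k` covers every
  -- index.
  suffices H : ∀ d : ℕ, ∃ C, 0 ≤ C ∧
      ∀ (u : (Fin k → ℕ) → ℂ) (U Z : Fin k → (Fin k → ℕ) → ℂ), MomentSystem q a u U Z →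
        ∀ B, 0 ≤ B → (∀ n ∈ weylChamber k N, ‖u n‖ ≤ B) →
          ∀ l : Fin k, k ≤ l + d → ∀ n ∈ weylChamber k N, ‖U l n‖ ≤ C * B by
    obtain ⟨C, hC, h⟩ := H k
    exact ⟨C, hC, fun u U Z hs B hB hu l => h u U Z hs B hB hu l (Nat.le_add_left _ _)⟩
  intro d
  induction d with
  | zero => exact ⟨0, le_rfl, fun _ _ _ _ _ _ _ l hl => absurd l.2 (by omega)⟩
  | succ d ih =>
    obtain ⟨C, hC, h⟩ := ih
    set A := ∑ i ∈ Finset.Ioc 0 N, ‖(rateAt a i : ℂ)⁻¹‖ with hA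
    have hA0 : 0 ≤ A := Finset.sum_nonneg fun _ _ => norm_nonneg _
    refine ⟨A + ‖(q : ℂ)⁻¹‖ * C, by positivity, fun u U Z hs B hB hu l hl n hn => ?_⟩
    by_cases hlast : (l : ℕ) + 1 = k
    · rw [hs.left_last n hn l hlast]
      refine (norm_sum_le (hn.2 l) (fun i hi => hu _ (update_mem_weylChamber hn
        (Finset.mem_Ioc.1 hi).2 fun l' hl' => ?_)) hB).trans ?_
      · exact absurd l'.2 (by omega)
      · have : 0 ≤ ‖(q : ℂ)⁻¹‖ * C * B := by positivity
        linarith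
    · have hl2 := l.2
      obtain ⟨l', hl'⟩ : ∃ l' : Fin k, (l' : ℕ) = l + 1 := ⟨⟨l + 1, by omega⟩, rfl⟩
      have huniq : ∀ l'' : Fin k, (l'' : ℕ) = l + 1 → l'' = l' := fun l'' h => Fin.ext (by omega)
      rw [hs.left_step n hn l l' hl', add_mul]
      refine norm_add_le_of_le (norm_sum_le (hn.2 l) (fun i hi => hu _ (update_mem_weylChamber hn
        (Finset.mem_Ioc.1 hi).2 fun l'' hl'' => ?_)) hB) ?_
      · rw [huniq l'' hl'']
        exact (Finset.mem_Ioc.1 hi).1.le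
      · rw [norm_mul, mul_assoc]
        refine mul_le_mul_of_nonneg_left (h u U Z hs B hB hu l' (by omega) _
          (update_mem_weylChamber hn (hn.1 (by rw [Fin.le_def]; omega)) fun l'' hl'' => ?_))
          (norm_nonneg _)
        rw [huniq l'' hl'']

lemma exists_norm_right_le (q : ℝ) (a : Fin N → ℝ) (k : ℕ) : ∃ C, 0 ≤ C ∧
    ∀ (u : (Fin k → ℕ) → ℂ) (U Z : Fin k → (Fin k → ℕ) → ℂ), MomentSystem q a u U Z →
      ∀ B, 0 ≤ B → (∀ n ∈ weylChamber k N, ‖u n‖ ≤ B) →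
        ∀ l, ∀ n ∈ weylChamber k N, (∀ j, 0 < n j) → ‖Z l n‖ ≤ C * B := by
  suffices H : ∀ d : ℕ, ∃ C, 0 ≤ C ∧
      ∀ (u : (Fin k → ℕ) → ℂ) (U Z : Fin k → (Fin k → ℕ) → ℂ), MomentSystem q a u U Z →
        ∀ B, 0 ≤ B → (∀ n ∈ weylChamber k N, ‖u n‖ ≤ B) →
          ∀ l : Fin k, k ≤ l + d → ∀ n ∈ weylChamber k N, (∀ j, 0 < n j) → ‖Z l n‖ ≤ C * B by
    obtain ⟨C, hC, h⟩ := H k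
    exact ⟨C, hC, fun u U Z hs B hB hu l => h u U Z hs B hB hu l (Nat.le_add_left _ _)⟩
  intro d
  induction d with
  | zero => exact ⟨0, le_rfl, fun _ _ _ _ _ _ _ l hl => absurd l.2 (by omega)⟩
  | succ d ih =>
    obtain ⟨C, hC, h⟩ := ih
    set A := ∑ i ∈ Finset.Ioc 0 N, ‖(rateAt a i : ℂ)‖ with hA
    have hA0 : 0 ≤ A := Finset.sum_nonneg fun _ _ => norm_nonneg _
    refine ⟨A * 2 + ‖(q : ℂ)‖ * C, by positivity, fun u U Z hs B hB hu l hl n hn hpos => ?_⟩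
    by_cases hnext : ∃ l' : Fin k, (l' : ℕ) = l + 1 ∧ n l' = n l
    · obtain ⟨l', hl', hnl⟩ := hnext
      rw [hs.right_step n hn hpos l l' hl' hnl, norm_mul, add_mul, mul_assoc ‖(q : ℂ)‖]
      refine (mul_le_mul_of_nonneg_left (h u U Z hs B hB hu l' (by omega) n hn hpos)
        (norm_nonneg _)).trans ?_
      have : 0 ≤ A * 2 * B := by positivity
      linarith
    · have hlt : ∀ l' : Fin k, (l' : ℕ) = l + 1 → n l' < n l := fun l' hl' =>
        lt_of_le_of_ne (hn.1 (by rw [Fin.le_def]; omega)) fun e => hnext ⟨l', hl', e⟩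
      rw [hs.right_last n hn hpos l hlt, norm_mul]
      have h1 : ‖(rateAt a (n l) : ℂ)‖ ≤ A :=
        Finset.single_le_sum (f := fun i => ‖(rateAt a i : ℂ)‖) (fun _ _ => norm_nonneg _)
          (Finset.mem_Ioc.2 ⟨hpos l, hn.2 l⟩)
      have h2 : ‖u n - u (Function.update n l (n l - 1))‖ ≤ B + B :=
        norm_sub_le_of_le (hu n hn) (hu _ (update_mem_weylChamber hn (Nat.sub_le _ _)
          fun l' hl' => Nat.le_sub_one_of_lt (hlt l' hl')))
      have h3 : 0 ≤ ‖(q : ℂ)‖ * C * B := by positivity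
      have h4 := mul_le_mul h1 h2 (norm_nonneg _) hA0
      linarith

/-- The moments are determined by their initial values. -/
theorem eq_zero_of_hasDerivWithinAt {α β : ℂ} {u : ℝ → (Fin k → ℕ) → ℂ}
    {U Z : ℝ → Fin k → (Fin k → ℕ) → ℂ} (hs : ∀ t, 0 ≤ t → MomentSystem q a (u t) (U t) (Z t))
    (hu : ∀ n ∈ weylChamber k N, (∀ j, 0 < n j) → ∀ t, 0 ≤ t →
      HasDerivWithinAt (fun t => u t n) (α * ∑ l, Z t l n + β * ∑ l, U t l n) (Set.Ici t) t)
    (hc : ∀ n ∈ weylChamber k N, (∀ j, 0 < n j) → ContinuousOn (fun t => u t n) (Set.Ici 0))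
    (h0 : ∀ n ∈ weylChamber k N, (∀ j, 0 < n j) → u 0 n = 0)
    {n : Fin k → ℕ} (hn : n ∈ weylChamber k N) {t : ℝ} (ht : 0 ≤ t) : u t n = 0 := by
  classical
  obtain ⟨CU, hCU, hU⟩ := exists_norm_left_le q a k
  obtain ⟨CZ, hCZ, hZ⟩ := exists_norm_right_le q a k
  have : Fintype (weylChamber k N) := (finite_weylChamber k N).fintype
  have hnp : ∀ n ∈ weylChamber k N, ¬ (∀ j, 0 < n j) → ∀ t, 0 ≤ t → u t n = 0 := by
    intro n hn hpos t ht
    push Not at hpos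
    obtain ⟨j, hj⟩ := hpos
    exact (hs t ht).eq_zero n hn j (by omega)
  set f : ℝ → (weylChamber k N → ℂ) := fun t n => u t n with hf
  -- Entries with a zero label vanish identically by `eq_zero`, so their derivative is zero and no
  -- equation is required for them.
  set f' : ℝ → (weylChamber k N → ℂ) := fun t n => if ∀ j, 0 < n.1 j then
    α * ∑ l, Z t l n + β * ∑ l, U t l n else 0 with hf'
  set K : ℝ := ‖α‖ * (k * CZ) + ‖β‖ * (k * CU) with hK
  have hK0 : 0 ≤ K := by positivity
  have hfc : ContinuousOn f (Set.Icc 0 t) := by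
    refine continuousOn_pi.2 fun n => ?_
    by_cases hpos : ∀ j, 0 < n.1 j
    · exact (hc n n.2 hpos).mono Set.Icc_subset_Ici_self
    · exact continuousOn_const.congr fun s hs => hnp n n.2 hpos s hs.1
  have hfd : ∀ x ∈ Set.Ico 0 t, HasDerivWithinAt f (f' x) (Set.Ici x) x := by
    intro x hx
    refine hasDerivWithinAt_pi.2 fun n => ?_
    by_cases hpos : ∀ j, 0 < n.1 j
    · simpa only [hf', if_pos hpos] using hu n n.2 hpos x hx.1
    · simp only [hf', if_neg hpos]
      exact (hasDerivWithinAt_const x _ (0 : ℂ)).congr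
        (fun s hs => hnp n n.2 hpos s (hx.1.trans hs)) (hnp n n.2 hpos x hx.1)
  have hf0 : ‖f 0‖ ≤ 0 := by
    rw [norm_le_zero_iff]
    ext n
    by_cases hpos : ∀ j, 0 < n.1 j
    · exact h0 n n.2 hpos
    · exact hnp n n.2 hpos 0 le_rfl
  have hbound : ∀ x ∈ Set.Ico 0 t, ‖f' x‖ ≤ K * ‖f x‖ + 0 := by
    intro x hx
    rw [add_zero, pi_norm_le_iff_of_nonneg (by positivity)]
    intro n
    by_cases hpos : ∀ j, 0 < n.1 j
    · simp only [hf', if_pos hpos]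
      have hB : ∀ m ∈ weylChamber k N, ‖u x m‖ ≤ ‖f x‖ := fun m hm => norm_le_pi_norm (f x) ⟨m, hm⟩
      have h1 : ‖∑ l, Z x l n‖ ≤ k * (CZ * ‖f x‖) := by
        refine (norm_sum_le_of_le _ fun l _ =>
          hZ _ _ _ (hs x hx.1) _ (norm_nonneg _) hB l n n.2 hpos).trans_eq ?_
        simp
      have h2 : ‖∑ l, U x l n‖ ≤ k * (CU * ‖f x‖) := by
        refine (norm_sum_le_of_le _ fun l _ =>
          hU _ _ _ (hs x hx.1) _ (norm_nonneg _) hB l n n.2).trans_eq ?_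
        simp
      refine (norm_add_le _ _).trans ?_
      rw [norm_mul, norm_mul]
      have h3 := mul_le_mul_of_nonneg_left h1 (norm_nonneg α)
      have h4 := mul_le_mul_of_nonneg_left h2 (norm_nonneg β)
      rw [hK]
      linarith
    · simp only [hf', if_neg hpos, norm_zero]
      positivity
  have := norm_le_gronwallBound_of_norm_deriv_right_le hfc hfd hf0 hbound t ⟨ht, le_rfl⟩
  rw [gronwallBound_ε0_δ0] at this
  have h00 : f t = 0 := norm_le_zero_iff.1 this
  exact congrFun h00 ⟨n, hn⟩

end MomentSystem

end Uniqueness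

end QPushASEP

namespace QPushASEP

/-! ### The algebra of the generator on the observables -/

section Observables

variable {N k : ℕ} {q R L : ℝ} {a : Fin N → ℝ}

/-- The product of the observables `q ^ (x_{n_i} + n_i)`. -/
def obsProd (q : ℝ) (n : Fin k → ℕ) (x : Fin N → ℤ) : ℝ := ∏ i, qObservable q x (n i)

lemma qObservable_zero (x : Fin N → ℤ) : qObservable q x 0 = 0 := by simp [qObservable]

lemma qObservable_of_lt (x : Fin N → ℤ) {m : ℕ} (hm : N < m) : qObservable q x m = 0 := by
  rw [qObservable, dif_neg (by omega)]

lemma qObservable_pos (hq : 0 < q) (x : Fin N → ℤ) {m : ℕ} (hm : 0 < m) (hmN : m ≤ N) :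
    0 < qObservable q x m := by
  rw [qObservable, dif_pos ⟨hm, hmN⟩]
  positivity

/-- With zero-based `m` the gap lies between the particles with one-based labels `m` and `m + 1`.
The case `m = 0` agrees with the convention that the observable with label zero vanishes. -/
lemma qGap_eq_div (hq : 0 < q) (x : Fin N → ℤ) {m : ℕ} (hm : m < N) :
    qGap q x m = qObservable q x m / qObservable q x (m + 1) := by
  rcases Nat.eq_zero_or_pos m with rfl | h0
  · simp [qGap, qObservable_zero]
  · rw [qGap, dif_pos ⟨h0, hm⟩, qObservable, dif_pos ⟨h0, hm.le⟩, qObservable,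
      dif_pos ⟨by omega, by omega⟩, ← zpow_sub₀ hq.ne']
    congr 1
    simp only [Nat.add_sub_cancel]
    push_cast
    ring

lemma qGap_nonneg (hq : 0 < q) (x : Fin N → ℤ) (m : ℕ) : 0 ≤ qGap q x m := by
  unfold qGap
  split_ifs <;> positivity

lemma qGap_le_one (hq : 0 < q) (hq1 : q ≤ 1) {x : Fin N → ℤ} (hx : StrictAnti x) (m : ℕ) :
    qGap q x m ≤ 1 := by
  unfold qGap
  split_ifs with h
  · have hlt : x ⟨m, h.2⟩ < x ⟨m - 1, by omega⟩ := hx (by rw [Fin.lt_def]; simp only; omega)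
    obtain ⟨e, he⟩ := Int.eq_ofNat_of_zero_le
      (by omega : 0 ≤ x ⟨m - 1, by omega⟩ - x ⟨m, h.2⟩ - 1)
    rw [he, zpow_natCast]
    exact pow_le_one₀ hq.le hq1
  · exact zero_le_one

lemma prod_qGap (hq : 0 < q) (x : Fin N → ℤ) {i j : ℕ} (hij : i ≤ j) (hj : j < N) :
    ∏ m ∈ Finset.Ioc i j, qGap q x m =
      qObservable q x (i + 1) / qObservable q x (j + 1) := by
  induction j, hij using Nat.le_induction with
  | base =>
    have := (qObservable_pos hq x (Nat.succ_pos i) hj).ne'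
    simp only [Nat.succ_eq_add_one] at this
    simp [this]
  | succ j hij ih =>
    have h1 := (qObservable_pos hq x (Nat.succ_pos j) (by omega)).ne'
    simp only [Nat.succ_eq_add_one] at h1
    rw [← Finset.insert_Ioc_right_eq_Ioc_add_one hij, Finset.prod_insert (by simp),
      ih (by omega), qGap_eq_div hq x hj]
    field_simp

/-- This puts the probability of stopping at `j` into a form that telescopes in `j`. For the last
particle the gap factor is zero by definition, and the inverse of the zero observable with label `N
+ 1` is zero as well, so the formula persists. -/
lemma inv_mul_one_sub_qGap (hq : 0 < q) (x : Fin N → ℤ) {j : ℕ} (hj : j < N) :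
    (qObservable q x (j + 1))⁻¹ * (1 - qGap q x (j + 1)) =
      (qObservable q x (j + 1))⁻¹ - (qObservable q x (j + 2))⁻¹ := by
  have h1 := (qObservable_pos hq x (Nat.succ_pos j) hj).ne'
  simp only [Nat.succ_eq_add_one] at h1
  rcases (Nat.succ_le_of_lt hj).eq_or_lt with h | h
  · rw [qObservable_of_lt x (by omega : N < j + 2), qGap, dif_neg (by omega)]
    simp
  · rw [qGap_eq_div hq x h]
    field_simp

lemma rateLeft_eq (hq : 0 < q) (x : Fin N → ℤ) {i j : Fin N} (hij : i ≤ j) :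
    rateLeft q L a x i j = (a i)⁻¹ * L * qObservable q x (i + 1) *
      ((qObservable q x (j + 1))⁻¹ - (qObservable q x (j + 2))⁻¹) := by
  rw [rateLeft, prod_qGap hq x hij j.2, ← inv_mul_one_sub_qGap hq x j.2]
  ring

lemma qObservable_jumpRight (hq : 0 < q) (x : Fin N → ℤ) (i : Fin N) (m : ℕ) :
    qObservable q (jumpRight x i) m =
      (if m = i + 1 then q else 1) * qObservable q x m := by
  unfold qObservable
  split_ifs with h1 h2 h2
  · have hi : (⟨m - 1, by omega⟩ : Fin N) = i := Fin.ext (by simp only; omega)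
    rw [jumpRight, hi, Function.update_self, ← zpow_one_add₀ hq.ne']
    congr 1
    ring
  · have hi : (⟨m - 1, by omega⟩ : Fin N) ≠ i := fun e => h2 (by
      have := congrArg Fin.val e
      simp only at this
      omega)
    rw [jumpRight, Function.update_of_ne hi, one_mul]
  · simp
  · simp

lemma qObservable_jumpLeft (hq : 0 < q) (x : Fin N → ℤ) (i j : Fin N) (m : ℕ) :
    qObservable q (jumpLeft x i j) m =
      (if (i : ℕ) + 1 ≤ m ∧ m ≤ j + 1 then q⁻¹ else 1) * qObservable q x m := by
  unfold qObservable
  by_cases h1 : 0 < m ∧ m ≤ N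
  · rw [dif_pos h1, dif_pos h1, jumpLeft]
    by_cases h2 : (i : ℕ) + 1 ≤ m ∧ m ≤ j + 1
    · rw [if_pos h2, if_pos ⟨by rw [Fin.le_def]; simp only; omega,
        by rw [Fin.le_def]; simp only; omega⟩, ← zpow_neg_one, ← zpow_add₀ hq.ne']
      congr 1
      ring
    · rw [if_neg h2, if_neg (by simp only [Fin.le_def]; omega), one_mul]
  · rw [dif_neg h1, dif_neg h1, mul_zero]

/-- Changing the factors one after another distributes the effect of a single jump over the `k`
factors. The product over later indices is the source of the powers of `q` in `leftSum` and
`rightSum`. -/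
lemma prod_sub_one_eq_sum {α : Type*} [CommRing α] (c : Fin k → α) :
    ∏ l, c l - 1 = ∑ l, (c l - 1) * ∏ l' ∈ Finset.Ioi l, c l' := by
  induction k with
  | zero => simp
  | succ k ih =>
    rw [Fin.prod_univ_succ, Fin.sum_univ_succ]
    have h0 : ∏ l' ∈ Finset.Ioi (0 : Fin (k + 1)), c l' = ∏ l : Fin k, c l.succ := by
      rw [Fin.Ioi_zero_eq_map, Finset.prod_map]
      simp
    have hs : ∀ l : Fin k, ∏ l' ∈ Finset.Ioi l.succ, c l' = ∏ l' ∈ Finset.Ioi l, c l'.succ :=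
      fun l => by
        rw [← Fin.map_succEmb_Ioi, Finset.prod_map]
        simp
    simp only [h0, hs]
    rw [← ih fun l => c l.succ]
    ring

/-- The contribution of the left jumps to the evolution of the `l`-th factor. -/
def leftSum (q : ℝ) (a : Fin N → ℝ) (u : (Fin k → ℕ) → ℂ) (l : Fin k) (n : Fin k → ℕ) : ℂ :=
  ∑ i ∈ Finset.Ioc 0 (n l), (rateAt a i : ℂ)⁻¹ *
    ((∏ l' ∈ Finset.Ioi l, if i ≤ n l' then (q : ℂ)⁻¹ else 1) * u (Function.update n l i))

/-- The contribution of the right jumps to the evolution of the `l`-th factor. -/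
def rightSum (q : ℝ) (a : Fin N → ℝ) (u : (Fin k → ℕ) → ℂ) (l : Fin k) (n : Fin k → ℕ) : ℂ :=
  rateAt a (n l) * ((∏ l' ∈ Finset.Ioi l, if n l' = n l then (q : ℂ) else 1) *
    (u n - u (Function.update n l (n l - 1))))

/-- Only the symmetry of `u` in its labels is needed. It identifies the configurations that arise
from neighbouring factors, while the ordering of `n` decides which of the later factors carry a
power of `q`. -/
theorem momentSystem_of_symmetric (q : ℝ) (a : Fin N → ℝ) {u : (Fin k → ℕ) → ℂ}
    (hu0 : ∀ n j, n j = 0 → u n = 0)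
    (hsym : ∀ (n : Fin k → ℕ) (l l' : Fin k) (i : ℕ), l ≠ l' →
      u (Function.update (Function.update n l (n l')) l' i) = u (Function.update n l i)) :
    MomentSystem q a u (leftSum q a u) (rightSum q a u) where
  eq_zero n _ j hj := hu0 n j hj
  left_last n _ l hl := by
    have hI : Finset.Ioi l = ∅ := by
      ext l'
      have := l'.2
      simp only [Finset.mem_Ioi, Fin.lt_def, Finset.notMem_empty, iff_false]
      omega
    simp [leftSum, hI]
  left_step n hn l l' hl := by
    have hle : n l' ≤ n l := hn.1 (by rw [Fin.le_def]; omega)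
    have hne : l ≠ l' := fun e => by rw [e] at hl; omega
    have hI : Finset.Ioi l = insert l' (Finset.Ioi l') := by
      ext l''
      simp only [Finset.mem_Ioi, Fin.lt_def, Finset.mem_insert, Fin.ext_iff]
      omega
    have hIoc : Finset.Ioc 0 (n l) = Finset.Ioc (n l') (n l) ∪ Finset.Ioc 0 (n l') := by
      ext i
      simp only [Finset.mem_Ioc, Finset.mem_union]
      omega
    have hdisj : Disjoint (Finset.Ioc (n l') (n l)) (Finset.Ioc 0 (n l')) :=
      Finset.disjoint_left.2 fun i hi hi' => by
        simp only [Finset.mem_Ioc] at hi hi'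
        omega
    rw [leftSum, hIoc, Finset.sum_union hdisj, leftSum]
    congr 1
    · refine Finset.sum_congr rfl fun i hi => ?_
      rw [Finset.prod_eq_one, one_mul]
      intro l'' hl''
      have : n l'' ≤ n l' := hn.1 (by
        simp only [Finset.mem_Ioi, Fin.lt_def] at hl''
        rw [Fin.le_def]; omega)
      rw [if_neg]
      have := (Finset.mem_Ioc.1 hi).1
      omega
    · rw [Function.update_of_ne hne.symm, Finset.mul_sum]
      refine Finset.sum_congr rfl fun i hi => ?_
      -- For `i ≤ n l'` the factor `l'` contributes exactly one `q⁻¹`, and symmetry moves the label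
      -- `i` from position `l` to `l'`.
      rw [hI, Finset.prod_insert (by simp), if_pos (Finset.mem_Ioc.1 hi).2, hsym n l l' i hne]
      have hprod : ∏ l'' ∈ Finset.Ioi l',
          (if i ≤ Function.update n l (n l') l'' then (q : ℂ)⁻¹ else 1) =
          ∏ l'' ∈ Finset.Ioi l', if i ≤ n l'' then (q : ℂ)⁻¹ else 1 := by
        refine Finset.prod_congr rfl fun l'' hl'' => ?_
        rw [Function.update_of_ne]
        rintro rfl
        simp only [Finset.mem_Ioi, Fin.lt_def] at hl''
        omega
      rw [hprod]
      ring
  right_last n hn _ l hl := by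
    rw [rightSum, Finset.prod_eq_one, one_mul]
    intro l'' hl''
    rw [Finset.mem_Ioi, Fin.lt_def] at hl''
    have h2 := l''.2
    have h3 := hl ⟨l + 1, by omega⟩ rfl
    have : n l'' ≤ n ⟨l + 1, by omega⟩ := hn.1 (by rw [Fin.le_def]; exact hl'')
    rw [if_neg]
    omega
  right_step n _ _ l l' hl hnl := by
    have hne : l ≠ l' := fun e => by rw [e] at hl; omega
    have hI : Finset.Ioi l = insert l' (Finset.Ioi l') := by
      ext l''
      simp only [Finset.mem_Ioi, Fin.lt_def, Finset.mem_insert, Fin.ext_iff]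
      omega
    have hu : u (Function.update n l (n l - 1)) = u (Function.update n l' (n l' - 1)) := by
      rw [← hsym n l l' _ hne, hnl, Function.update_eq_self]
    rw [rightSum, rightSum, hI, Finset.prod_insert (by simp), if_pos hnl, hu, hnl]
    ring

lemma obsProd_eq_zero {n : Fin k → ℕ} {j : Fin k} (hj : n j = 0) (x : Fin N → ℤ) :
    obsProd q n x = 0 :=
  Finset.prod_eq_zero (Finset.mem_univ j) (by rw [hj, qObservable_zero])

lemma obsProd_update (n : Fin k → ℕ) (l : Fin k) (i : ℕ) (x : Fin N → ℤ) :
    obsProd q (Function.update n l i) x =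
      qObservable q x i * ∏ j ∈ Finset.univ.erase l, qObservable q x (n j) := by
  rw [obsProd, ← Finset.mul_prod_erase Finset.univ _ (Finset.mem_univ l), Function.update_self]
  congr 1
  exact Finset.prod_congr rfl fun j hj => by rw [Function.update_of_ne (Finset.ne_of_mem_erase hj)]

lemma obsProd_update_update (n : Fin k → ℕ) {l l' : Fin k} (i : ℕ) (hne : l ≠ l')
    (x : Fin N → ℤ) :
    obsProd q (Function.update (Function.update n l (n l')) l' i) x =
      obsProd q (Function.update n l i) x := by
  have h : Function.update (Function.update n l (n l')) l' i =
      Function.update n l i ∘ Equiv.swap l l' := by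
    ext j
    simp only [Function.comp_apply, Equiv.swap_apply_def]
    by_cases hj : j = l'
    · subst hj
      simp [hne.symm]
    · by_cases hj' : j = l
      · subst hj'
        simp [hne, hne.symm]
      · simp [hj, hj']
  rw [h]
  exact Equiv.prod_comp (Equiv.swap l l') fun j => qObservable q x (Function.update n l i j)

lemma obsProd_update_eq_div (hq : 0 < q) {n : Fin k → ℕ} {l : Fin k} (hl : 0 < n l)
    (hlN : n l ≤ N) (i : ℕ) (x : Fin N → ℤ) :
    obsProd q (Function.update n l i) x =
      qObservable q x i * (qObservable q x (n l))⁻¹ * obsProd q n x := by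
  have h := obsProd_update (q := q) n l (n l) x
  rw [Function.update_eq_self] at h
  have := (qObservable_pos hq x hl hlN).ne'
  rw [obsProd_update, h]
  field_simp

/-- A right jump multiplies by `q` every factor that carries the label of the jumping particle.
After telescoping, the rate factor `1 - y_{m-1} / y_m` with `m = n l` turns the product into the
difference of the product for `n` and the one with `n l` lowered by one. -/
lemma sum_right_generator (hq : 0 < q) {n : Fin k → ℕ} (hn : n ∈ weylChamber k N)
    (hpos : ∀ j, 0 < n j) (x : Fin N → ℤ) :
    ∑ i : Fin N, rateRight q R a x i * (obsProd q n (jumpRight x i) - obsProd q n x) =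
      R * (q - 1) * ∑ l, rateAt a (n l) * ((∏ l' ∈ Finset.Ioi l, if n l' = n l then q else 1) *
        (obsProd q n x - obsProd q (Function.update n l (n l - 1)) x)) := by
  have h1 : ∀ i : Fin N, obsProd q n (jumpRight x i) - obsProd q n x =
      ∑ l, if n l = i + 1 then (q - 1) * (∏ l' ∈ Finset.Ioi l, if n l' = n l then q else 1) *
        obsProd q n x else 0 := by
    intro i
    have : obsProd q n (jumpRight x i) - obsProd q n x =
        (∏ l, (if n l = i + 1 then q else 1) - 1) * obsProd q n x := by
      simp only [obsProd, qObservable_jumpRight hq, Finset.prod_mul_distrib]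
      ring
    rw [this, prod_sub_one_eq_sum, Finset.sum_mul]
    refine Finset.sum_congr rfl fun l _ => ?_
    by_cases h : n l = i + 1
    · simp only [h, if_true]
    · simp only [h, if_false, sub_self, zero_mul]
  simp only [h1, Finset.mul_sum]
  rw [Finset.sum_comm]
  refine Finset.sum_congr rfl fun l _ => ?_
  have hl := hpos l
  have hlN := hn.2 l
  have hi : ∀ i : Fin N, n l = i + 1 ↔ i = ⟨n l - 1, by omega⟩ := fun i => by
    rw [Fin.ext_iff]
    simp only
    omega
  simp only [hi, mul_ite, mul_zero]
  rw [Finset.sum_ite_eq' Finset.univ, if_pos (Finset.mem_univ _),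
    obsProd_update_eq_div hq hl hlN, rateRight, rateAt, dif_pos ⟨hl, hlN⟩,
    qGap_eq_div hq x (by omega : n l - 1 < N), Nat.sub_add_cancel hl]
  ring

/-- The sum telescopes, and its upper end vanishes because the observable with label `N + 1` is zero
and so is its inverse. -/
lemma sum_inv_qObservable (x : Fin N → ℤ) {m : ℕ} (hm : 0 < m) (hmN : m ≤ N) :
    ∑ j : Fin N, (if m ≤ j + 1 then (qObservable q x (j + 1))⁻¹ - (qObservable q x (j + 2))⁻¹
      else 0) = (qObservable q x m)⁻¹ := by
  rw [Fin.sum_univ_eq_sum_range (fun j => if m ≤ j + 1 then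
    (qObservable q x (j + 1))⁻¹ - (qObservable q x (j + 2))⁻¹ else 0) N]
  have key : ∀ M, m ≤ M → ∑ j ∈ Finset.range M, (if m ≤ j + 1 then
      (qObservable q x (j + 1))⁻¹ - (qObservable q x (j + 2))⁻¹ else 0) =
      (qObservable q x m)⁻¹ - (qObservable q x (M + 1))⁻¹ := by
    intro M hM
    induction M, hM using Nat.le_induction with
    | base =>
      obtain ⟨m, rfl⟩ := Nat.exists_eq_succ_of_ne_zero hm.ne'
      rw [Finset.sum_range_succ, Finset.sum_eq_zero fun j hj => if_neg (by
        have := Finset.mem_range.1 hj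
        omega)]
      simp
    | succ M hM ih =>
      rw [Finset.sum_range_succ, ih, if_pos (by omega)]
      ring
  rw [key N hmN, qObservable_of_lt x (Nat.lt_succ_self N)]
  simp

/-- A jump of the block from `i` to `j` multiplies by `q⁻¹` the factors with labels in the block.
Summing the rates over all `j` with `n l` in the block leaves `y_i / y_{n l}`, which replaces the
label `n l` by that of the particle starting the jump. -/
lemma sum_left_generator (hq : 0 < q) {n : Fin k → ℕ} (hn : n ∈ weylChamber k N)
    (hpos : ∀ j, 0 < n j) (x : Fin N → ℤ) :
    ∑ i : Fin N, ∑ j ∈ Finset.Ici i,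
        rateLeft q L a x i j * (obsProd q n (jumpLeft x i j) - obsProd q n x) =
      L * (q⁻¹ - 1) * ∑ l, ∑ i ∈ Finset.Ioc 0 (n l), (rateAt a i)⁻¹ *
        ((∏ l' ∈ Finset.Ioi l, if i ≤ n l' then q⁻¹ else 1) *
          obsProd q (Function.update n l i) x) := by
  have h1 : ∀ i j : Fin N, obsProd q n (jumpLeft x i j) - obsProd q n x =
      ∑ l, if (i : ℕ) + 1 ≤ n l ∧ n l ≤ j + 1 then (q⁻¹ - 1) *
        (∏ l' ∈ Finset.Ioi l, if (i : ℕ) + 1 ≤ n l' then q⁻¹ else 1) * obsProd q n x else 0 := by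
    intro i j
    have : obsProd q n (jumpLeft x i j) - obsProd q n x =
        (∏ l, (if (i : ℕ) + 1 ≤ n l ∧ n l ≤ j + 1 then q⁻¹ else 1) - 1) * obsProd q n x := by
      simp only [obsProd, qObservable_jumpLeft hq, Finset.prod_mul_distrib]
      ring
    rw [this, prod_sub_one_eq_sum, Finset.sum_mul]
    refine Finset.sum_congr rfl fun l _ => ?_
    by_cases h : (i : ℕ) + 1 ≤ n l ∧ n l ≤ j + 1
    · rw [if_pos h, if_pos h]
      congr 2
      -- Later labels are no larger than `n l`, so the upper end of the block imposes no further
      -- condition on them.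
      refine Finset.prod_congr rfl fun l' hl' => ?_
      have : n l' ≤ n l := hn.1 (Finset.mem_Ioi.1 hl').le
      congr 1
      exact propext ⟨fun h' => h'.1, fun h' => ⟨h', this.trans h.2⟩⟩
    · rw [if_neg h, if_neg h, sub_self, zero_mul, zero_mul]
  have h2 : ∀ i : Fin N, ∑ j ∈ Finset.Ici i,
      rateLeft q L a x i j * (obsProd q n (jumpLeft x i j) - obsProd q n x) =
      ∑ l, if (i : ℕ) + 1 ≤ n l then L * (q⁻¹ - 1) * ((a i)⁻¹ *
        ((∏ l' ∈ Finset.Ioi l, if (i : ℕ) + 1 ≤ n l' then q⁻¹ else 1) *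
          obsProd q (Function.update n l (i + 1)) x)) else 0 := by
    intro i
    simp only [h1, Finset.mul_sum]
    rw [Finset.sum_comm]
    refine Finset.sum_congr rfl fun l _ => ?_
    by_cases h : (i : ℕ) + 1 ≤ n l
    · simp only [h, true_and, if_true]
      rw [obsProd_update_eq_div hq (hpos l) (hn.2 l), ← sum_inv_qObservable x (hpos l) (hn.2 l)]
      -- As `i + 1 ≤ n l`, the terms with `j < i` vanish, and the telescoping sum over all `j` may
      -- be used.
      have hsub : ∑ j : Fin N, (if n l ≤ j + 1 then
          (qObservable q x (j + 1))⁻¹ - (qObservable q x (j + 2))⁻¹ else 0) =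
          ∑ j ∈ Finset.Ici i, (if n l ≤ j + 1 then
          (qObservable q x (j + 1))⁻¹ - (qObservable q x (j + 2))⁻¹ else 0) := by
        symm
        refine Finset.sum_subset (Finset.subset_univ _) fun j _ hj => if_neg fun hj' => hj ?_
        rw [Finset.mem_Ici, Fin.le_def]
        omega
      rw [hsub, Finset.mul_sum, Finset.sum_mul, Finset.mul_sum, Finset.mul_sum, Finset.mul_sum]
      refine Finset.sum_congr rfl fun j hj => ?_
      rw [rateLeft_eq hq x (Finset.mem_Ici.1 hj)]
      split_ifs
      · ring
      · ring
    · simp [h]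
  simp only [h2]
  rw [Finset.sum_comm, Finset.mul_sum]
  refine Finset.sum_congr rfl fun l _ => ?_
  rw [Finset.mul_sum, ← Finset.sum_filter]
  refine Finset.sum_bij (fun i _ => (i : ℕ) + 1) ?_ ?_ ?_ ?_
  · intro i hi
    simp only [Finset.mem_filter, Finset.mem_univ, true_and] at hi
    simp only [Finset.mem_Ioc]
    omega
  · intro i _ j _ hij
    exact Fin.ext (by omega)
  · intro m hm
    have hlN := hn.2 l
    simp only [Finset.mem_Ioc] at hm
    exact ⟨⟨m - 1, by omega⟩, by simp; omega, by simp; omega⟩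
  · intro i _
    have := i.2
    rw [rateAt, dif_pos ⟨by omega, by omega⟩]
    simp

/-- The generator acts on the observables by a closed system. -/
theorem generator_obsProd (hq : 0 < q) {n : Fin k → ℕ} (hn : n ∈ weylChamber k N)
    (hpos : ∀ j, 0 < n j) (x : Fin N → ℤ) :
    (generator q R L a (obsProd q n) x : ℂ) =
      R * (q - 1) * ∑ l, rightSum q a (fun n => (obsProd q n x : ℂ)) l n +
        L * ((q : ℂ)⁻¹ - 1) * ∑ l, leftSum q a (fun n => (obsProd q n x : ℂ)) l n := by
  rw [generator, sum_right_generator hq hn hpos, sum_left_generator hq hn hpos]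
  push_cast
  simp only [rightSum, leftSum, apply_ite (fun r : ℝ => (r : ℂ)), Complex.ofReal_inv,
    Complex.ofReal_one]

end Observables

end QPushASEP

namespace QPushASEP

/-! ### Expectations along the process -/

section Dynkin

variable {N : ℕ} {q R L : ℝ} {a : Fin N → ℝ} {Ω : Type*} [MeasurableSpace Ω] {P : Measure Ω}
  {X : ℝ≥0 → Ω → (Fin N → ℤ)}

lemma measurable_config (f : (Fin N → ℤ) → ℝ) : Measurable f := measurable_of_countable f

/-- The point of the grid `ℕ / (m + 1)` that follows `s`. -/
def gridTime (m : ℕ) (s : ℝ) : ℝ≥0 := (⌊((m : ℝ) + 1) * s⌋₊ + 1 : ℕ) / ((m : ℝ≥0) + 1)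

lemma le_gridTime (m : ℕ) (s : ℝ) : s.toNNReal ≤ gridTime m s := by
  rw [Real.toNNReal_le_iff_le_coe, gridTime]
  push_cast
  rw [le_div_iff₀ (by positivity), mul_comm]
  exact (Nat.lt_floor_add_one _).le

lemma gridTime_le (m : ℕ) (s : ℝ) : (gridTime m s : ℝ) ≤ s.toNNReal + 1 / ((m : ℝ) + 1) := by
  have h : (⌊((m : ℝ) + 1) * s⌋₊ : ℝ) ≤ s.toNNReal * ((m : ℝ) + 1) := by
    rcases le_total 0 s with hs | hs
    · rw [Real.coe_toNNReal s hs, mul_comm s]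
      exact Nat.floor_le (by positivity)
    · rw [Real.toNNReal_of_nonpos hs,
        Nat.floor_of_nonpos (mul_nonpos_of_nonneg_of_nonpos (by positivity) hs)]
      simp
  rw [gridTime]
  push_cast
  rw [add_div]
  exact add_le_add ((div_le_iff₀ (by positivity)).2 h) le_rfl

lemma tendsto_gridTime (s : ℝ) : Tendsto (fun m => gridTime m s) atTop (𝓝[≥] s.toNNReal) := by
  refine tendsto_nhdsWithin_iff.2 ⟨?_, Eventually.of_forall fun m => le_gridTime m s⟩
  rw [← NNReal.tendsto_coe]
  refine tendsto_of_tendsto_of_tendsto_of_le_of_le tendsto_const_nhds ?_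
    (fun m => NNReal.coe_le_coe.2 (le_gridTime m s)) (fun m => gridTime_le m s)
  simpa using tendsto_const_nhds.add (tendsto_one_div_add_atTop_nhds_zero_nat (𝕜 := ℝ))

/-- A right-continuous process with measurable values is jointly measurable. -/
lemma IsQPushASEP.measurable_uncurry (hX : IsQPushASEP q R L a P X) :
    Measurable fun p : ℝ × Ω => X p.1.toNNReal p.2 := by
  have hlim : ∀ p : ℝ × Ω, Tendsto (fun m => X (gridTime m p.1) p.2) atTop
      (𝓝 (X p.1.toNNReal p.2)) := fun p =>
    (hX.right_continuous p.2 p.1.toNNReal).tendsto.comp (tendsto_gridTime p.1)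
  have hmeas : ∀ m, Measurable fun p : ℝ × Ω => X (gridTime m p.1) p.2 := fun m => by
    have h1 : Measurable fun p : ℕ × Ω => X ((p.1 + 1 : ℕ) / ((m : ℝ≥0) + 1)) p.2 :=
      measurable_from_prod_countable_right fun j =>
        (hX.stronglyMeasurable ((j + 1 : ℕ) / ((m : ℝ≥0) + 1))).measurable
    have h2 : Measurable fun p : ℝ × Ω => (⌊((m : ℝ) + 1) * p.1⌋₊, p.2) :=
      (Nat.measurable_floor.comp (measurable_fst.const_mul _)).prodMk measurable_snd
    exact h1.comp h2
  exact measurable_of_tendsto_metrizable hmeas (tendsto_pi_nhds.2 hlim)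

/-- The expectation of `f (X s)`. -/
def expect (P : Measure Ω) (X : ℝ≥0 → Ω → (Fin N → ℤ)) (f : (Fin N → ℤ) → ℝ) (s : ℝ) : ℝ :=
  ∫ ω, f (X s.toNNReal ω) ∂P

lemma IsQPushASEP.measurable_comp (hX : IsQPushASEP q R L a P X) (f : (Fin N → ℤ) → ℝ) (s : ℝ) :
    Measurable fun ω => f (X s.toNNReal ω) :=
  (measurable_config f).comp (hX.stronglyMeasurable _).measurable

lemma IsQPushASEP.measurable_comp_uncurry (hX : IsQPushASEP q R L a P X)
    (f : (Fin N → ℤ) → ℝ) : Measurable fun p : ℝ × Ω => f (X p.1.toNNReal p.2) :=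
  (measurable_config f).comp hX.measurable_uncurry

variable [IsProbabilityMeasure P]

lemma IsQPushASEP.stronglyMeasurable_expect (hX : IsQPushASEP q R L a P X)
    (f : (Fin N → ℤ) → ℝ) : StronglyMeasurable (expect P X f) :=
  (hX.measurable_comp_uncurry f).stronglyMeasurable.integral_prod_right

lemma norm_expect_le {X : ℝ≥0 → Ω → (Fin N → ℤ)} {f : (Fin N → ℤ) → ℝ} {s C : ℝ}
    (h : ∀ ω, |f (X s.toNNReal ω)| ≤ C) : ‖expect P X f s‖ ≤ C := by
  have := norm_integral_le_of_norm_le_const (μ := P)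
    (f := fun ω => f (X s.toNNReal ω)) (Eventually.of_forall h)
  simpa [expect] using this

/-- Dynkin's formula for bounded functions. -/
lemma IsQPushASEP.expect_eq_of_bounded (hX : IsQPushASEP q R L a P X) {f : (Fin N → ℤ) → ℝ}
    {C C' : ℝ} (hf : ∀ x, |f x| ≤ C) (hg : ∀ x, StrictAnti x → |generator q R L a f x| ≤ C')
    {t : ℝ} (ht : 0 ≤ t) :
    expect P X f t = expect P X f 0 + ∫ s in (0 : ℝ)..t, expect P X (generator q R L a f) s := by
  have hmart := hX.martingale f ⟨C, hf⟩
  have hint : ∀ s : ℝ, Integrable (fun ω => f (X s.toNNReal ω)) P := fun s =>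
    Integrable.of_bound (hX.measurable_comp f s).aestronglyMeasurable C
      (Eventually.of_forall fun ω => hf _)
  have hprod : Integrable (Function.uncurry fun s ω => generator q R L a f (X s.toNNReal ω))
      ((volume.restrict (Set.Ioc 0 t)).prod P) :=
    Integrable.of_bound (hX.measurable_comp_uncurry _).aestronglyMeasurable C'
      (Eventually.of_forall fun p => hg _ (hX.ordered _ _))
  have hswap := integral_integral_swap hprod
  have hE := hmart.setIntegral_eq (zero_le : (0 : ℝ≥0) ≤ t.toNNReal) MeasurableSet.univ
  simp only [setIntegral_univ, NNReal.coe_zero, intervalIntegral.integral_same, sub_zero] at hE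
  rw [Real.coe_toNNReal t ht, integral_sub (hint t) ?_] at hE
  · rw [expect, expect, Real.toNNReal_zero, hE, intervalIntegral.integral_of_le ht]
    simp only [intervalIntegral.integral_of_le ht, expect]
    rw [hswap]
    ring
  · simp only [intervalIntegral.integral_of_le ht]
    exact hprod.integral_prod_right

/-- A bound for all jump rates together. -/
def totalRate (R L : ℝ) (a : Fin N → ℝ) : ℝ :=
  (∑ i, a i * R) + ∑ i : Fin N, ∑ _j ∈ Finset.Ici i, (a i)⁻¹ * L


lemma rateRight_nonneg (hq0 : 0 < q) (hq1 : q < 1) (hR : 0 ≤ R) (ha : ∀ i, 0 < a i)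
    {x : Fin N → ℤ} (hx : StrictAnti x) (i : Fin N) :
    0 ≤ rateRight q R a x i ∧ rateRight q R a x i ≤ a i * R := by
  have h0 := qGap_nonneg hq0 x i
  have h1 := qGap_le_one hq0 hq1.le hx i
  have h2 : 0 ≤ a i * R := mul_nonneg (ha i).le hR
  exact ⟨mul_nonneg h2 (by linarith), mul_le_of_le_one_right h2 (by linarith)⟩

lemma rateLeft_nonneg (hq0 : 0 < q) (hq1 : q < 1) (hL : 0 ≤ L) (ha : ∀ i, 0 < a i)
    {x : Fin N → ℤ} (hx : StrictAnti x) (i j : Fin N) :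
    0 ≤ rateLeft q L a x i j ∧ rateLeft q L a x i j ≤ (a i)⁻¹ * L := by
  have h0 := qGap_nonneg hq0 x (j + 1)
  have h1 := qGap_le_one hq0 hq1.le hx (j + 1)
  have h2 : 0 ≤ (a i)⁻¹ * L := mul_nonneg (inv_nonneg.2 (ha i).le) hL
  have h3 : 0 ≤ ∏ m ∈ Finset.Ioc (i : ℕ) j, qGap q x m :=
    Finset.prod_nonneg fun m _ => qGap_nonneg hq0 x m
  have h4 : ∏ m ∈ Finset.Ioc (i : ℕ) j, qGap q x m ≤ 1 :=
    Finset.prod_le_one (fun m _ => qGap_nonneg hq0 x m) fun m _ => qGap_le_one hq0 hq1.le hx m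
  refine ⟨mul_nonneg (mul_nonneg h2 h3) (by linarith), ?_⟩
  exact (mul_le_of_le_one_right (mul_nonneg h2 h3) (by linarith)).trans
    (mul_le_of_le_one_right h2 h4)

lemma totalRate_nonneg (hR : 0 ≤ R) (hL : 0 ≤ L) (ha : ∀ i, 0 < a i) : 0 ≤ totalRate R L a :=
  add_nonneg (Finset.sum_nonneg fun i _ => mul_nonneg (ha i).le hR)
    (Finset.sum_nonneg fun i _ => Finset.sum_nonneg fun _ _ =>
      mul_nonneg (inv_nonneg.2 (ha i).le) hL)

lemma abs_generator_le (hq0 : 0 < q) (hq1 : q < 1) (hR : 0 ≤ R) (hL : 0 ≤ L)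
    (ha : ∀ i, 0 < a i) {x : Fin N → ℤ} (hx : StrictAnti x) {f : (Fin N → ℤ) → ℝ} {D : ℝ}
    (h1 : ∀ i, |f (jumpRight x i) - f x| ≤ D) (h2 : ∀ i j, |f (jumpLeft x i j) - f x| ≤ D) :
    |generator q R L a f x| ≤ totalRate R L a * D := by
  rw [generator, totalRate, add_mul, Finset.sum_mul, Finset.sum_mul]
  refine (abs_add_le _ _).trans (add_le_add ?_ ?_)
  · refine (Finset.abs_sum_le_sum_abs _ _).trans (Finset.sum_le_sum fun i _ => ?_)
    obtain ⟨h3, h4⟩ := rateRight_nonneg hq0 hq1 hR ha hx i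
    rw [abs_mul, abs_of_nonneg h3]
    exact mul_le_mul h4 (h1 i) (abs_nonneg _) (h3.trans h4)
  · refine (Finset.abs_sum_le_sum_abs _ _).trans (Finset.sum_le_sum fun i _ => ?_)
    rw [Finset.sum_mul]
    refine (Finset.abs_sum_le_sum_abs _ _).trans (Finset.sum_le_sum fun j _ => ?_)
    obtain ⟨h3, h4⟩ := rateLeft_nonneg hq0 hq1 hL ha hx i j
    rw [abs_mul, abs_of_nonneg h3]
    exact mul_le_mul h4 (h2 i j) (abs_nonneg _) (h3.trans h4)

/-- A function that controls the products of `k` observables. -/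
def growth (q : ℝ) (k : ℕ) (x : Fin N → ℤ) : ℝ := (∑ m, q ^ x m) ^ k

lemma growth_nonneg (hq : 0 < q) (k : ℕ) (x : Fin N → ℤ) : 0 ≤ growth q k x :=
  pow_nonneg (Finset.sum_nonneg fun _ _ => by positivity) k

/-- A jump moves each particle to the left by at most one site and so multiplies the `k`-th power by
at most `q ^ (-k)`. With bounded rates this makes `growth` a Lyapunov function. -/
lemma growth_le_of_le (hq : 0 < q) (hq1 : q < 1) (k : ℕ) {x y : Fin N → ℤ}
    (h : ∀ m, x m - 1 ≤ y m) : growth q k y ≤ (q⁻¹) ^ k * growth q k x := by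
  rw [growth, growth, ← mul_pow, Finset.mul_sum]
  refine pow_le_pow_left₀ (Finset.sum_nonneg fun _ _ => by positivity)
    (Finset.sum_le_sum fun m _ => ?_) k
  rw [← zpow_neg_one, ← zpow_add₀ hq.ne']
  exact zpow_le_zpow_right_of_le_one₀ hq hq1.le (by linarith [h m])

lemma growth_jumpRight_le (hq : 0 < q) (hq1 : q < 1) (k : ℕ) (x : Fin N → ℤ) (i : Fin N) :
    growth q k (jumpRight x i) ≤ (q⁻¹) ^ k * growth q k x :=
  growth_le_of_le hq hq1 k fun m => by
    unfold jumpRight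
    by_cases h : m = i
    · subst h
      rw [Function.update_self]
      omega
    · rw [Function.update_of_ne h]
      omega

lemma growth_jumpLeft_le (hq : 0 < q) (hq1 : q < 1) (k : ℕ) (x : Fin N → ℤ) (i j : Fin N) :
    growth q k (jumpLeft x i j) ≤ (q⁻¹) ^ k * growth q k x :=
  growth_le_of_le hq hq1 k fun m => by
    unfold jumpLeft
    split_ifs <;> omega

lemma one_le_inv_pow (hq : 0 < q) (hq1 : q < 1) (k : ℕ) : 1 ≤ (q⁻¹) ^ k :=
  one_le_pow₀ ((one_le_inv₀ hq).2 hq1.le)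

lemma expect_zero (hX0 : ∀ᵐ ω ∂P, X 0 ω = stepConfig N) (f : (Fin N → ℤ) → ℝ) :
    expect P X f 0 = f (stepConfig N) := by
  rw [expect, integral_congr_ae (g := fun _ => f (stepConfig N))]
  · simp
  · filter_upwards [hX0] with ω hω
    rw [Real.toNNReal_zero, hω]

/-- The bound for the expectation of `growth`. -/
def growthBound (q R L : ℝ) (a : Fin N → ℝ) (k : ℕ) (t : ℝ) : ℝ :=
  growth q k (stepConfig N) + totalRate R L a * (q⁻¹) ^ k *
    gronwallBound 0 (totalRate R L a * (q⁻¹) ^ k) (growth q k (stepConfig N)) t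

lemma monotone_growthBound (hq : 0 < q) (hR : 0 ≤ R) (hL : 0 ≤ L) (ha : ∀ i, 0 < a i) (k : ℕ) :
    Monotone (growthBound q R L a k) := by
  have hC : 0 ≤ totalRate R L a * (q⁻¹) ^ k :=
    mul_nonneg (totalRate_nonneg hR hL ha) (by positivity)
  have := gronwallBound_mono le_rfl (growth_nonneg hq k (stepConfig N)) hC
  intro s t hst
  unfold growthBound
  have := mul_le_mul_of_nonneg_left (this hst) hC
  linarith

lemma IsQPushASEP.intervalIntegrable_expect (hX : IsQPushASEP q R L a P X)
    {f : (Fin N → ℤ) → ℝ} {T C : ℝ} (h : ∀ s ∈ Set.Icc 0 T, ‖expect P X f s‖ ≤ C) (hT : 0 ≤ T) :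
    IntervalIntegrable (expect P X f) volume 0 T := by
  rw [intervalIntegrable_iff_integrableOn_Ioc_of_le hT]
  refine Measure.integrableOn_of_bounded (by simp)
    (hX.stronglyMeasurable_expect f).aestronglyMeasurable (M := C) ?_
  exact (ae_restrict_mem measurableSet_Ioc).mono fun s hs => h s (Set.Ioc_subset_Icc_self hs)

/-- The bound does not depend on the truncation level `M`. The truncated function satisfies the same
jump estimate, so its expectation is at most its initial value plus a constant times its own time
integral. -/
lemma IsQPushASEP.expect_min_growth_le (hX : IsQPushASEP q R L a P X) (hq0 : 0 < q) (hq1 : q < 1)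
    (hR : 0 ≤ R) (hL : 0 ≤ L) (ha : ∀ i, 0 < a i) (hX0 : ∀ᵐ ω ∂P, X 0 ω = stepConfig N)
    (k : ℕ) {M : ℝ} (hM : 0 ≤ M) {t : ℝ} (ht : 0 ≤ t) :
    expect P X (fun x => min (growth q k x) M) t ≤ growthBound q R L a k t := by
  set f : (Fin N → ℤ) → ℝ := fun x => min (growth q k x) M with hf
  set C := totalRate R L a * (q⁻¹) ^ k with hC
  have hρ := totalRate_nonneg hR hL ha
  have hc1 := one_le_inv_pow hq0 hq1 k
  have hC0 : 0 ≤ C := mul_nonneg hρ (by positivity)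
  have hf0 : ∀ x, 0 ≤ f x := fun x => le_min (growth_nonneg hq0 k x) hM
  have hfM : ∀ x, |f x| ≤ M := fun x => by
    rw [abs_of_nonneg (hf0 x)]
    exact min_le_right _ _
  have hjump : ∀ x y, growth q k y ≤ (q⁻¹) ^ k * growth q k x →
      |f y - f x| ≤ (q⁻¹) ^ k * f x := by
    intro x y hxy
    -- Because `q ^ (-k) ≥ 1`, the cap at `M` only improves the estimate.
    have h1 : f y ≤ (q⁻¹) ^ k * f x := by
      rcases min_cases (growth q k x) M with ⟨h, _⟩ | ⟨h, _⟩
      · simp only [hf]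
        rw [h]
        exact (min_le_left _ _).trans hxy
      · simp only [hf]
        rw [h]
        exact (min_le_right _ _).trans (le_mul_of_one_le_left hM hc1)
    have h2 : f x ≤ (q⁻¹) ^ k * f x := le_mul_of_one_le_left (hf0 x) hc1
    rw [abs_le]
    constructor <;> linarith [hf0 x, hf0 y]
  have hgen : ∀ x, StrictAnti x → |generator q R L a f x| ≤ C * f x := fun x hx => by
    rw [hC, mul_assoc]
    exact abs_generator_le hq0 hq1 hR hL ha hx
      (fun i => hjump x _ (growth_jumpRight_le hq0 hq1 k x i))
      (fun i j => hjump x _ (growth_jumpLeft_le hq0 hq1 k x i j))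
  have hgenM : ∀ x, StrictAnti x → |generator q R L a f x| ≤ C * M := fun x hx =>
    (hgen x hx).trans (mul_le_mul_of_nonneg_left (min_le_right _ _) hC0)
  have hint : ∀ s : ℝ, Integrable (fun ω => f (X s.toNNReal ω)) P := fun s =>
    Integrable.of_bound (hX.measurable_comp f s).aestronglyMeasurable M
      (Eventually.of_forall fun ω => hfM _)
  have hgle : ∀ s, expect P X (generator q R L a f) s ≤ C * expect P X f s := fun s => by
    rw [expect, expect, ← integral_const_mul]
    refine integral_mono (Integrable.of_bound (hX.measurable_comp _ s).aestronglyMeasurable (C * M)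
      (Eventually.of_forall fun ω => hgenM _ (hX.ordered _ _))) ((hint s).const_mul C) fun ω => ?_
    exact (le_abs_self _).trans (hgen _ (hX.ordered _ _))
  have hG : ∀ T, 0 ≤ T → IntervalIntegrable (expect P X (generator q R L a f)) volume 0 T :=
    fun T hT => hX.intervalIntegrable_expect (fun s _ => norm_expect_le fun ω =>
      hgenM _ (hX.ordered _ _)) hT
  have hF : ∀ T, 0 ≤ T → IntervalIntegrable (expect P X f) volume 0 T :=
    fun T hT => hX.intervalIntegrable_expect (fun s _ => norm_expect_le fun ω => hfM _) hT
  have hdyn : ∀ s, 0 ≤ s → expect P X f s =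
      expect P X f 0 + ∫ u in (0 : ℝ)..s, expect P X (generator q R L a f) u := fun s hs =>
    hX.expect_eq_of_bounded hfM hgenM hs
  have hinit : expect P X f 0 ≤ growth q k (stepConfig N) := by
    rw [expect_zero hX0]
    exact min_le_left _ _
  have hpos : ∀ s, 0 ≤ expect P X f s := fun s => integral_nonneg fun ω => hf0 _
  have hineq : ∀ s, 0 ≤ s → expect P X f s ≤
      growth q k (stepConfig N) + C * ∫ u in (0 : ℝ)..s, expect P X f u := fun s hs => by
    rw [hdyn s hs, ← intervalIntegral.integral_const_mul]
    exact add_le_add hinit (intervalIntegral.integral_mono_on hs (hG s hs)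
      ((hF s hs).const_mul C) fun u _ => hgle u)
  have hcont : ∀ T, 0 ≤ T → ContinuousOn (expect P X f) (Set.Icc 0 T) := fun T hT => by
    refine ContinuousOn.congr (continuousOn_const.add ?_) fun s hs => hdyn s hs.1
    have := intervalIntegral.continuousOn_primitive_interval (μ := volume) (a := 0) (b := T)
      (f := expect P X (generator q R L a f)) (by
        rw [Set.uIcc_of_le hT]
        exact (intervalIntegrable_iff_integrableOn_Icc_of_le hT).1 (hG T hT))
    rwa [Set.uIcc_of_le hT] at this
  -- Grönwall's inequality is applied to the integral `Φ`, whose derivative is the expectation; the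
  -- integral inequality becomes `Φ' ≤ C Φ + growth` with `Φ 0 = 0`.
  set Φ : ℝ → ℝ := fun s => ∫ u in (0 : ℝ)..s, expect P X f u with hΦ
  have hΦc : ContinuousOn Φ (Set.Icc 0 t) := by
    have := intervalIntegral.continuousOn_primitive_interval (μ := volume) (a := 0) (b := t)
      (f := expect P X f) (by
        rw [Set.uIcc_of_le ht]
        exact (intervalIntegrable_iff_integrableOn_Icc_of_le ht).1 (hF t ht))
    rwa [Set.uIcc_of_le ht] at this
  have hΦd : ∀ s ∈ Set.Ico 0 t, HasDerivWithinAt Φ (expect P X f s) (Set.Ici s) s := fun s hs => by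
    refine intervalIntegral.integral_hasDerivWithinAt_right (hF s hs.1)
      (hX.stronglyMeasurable_expect f).stronglyMeasurableAtFilter ?_
    refine ((hcont t ht s ⟨hs.1, hs.2.le⟩).mono_of_mem_nhdsWithin ?_)
    exact mem_of_superset (Ioc_mem_nhdsGT hs.2)
      fun u hu => ⟨hs.1.trans hu.1.le, hu.2⟩
  have hΦ0 : ∀ s, 0 ≤ s → 0 ≤ Φ s := fun s hs =>
    intervalIntegral.integral_nonneg hs fun u _ => hpos u
  have hgron := norm_le_gronwallBound_of_norm_deriv_right_le (δ := 0) (K := C)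
    (ε := growth q k (stepConfig N)) hΦc hΦd (by simp [hΦ]) (fun s hs => by
      rw [Real.norm_of_nonneg (hpos s), Real.norm_of_nonneg (hΦ0 s hs.1)]
      linarith [hineq s hs.1]) t ⟨ht, le_rfl⟩
  rw [Real.norm_of_nonneg (hΦ0 t ht), sub_zero] at hgron
  exact (hineq t ht).trans (add_le_add le_rfl (mul_le_mul_of_nonneg_left hgron hC0))

/-- Monotone convergence removes the truncation from the uniform bound. -/
lemma IsQPushASEP.integrable_growth (hX : IsQPushASEP q R L a P X) (hq0 : 0 < q) (hq1 : q < 1)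
    (hR : 0 ≤ R) (hL : 0 ≤ L) (ha : ∀ i, 0 < a i) (hX0 : ∀ᵐ ω ∂P, X 0 ω = stepConfig N)
    (k : ℕ) {t : ℝ} (ht : 0 ≤ t) :
    Integrable (fun ω => growth q k (X t.toNNReal ω)) P ∧
      expect P X (growth q k) t ≤ growthBound q R L a k t := by
  have hV0 : ∀ x : Fin N → ℤ, 0 ≤ growth q k x := growth_nonneg hq0 k
  have hB0 : 0 ≤ growthBound q R L a k t := (integral_nonneg fun _ =>
    le_min (hV0 _) le_rfl).trans (hX.expect_min_growth_le hq0 hq1 hR hL ha hX0 k le_rfl ht)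
  have hmeas := hX.measurable_comp (growth q k) t
  have hlim : Tendsto (fun M : ℕ => ∫⁻ ω, ENNReal.ofReal (min (growth q k (X t.toNNReal ω)) M) ∂P)
      atTop (𝓝 (∫⁻ ω, ENNReal.ofReal (growth q k (X t.toNNReal ω)) ∂P)) := by
    refine lintegral_tendsto_of_tendsto_of_monotone
      (fun M => (hmeas.min measurable_const).ennreal_ofReal.aemeasurable)
      (Eventually.of_forall fun ω M M' h => ENNReal.ofReal_le_ofReal
        (min_le_min le_rfl (Nat.cast_le.2 h)))
      (Eventually.of_forall fun ω => ?_)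
    refine ENNReal.tendsto_ofReal (tendsto_const_nhds.congr' ?_)
    obtain ⟨M₀, hM₀⟩ := exists_nat_ge (growth q k (X t.toNNReal ω))
    filter_upwards [eventually_ge_atTop M₀] with M hM
    exact (min_eq_left (hM₀.trans (Nat.cast_le.2 hM))).symm
  have hle : ∫⁻ ω, ENNReal.ofReal (growth q k (X t.toNNReal ω)) ∂P ≤
      ENNReal.ofReal (growthBound q R L a k t) := by
    refine le_of_tendsto' hlim fun M => ?_
    rw [← ofReal_integral_eq_lintegral_ofReal]
    · exact ENNReal.ofReal_le_ofReal
        (hX.expect_min_growth_le hq0 hq1 hR hL ha hX0 k (Nat.cast_nonneg M) ht)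
    · refine Integrable.of_bound (hmeas.min measurable_const).aestronglyMeasurable M
        (Eventually.of_forall fun ω => ?_)
      rw [Real.norm_of_nonneg (le_min (hV0 _) (Nat.cast_nonneg M))]
      exact min_le_right _ _
    · exact Eventually.of_forall fun ω => le_min (hV0 _) (Nat.cast_nonneg M)
  have hint : Integrable (fun ω => growth q k (X t.toNNReal ω)) P := by
    refine ⟨hmeas.aestronglyMeasurable, ?_⟩
    rw [hasFiniteIntegral_iff_ofReal (Eventually.of_forall fun ω => hV0 _)]
    exact hle.trans_lt ENNReal.ofReal_lt_top
  refine ⟨hint, ?_⟩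
  rw [← ENNReal.ofReal_le_ofReal_iff hB0, expect,
    ofReal_integral_eq_lintegral_ofReal hint (Eventually.of_forall fun ω => hV0 _)]
  exact hle

lemma IsQPushASEP.integrable_of_growth (hX : IsQPushASEP q R L a P X) (hq0 : 0 < q) (hq1 : q < 1)
    (hR : 0 ≤ R) (hL : 0 ≤ L) (ha : ∀ i, 0 < a i) (hX0 : ∀ᵐ ω ∂P, X 0 ω = stepConfig N)
    {k : ℕ} {f : (Fin N → ℤ) → ℝ} {b : ℝ} (hf : ∀ x, StrictAnti x → |f x| ≤ b * growth q k x)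
    {t : ℝ} (ht : 0 ≤ t) : Integrable (fun ω => f (X t.toNNReal ω)) P :=
  ((hX.integrable_growth hq0 hq1 hR hL ha hX0 k ht).1.const_mul b).mono'
    (hX.measurable_comp f t).aestronglyMeasurable
    (Eventually.of_forall fun _ => hf _ (hX.ordered _ _))

lemma IsQPushASEP.norm_expect_le_of_growth (hX : IsQPushASEP q R L a P X) (hq0 : 0 < q)
    (hq1 : q < 1) (hR : 0 ≤ R) (hL : 0 ≤ L) (ha : ∀ i, 0 < a i)
    (hX0 : ∀ᵐ ω ∂P, X 0 ω = stepConfig N) {k : ℕ} {f : (Fin N → ℤ) → ℝ} {b : ℝ} (hb : 0 ≤ b)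
    (hf : ∀ x, StrictAnti x → |f x| ≤ b * growth q k x) {s t : ℝ} (hs : 0 ≤ s) (hst : s ≤ t) :
    ‖expect P X f s‖ ≤ b * growthBound q R L a k t := by
  obtain ⟨hint, hle⟩ := hX.integrable_growth hq0 hq1 hR hL ha hX0 k hs
  refine (norm_integral_le_of_norm_le (hint.const_mul b)
    (Eventually.of_forall fun ω => hf _ (hX.ordered _ _))).trans ?_
  rw [integral_const_mul]
  exact mul_le_mul_of_nonneg_left
    (hle.trans (monotone_growthBound hq0 hR hL ha k hst)) hb

lemma tendsto_generator {F : ℕ → (Fin N → ℤ) → ℝ} {f : (Fin N → ℤ) → ℝ}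
    (h : ∀ x, Tendsto (fun M => F M x) atTop (𝓝 (f x))) (x : Fin N → ℤ) :
    Tendsto (fun M => generator q R L a (F M) x) atTop (𝓝 (generator q R L a f x)) := by
  unfold generator
  exact (tendsto_finsetSum _ fun i _ => ((h _).sub (h _)).const_mul _).add
    (tendsto_finsetSum _ fun i _ => tendsto_finsetSum _ fun j _ => ((h _).sub (h _)).const_mul _)

lemma abs_generator_le_growth (hq0 : 0 < q) (hq1 : q < 1) (hR : 0 ≤ R) (hL : 0 ≤ L)
    (ha : ∀ i, 0 < a i) {k : ℕ} {f : (Fin N → ℤ) → ℝ} {b : ℝ} (hb : 0 ≤ b)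
    (hf : ∀ x, |f x| ≤ b * growth q k x) {x : Fin N → ℤ} (hx : StrictAnti x) :
    |generator q R L a f x| ≤
      totalRate R L a * (b * (2 * (q⁻¹) ^ k)) * growth q k x := by
  rw [mul_assoc]
  have hc1 := one_le_inv_pow hq0 hq1 k
  have hjump : ∀ y, growth q k y ≤ (q⁻¹) ^ k * growth q k x →
      |f y - f x| ≤ b * (2 * (q⁻¹) ^ k) * growth q k x := fun y hy => by
    have h1 : |f y| ≤ b * ((q⁻¹) ^ k * growth q k x) :=
      (hf y).trans (mul_le_mul_of_nonneg_left hy hb)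
    have h2 : |f x| ≤ b * ((q⁻¹) ^ k * growth q k x) := (hf x).trans
      (mul_le_mul_of_nonneg_left (le_mul_of_one_le_left (growth_nonneg hq0 k x) hc1) hb)
    have := abs_sub (f y) (f x)
    linarith
  exact abs_generator_le hq0 hq1 hR hL ha hx
    (fun i => hjump _ (growth_jumpRight_le hq0 hq1 k x i))
    (fun i j => hjump _ (growth_jumpLeft_le hq0 hq1 k x i j))

/-- Dynkin's formula for functions that are bounded by `growth`. -/
theorem IsQPushASEP.expect_eq_of_growth (hX : IsQPushASEP q R L a P X) (hq0 : 0 < q)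
    (hq1 : q < 1) (hR : 0 ≤ R) (hL : 0 ≤ L) (ha : ∀ i, 0 < a i)
    (hX0 : ∀ᵐ ω ∂P, X 0 ω = stepConfig N) {k : ℕ} {f : (Fin N → ℤ) → ℝ} {b : ℝ} (hb : 0 ≤ b)
    (hf : ∀ x, |f x| ≤ b * growth q k x) {t : ℝ} (ht : 0 ≤ t) :
    expect P X f t = expect P X f 0 + ∫ s in (0 : ℝ)..t, expect P X (generator q R L a f) s := by
  -- The truncations are bounded, dominated by `|f|` and eventually equal to `f` at each point.
  -- Their generators are dominated by a multiple of `growth` uniformly in `M`, so every term of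
  -- Dynkin's formula converges.
  set F : ℕ → (Fin N → ℤ) → ℝ := fun M x => max (-(M : ℝ)) (min (f x) M) with hF
  have hFM : ∀ (M : ℕ) x, |F M x| ≤ M := fun M x => by
    have hM : (0 : ℝ) ≤ M := Nat.cast_nonneg M
    exact abs_le.2 ⟨le_max_left _ _, max_le (by linarith) (min_le_right _ _)⟩
  have hFf : ∀ (M : ℕ) x, |F M x| ≤ |f x| := fun M x => by
    have hM : (0 : ℝ) ≤ M := Nat.cast_nonneg M
    refine abs_le.2 ⟨le_max_of_le_right (le_min (neg_abs_le _) ?_), max_le ?_ ?_⟩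
    · linarith [abs_nonneg (f x)]
    · linarith [abs_nonneg (f x)]
    · exact (min_le_left _ _).trans (le_abs_self _)
  have hFb : ∀ (M : ℕ) x, |F M x| ≤ b * growth q k x := fun M x => (hFf M x).trans (hf x)
  have hlim : ∀ x, Tendsto (fun M => F M x) atTop (𝓝 (f x)) := fun x => by
    refine tendsto_const_nhds.congr' ?_
    obtain ⟨M₀, hM₀⟩ := exists_nat_ge |f x|
    filter_upwards [eventually_ge_atTop M₀] with M hM
    have h1 : |f x| ≤ M := hM₀.trans (Nat.cast_le.2 hM)
    obtain ⟨h2, h3⟩ := abs_le.1 h1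
    simp only [hF]
    rw [min_eq_left h3, max_eq_right h2]
  set b' := totalRate R L a * (b * (2 * (q⁻¹) ^ k)) with hb'
  have hb'0 : 0 ≤ b' := mul_nonneg (totalRate_nonneg hR hL ha) (by positivity)
  have hgen : ∀ (M : ℕ) x, StrictAnti x → |generator q R L a (F M) x| ≤ b' * growth q k x :=
    fun M x hx => abs_generator_le_growth hq0 hq1 hR hL ha hb (hFb M) hx
  have hexp : ∀ s, 0 ≤ s → Tendsto (fun M => expect P X (F M) s) atTop (𝓝 (expect P X f s)) :=
    fun s hs => tendsto_integral_of_dominated_convergence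
      (fun ω => b * growth q k (X s.toNNReal ω))
      (fun M => (hX.measurable_comp (F M) s).aestronglyMeasurable)
      ((hX.integrable_growth hq0 hq1 hR hL ha hX0 k hs).1.const_mul b)
      (fun M => Eventually.of_forall fun ω => hFb M _)
      (Eventually.of_forall fun ω => hlim _)
  have hexpg : ∀ s, 0 ≤ s → Tendsto (fun M => expect P X (generator q R L a (F M)) s) atTop
      (𝓝 (expect P X (generator q R L a f) s)) :=
    fun s hs => tendsto_integral_of_dominated_convergence
      (fun ω => b' * growth q k (X s.toNNReal ω))
      (fun M => (hX.measurable_comp _ s).aestronglyMeasurable)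
      ((hX.integrable_growth hq0 hq1 hR hL ha hX0 k hs).1.const_mul b')
      (fun M => Eventually.of_forall fun ω => hgen M _ (hX.ordered _ _))
      (Eventually.of_forall fun ω => tendsto_generator hlim _)
  have hint : Tendsto (fun M => ∫ s in (0 : ℝ)..t, expect P X (generator q R L a (F M)) s) atTop
      (𝓝 (∫ s in (0 : ℝ)..t, expect P X (generator q R L a f) s)) := by
    refine intervalIntegral.tendsto_integral_filter_of_dominated_convergence
      (fun _ => b' * growthBound q R L a k t)
      (Eventually.of_forall fun M => (hX.stronglyMeasurable_expect _).aestronglyMeasurable)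
      (Eventually.of_forall fun M => Eventually.of_forall fun s hs => ?_)
      intervalIntegrable_const (Eventually.of_forall fun s hs => ?_)
    · rw [Set.uIoc_of_le ht] at hs
      exact hX.norm_expect_le_of_growth hq0 hq1 hR hL ha hX0 hb'0 (hgen M) hs.1.le hs.2
    · rw [Set.uIoc_of_le ht] at hs
      exact hexpg s hs.1.le
  refine tendsto_nhds_unique (hexp t ht) (((hexp 0 le_rfl).add hint).congr fun M => ?_)
  -- The bound depending on `M` serves only to justify Dynkin's formula for one truncation; the
  -- passage to the limit uses `hgen`.
  refine (hX.expect_eq_of_bounded (hFM M) (C' := totalRate R L a * (2 * M)) (fun x hx => ?_) ht).symm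
  have hd : ∀ y, |F M y - F M x| ≤ 2 * M := fun y => by
    have := abs_sub (F M y) (F M x)
    linarith [hFM M x, hFM M y]
  exact abs_generator_le hq0 hq1 hR hL ha hx (fun i => hd _) fun i j => hd _

lemma IsQPushASEP.continuousOn_expect (hX : IsQPushASEP q R L a P X) (hq0 : 0 < q)
    (hq1 : q < 1) (hR : 0 ≤ R) (hL : 0 ≤ L) (ha : ∀ i, 0 < a i)
    (hX0 : ∀ᵐ ω ∂P, X 0 ω = stepConfig N) {k : ℕ} {f : (Fin N → ℤ) → ℝ} {b : ℝ} (hb : 0 ≤ b)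
    (hf : ∀ x, |f x| ≤ b * growth q k x) :
    ContinuousOn (expect P X f) (Set.Ici 0) ∧
      ∀ t, 0 ≤ t → IntervalIntegrable (expect P X (generator q R L a f)) volume 0 t := by
  set b' := totalRate R L a * (b * (2 * (q⁻¹) ^ k)) with hb'
  have hb'0 : 0 ≤ b' := mul_nonneg (totalRate_nonneg hR hL ha) (by positivity)
  have hG : ∀ t, 0 ≤ t → IntervalIntegrable (expect P X (generator q R L a f)) volume 0 t :=
    fun t ht => hX.intervalIntegrable_expect (fun s hs =>
      hX.norm_expect_le_of_growth hq0 hq1 hR hL ha hX0 hb'0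
        (fun x hx => abs_generator_le_growth hq0 hq1 hR hL ha hb hf hx) hs.1 hs.2) ht
  refine ⟨fun t ht => ?_, hG⟩
  have ht' : (0 : ℝ) ≤ t := ht
  have hT : (0 : ℝ) ≤ t + 1 := by linarith
  have hcont : ContinuousOn (expect P X f) (Set.Icc 0 (t + 1)) := by
    refine ContinuousOn.congr (continuousOn_const.add ?_) fun s hs =>
      hX.expect_eq_of_growth hq0 hq1 hR hL ha hX0 hb hf hs.1
    have := intervalIntegral.continuousOn_primitive_interval (μ := volume) (a := 0) (b := t + 1)
      (f := expect P X (generator q R L a f)) (by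
        rw [Set.uIcc_of_le hT]
        exact (intervalIntegrable_iff_integrableOn_Icc_of_le hT).1 (hG _ hT))
    rwa [Set.uIcc_of_le hT] at this
  refine (hcont t ⟨ht', by linarith⟩).mono_of_mem_nhdsWithin ?_
  filter_upwards [self_mem_nhdsWithin, mem_nhdsWithin_of_mem_nhds (Iio_mem_nhds (lt_add_one t))]
    with s hs1 hs2 using ⟨hs1, hs2.le⟩

lemma IsQPushASEP.hasDerivWithinAt_expect (hX : IsQPushASEP q R L a P X) (hq0 : 0 < q)
    (hq1 : q < 1) (hR : 0 ≤ R) (hL : 0 ≤ L) (ha : ∀ i, 0 < a i)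
    (hX0 : ∀ᵐ ω ∂P, X 0 ω = stepConfig N) {k : ℕ} {f : (Fin N → ℤ) → ℝ} {b : ℝ} (hb : 0 ≤ b)
    (hf : ∀ x, |f x| ≤ b * growth q k x)
    (hg : ContinuousOn (expect P X (generator q R L a f)) (Set.Ici 0)) {t : ℝ} (ht : 0 ≤ t) :
    HasDerivWithinAt (expect P X f) (expect P X (generator q R L a f) t) (Set.Ici t) t := by
  have hd : HasDerivWithinAt (fun s => ∫ u in (0 : ℝ)..s, expect P X (generator q R L a f) u)
      (expect P X (generator q R L a f) t) (Set.Ici t) t :=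
    intervalIntegral.integral_hasDerivWithinAt_right
      ((hX.continuousOn_expect hq0 hq1 hR hL ha hX0 hb hf).2 t ht)
      (hX.stronglyMeasurable_expect _).stronglyMeasurableAtFilter
      ((hg t ht).mono fun s hs => ht.trans (le_of_lt hs))
  exact (hd.const_add (expect P X f 0)).congr
    (fun s hs => hX.expect_eq_of_growth hq0 hq1 hR hL ha hX0 hb hf (ht.trans hs))
    (hX.expect_eq_of_growth hq0 hq1 hR hL ha hX0 hb hf ht)

end Dynkin

end QPushASEP

/-! ### The moments of the process and the moment formula -/

namespace QPushASEP

section Moments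

variable {N k : ℕ} {q R L : ℝ} {a : Fin N → ℝ} {Ω : Type*} [MeasurableSpace Ω] {P : Measure Ω}
  {X : ℝ≥0 → Ω → (Fin N → ℤ)}

lemma qObservable_nonneg (hq : 0 < q) (x : Fin N → ℤ) (m : ℕ) : 0 ≤ qObservable q x m := by
  unfold qObservable
  split_ifs <;> positivity

lemma qObservable_le_sum (hq : 0 < q) (hq1 : q < 1) (x : Fin N → ℤ) (m : ℕ) :
    qObservable q x m ≤ ∑ i, q ^ x i := by
  unfold qObservable
  split_ifs with h
  · refine le_trans ?_ (Finset.single_le_sum (f := fun i => q ^ x i)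
      (fun i _ => by positivity) (Finset.mem_univ ⟨m - 1, by omega⟩))
    exact zpow_le_zpow_right_of_le_one₀ hq hq1.le (by omega)
  · exact Finset.sum_nonneg fun _ _ => by positivity

lemma abs_obsProd_le (hq : 0 < q) (hq1 : q < 1) (n : Fin k → ℕ) (x : Fin N → ℤ) :
    |obsProd q n x| ≤ 1 * growth q k x := by
  rw [one_mul, obsProd, abs_of_nonneg (Finset.prod_nonneg fun i _ => qObservable_nonneg hq x _),
    growth]
  refine (Finset.prod_le_prod (fun i _ => qObservable_nonneg hq x _)
    fun i _ => qObservable_le_sum hq hq1 x (n i)).trans_eq ?_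
  simp

lemma obsProd_stepConfig {n : Fin k → ℕ} (hpos : ∀ j, 0 < n j) (hn : ∀ j, n j ≤ N) :
    obsProd q n (stepConfig N) = 1 := by
  refine Finset.prod_eq_one fun j _ => ?_
  have h1 := hpos j
  rw [qObservable, dif_pos ⟨h1, hn j⟩, stepConfig]
  simp only
  rw [show -(((n j - 1 : ℕ) : ℤ) + 1) + (n j : ℤ) = 0 by omega, zpow_zero]

/-- The moments of the process. -/
def processMoment (P : Measure Ω) (X : ℝ≥0 → Ω → (Fin N → ℤ)) (q t : ℝ) (n : Fin k → ℕ) : ℂ :=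
  (expect P X (obsProd q n) t : ℂ)

/-- These relations are purely algebraic and use the symmetry of the products alone; the dynamics
enters through the time derivative. -/
theorem processMoment_system (P : Measure Ω) (X : ℝ≥0 → Ω → (Fin N → ℤ)) (q : ℝ)
    (a : Fin N → ℝ) (t : ℝ) :
    MomentSystem q a (processMoment (k := k) P X q t) (leftSum q a (processMoment P X q t))
      (rightSum q a (processMoment P X q t)) := by
  refine momentSystem_of_symmetric q a (fun n j hj => ?_) fun n l l' i hne => ?_
  · simp [processMoment, expect, obsProd_eq_zero hj]
  · simp only [processMoment, expect, obsProd_update_update n i hne]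

variable [IsProbabilityMeasure P]

lemma IsQPushASEP.integrable_obsProd (hX : IsQPushASEP q R L a P X) (hq0 : 0 < q)
    (hq1 : q < 1) (hR : 0 ≤ R) (hL : 0 ≤ L) (ha : ∀ i, 0 < a i)
    (hX0 : ∀ᵐ ω ∂P, X 0 ω = stepConfig N) (n : Fin k → ℕ) {t : ℝ} (ht : 0 ≤ t) :
    Integrable (fun ω => obsProd q n (X t.toNNReal ω)) P :=
  hX.integrable_of_growth hq0 hq1 hR hL ha hX0 (fun x _ => abs_obsProd_le hq0 hq1 n x) ht

lemma IsQPushASEP.expect_generator_obsProd (hX : IsQPushASEP q R L a P X) (hq0 : 0 < q)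
    (hq1 : q < 1) (hR : 0 ≤ R) (hL : 0 ≤ L) (ha : ∀ i, 0 < a i)
    (hX0 : ∀ᵐ ω ∂P, X 0 ω = stepConfig N) {n : Fin k → ℕ} (hn : n ∈ weylChamber k N)
    (hpos : ∀ j, 0 < n j) {t : ℝ} (ht : 0 ≤ t) :
    (expect P X (generator q R L a (obsProd q n)) t : ℂ) =
      R * (q - 1) * ∑ l, rightSum q a (processMoment P X q t) l n +
        L * ((q : ℂ)⁻¹ - 1) * ∑ l, leftSum q a (processMoment P X q t) l n := by
  have hint : ∀ m : Fin k → ℕ, Integrable (fun ω => (obsProd q m (X t.toNNReal ω) : ℂ)) P :=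
    fun m => (hX.integrable_obsProd hq0 hq1 hR hL ha hX0 m ht).ofReal
  have hmom : ∀ m : Fin k → ℕ, processMoment P X q t m =
      ∫ ω, (obsProd q m (X t.toNNReal ω) : ℂ) ∂P := fun m => integral_ofReal.symm
  have hright : ∀ l, Integrable (fun ω =>
      rightSum q a (fun m => (obsProd q m (X t.toNNReal ω) : ℂ)) l n) P := fun l =>
    (((hint _).sub (hint _)).const_mul _).const_mul _
  have hleft : ∀ l, Integrable (fun ω =>
      leftSum q a (fun m => (obsProd q m (X t.toNNReal ω) : ℂ)) l n) P := fun l =>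
    integrable_finsetSum _ fun i _ => ((hint _).const_mul _).const_mul _
  have hright' : ∀ l, rightSum q a (processMoment P X q t) l n =
      ∫ ω, rightSum q a (fun m => (obsProd q m (X t.toNNReal ω) : ℂ)) l n ∂P := fun l => by
    simp only [rightSum, hmom]
    rw [integral_const_mul, integral_const_mul, integral_sub (hint _) (hint _)]
  have hleft' : ∀ l, leftSum q a (processMoment P X q t) l n =
      ∫ ω, leftSum q a (fun m => (obsProd q m (X t.toNNReal ω) : ℂ)) l n ∂P := fun l => by
    simp only [leftSum, hmom]
    rw [integral_finsetSum _ fun i _ => ((hint _).const_mul _).const_mul _]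
    simp only [integral_const_mul]
  simp only [hright', hleft']
  rw [expect, ← integral_complex_ofReal, ← integral_finsetSum _ fun l _ => hright l,
    ← integral_finsetSum _ fun l _ => hleft l, ← integral_const_mul, ← integral_const_mul,
    ← integral_add ((integrable_finsetSum _ fun l _ => hright l).const_mul _)
      ((integrable_finsetSum _ fun l _ => hleft l).const_mul _)]
  exact integral_congr_ae (Eventually.of_forall fun ω => generator_obsProd hq0 hn hpos _)

lemma IsQPushASEP.continuousOn_processMoment (hX : IsQPushASEP q R L a P X) (hq0 : 0 < q)
    (hq1 : q < 1) (hR : 0 ≤ R) (hL : 0 ≤ L) (ha : ∀ i, 0 < a i)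
    (hX0 : ∀ᵐ ω ∂P, X 0 ω = stepConfig N) (n : Fin k → ℕ) :
    ContinuousOn (fun t => processMoment P X q t n) (Set.Ici 0) :=
  Complex.continuous_ofReal.comp_continuousOn
    (hX.continuousOn_expect hq0 hq1 hR hL ha hX0 zero_le_one (abs_obsProd_le hq0 hq1 n)).1

/-- Since the system is closed, the expectation of the generator is a finite combination of moments,
which are already known to be continuous. This continuity upgrades the integrated formula to a
derivative. -/
lemma IsQPushASEP.hasDerivWithinAt_processMoment (hX : IsQPushASEP q R L a P X) (hq0 : 0 < q)
    (hq1 : q < 1) (hR : 0 ≤ R) (hL : 0 ≤ L) (ha : ∀ i, 0 < a i)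
    (hX0 : ∀ᵐ ω ∂P, X 0 ω = stepConfig N) {n : Fin k → ℕ} (hn : n ∈ weylChamber k N)
    (hpos : ∀ j, 0 < n j) {t : ℝ} (ht : 0 ≤ t) :
    HasDerivWithinAt (fun t => processMoment P X q t n)
      (R * (q - 1) * ∑ l, rightSum q a (processMoment P X q t) l n +
        L * ((q : ℂ)⁻¹ - 1) * ∑ l, leftSum q a (processMoment P X q t) l n) (Set.Ici t) t := by
  have hcm := fun m : Fin k → ℕ => hX.continuousOn_processMoment hq0 hq1 hR hL ha hX0 m
  have hcont : ContinuousOn (fun t => R * (q - 1) *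
      ∑ l, rightSum q a (processMoment P X q t) l n +
        L * ((q : ℂ)⁻¹ - 1) * ∑ l, leftSum q a (processMoment P X q t) l n) (Set.Ici 0) := by
    unfold rightSum leftSum
    exact (continuousOn_const.mul (continuousOn_finsetSum _ fun l _ => continuousOn_const.mul
      (continuousOn_const.mul ((hcm _).sub (hcm _))))).add
      (continuousOn_const.mul (continuousOn_finsetSum _ fun l _ =>
        continuousOn_finsetSum _ fun i _ => continuousOn_const.mul
          (continuousOn_const.mul (hcm _))))
  have hg : ContinuousOn (expect P X (generator q R L a (obsProd q n))) (Set.Ici 0) := by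
    refine (Complex.continuous_re.comp_continuousOn hcont).congr fun s hs => ?_
    have := hX.expect_generator_obsProd hq0 hq1 hR hL ha hX0 hn hpos hs
    simp only [Function.comp_apply]
    rw [← this, Complex.ofReal_re]
  rw [← hX.expect_generator_obsProd hq0 hq1 hR hL ha hX0 hn hpos ht]
  exact (hX.hasDerivWithinAt_expect hq0 hq1 hR hL ha hX0 zero_le_one
    (abs_obsProd_le hq0 hq1 n) hg ht).ofReal_comp

theorem IsQPushASEP.processMoment_eq (hX : IsQPushASEP q R L a P X) (hq0 : 0 < q)
    (hq1 : q < 1) (hR : 0 ≤ R) (hL : 0 ≤ L) (ha : ∀ i, 0 < a i)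
    (hX0 : ∀ᵐ ω ∂P, X 0 ω = stepConfig N) {γ : Fin k → Contour} (hγ : NestedContours q a γ)
    {n : Fin k → ℕ} (hn : n ∈ weylChamber k N) {t : ℝ} (ht : 0 ≤ t) :
    processMoment P X q t n =
      (-1) ^ k * (q : ℂ) ^ (k * (k - 1) / 2) / (2 * Real.pi * Complex.I) ^ k *
        contourMoment γ q R L t a n := by
  set κ : ℂ := (-1) ^ k * (q : ℂ) ^ (k * (k - 1) / 2) / (2 * Real.pi * Complex.I) ^ k with hκ
  rw [← sub_eq_zero]
  refine MomentSystem.eq_zero_of_hasDerivWithinAt (q := q) (a := a)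
    (α := R * (q - 1)) (β := L * ((q : ℂ)⁻¹ - 1))
    (u := fun t n => processMoment P X q t n - κ * contourMoment γ q R L t a n)
    (U := fun t l n => leftSum q a (processMoment P X q t) l n -
      κ * contourMomentInv γ q R L t a l n)
    (Z := fun t l n => rightSum q a (processMoment P X q t) l n -
      κ * contourMomentMul γ q R L t a l n)
    (fun t _ => (processMoment_system P X q a t).sub_const_mul (contourMoment_system hγ hq0 ha) κ)
    (fun n hn hpos t ht => ?_) (fun n hn hpos => ?_) (fun n hn hpos => ?_) hn ht
  · refine ((hX.hasDerivWithinAt_processMoment hq0 hq1 hR hL ha hX0 hn hpos ht).sub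
      (((hasDerivAt_contourMoment hγ n t).const_mul κ).hasDerivWithinAt)).congr_deriv ?_
    rw [Finset.sum_sub_distrib, Finset.sum_sub_distrib, ← Finset.mul_sum, ← Finset.mul_sum]
    ring
  · refine (hX.continuousOn_processMoment hq0 hq1 hR hL ha hX0 n).sub
      (continuousOn_const.mul fun t _ => ?_)
    exact (hasDerivAt_contourMoment hγ n t).continuousAt.continuousWithinAt
  · rw [contourMoment_zero hq0 ha hγ hpos hn.2, processMoment, expect_zero hX0,
      obsProd_stepConfig hpos hn.2]
    simp

end Moments

end QPushASEP

end

theorem theorem1p1 {N : ℕ} (hN : 1 ≤ N) {q R L : ℝ} (hq0 : 0 < q) (hq1 : q < 1)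
    (hR : 0 ≤ R) (hL : 0 ≤ L) (hRL : R ≠ 0 ∨ L ≠ 0)
    (a : Fin N → ℝ) (ha : ∀ i, 0 < a i)
    {Ω : Type*} [MeasurableSpace Ω] (P : Measure Ω) [IsProbabilityMeasure P]
    (X : ℝ≥0 → Ω → (Fin N → ℤ)) (hX : QPushASEP.IsQPushASEP q R L a P X)
    (hX0 : ∀ᵐ ω ∂P, X 0 ω = QPushASEP.stepConfig N)
    {k : ℕ} (n : Fin k → ℕ) (hn : n ∈ QPushASEP.weylChamber k N) (t : ℝ≥0) :
    Integrable (fun ω => ∏ i, QPushASEP.qObservable q (X t ω) (n i)) P ∧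
    (∃ γ : Fin k → QPushASEP.Contour, QPushASEP.NestedContours q a γ) ∧
    ∀ γ : Fin k → QPushASEP.Contour, QPushASEP.NestedContours q a γ →
      ((∫ ω, ∏ i, QPushASEP.qObservable q (X t ω) (n i) ∂P : ℝ) : ℂ) =
        (-1) ^ k * (q : ℂ) ^ (k * (k - 1) / 2) / (2 * Real.pi * Complex.I) ^ k *
          QPushASEP.iteratedIntegral γ (QPushASEP.momentIntegrand q R L t a n) := by
  refine ⟨?_, QPushASEP.exists_nestedContours hq0 hq1 ha k, fun γ hγ => ?_⟩
  · have := hX.integrable_obsProd hq0 hq1 hR hL ha hX0 n t.coe_nonneg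
    rwa [Real.toNNReal_coe] at this
  · have hcont := hγ.continuousOn_weighted fun i =>
      QPushASEP.hasPoles_weight (q := q) (R := R) (L := L) (t := t) (n i)
    have h := hX.processMoment_eq hq0 hq1 hR hL ha hX0 hγ hn t.coe_nonneg
    rw [QPushASEP.processMoment, QPushASEP.expect, Real.toNNReal_coe] at h
    rw [funext (QPushASEP.momentIntegrand_eq n),
      QPushASEP.iteratedIntegral_eq_multiIntegral hcont]
    exact h
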